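/- **Setting.** A *completely integrable system* is a holomorphic symplectic manifold $(M,\Omega)$ with a proper flat holomorphic map $H\colon M\to B$ to a complex manifold $B$ such that, for some proper closed analytic subset $S\subsetneq B$, the fibers $M_b=H^{-1}(b)$ over $B^{\mathrm{reg}}=B\setminus S$ are (as analytic spaces, so that $H$ is a submersion along them) Lagrangian complex tori. For $b\in B^{\mathrm{reg}}$ and $\alpha\in T_b^\vee B$ let $X_\alpha$ be the invariant vector field along $M_b$ with $\Omega(X_\alpha,\cdot)=H^*\alpha$; this identifies $T_b^\vee B$ with the space $V_bM$ of invariant vector fields on $M_b$. Let $\Lambda_b\subset T_b^\vee B$ be the lattice of those $\alpha$ for which the time-one flow of $X_\alpha$ is the identity of $M_b$, so that $M_b\cong V_bM/\Lambda_b$. The integral affine structure on $B^{\mathrm{reg}}$ is given by the dual lattices $\Lambda_b^\vee=\{v\in T_bB : \operatorname{Re}\alpha(v)\in\mathbb Z \text{ for all }\alpha\in\Lambda_b\}$. A complex subspace of $T_bB$ is *rational* if it is generated, as a real vector space, by rational multiples of elements of $\Lambda_b^\vee$. A *Lagrangian subvariety* of $M$ is a closed analytic subset whose tangent space at every smooth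 point is a Lagrangian subspace. A Lagrangian subvariety $\mathcal L\subset M$ is *visible* over a closed analytic subset $B'\subsetneq B$ if $H(\mathcal L)\subset B'$ and there is a closed analytic subset $S'\subsetneq B'$ such that, over $B'^{\mathrm{reg}}=B'\setminus S'$, the map $H|_{\mathcal L}$ is a smooth (i.e. $C^\infty$ locally trivial) fiber bundle with non-empty fibers. **Theorem.** Let $H\colon M\to B$ be a completely integrable system and let $\mathcal L\to B'\subsetneq B$ be a visible Lagrangian with $B'^{\mathrm{reg}}\subset B^{\mathrm{reg}}$. Let $b\in B'^{\mathrm{reg}}$ be a smooth point of $B'$. Then: 1. $B'$ is rational at $b$ with respect to the integral affine structure on $B^{\mathrm{reg}}$, i.e. $T_bB'\subset T_bB$ is a rational subspace. 2. The fiber $\mathcal L_b=\mathcal L\cap M_b$ is a union of complex tori generated by the invariant vector fields in $T_bB'^{\perp}\subset T_b^\vee B\cong V_bM$. More precisely, every connected component of $\mathcal L_b$ is the image of an injective holomorphic immersion of a complex torus $T_bB'^{\perp}/\Gamma$, with $\Gamma$ a lattice in $T_bB'^{\perp}$, under which the constant vector field $\alpha\in T_bB'^{\perp}$ corresponds to $X_\alpha$.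 -/

import Mathlib

open Set Filter Topology Manifold
open scoped ContDiff

noncomputable section

namespace VisibleLagrangian

/-! ### Analytic subsets and their smooth points -/

section Analytic

variable {E : Type*} [NormedAddCommGroup E] [NormedSpace ℂ E]
  {X : Type*} [TopologicalSpace X] [ChartedSpace E X]

/-- A closed analytic subset of a complex manifold: around every point of the ambient manifold it
is the common zero set of finitely many holomorphic functions. -/
def IsAnalyticSubset (A : Set X) : Prop :=
  ∀ p : X, ∃ U : Set X, IsOpen U ∧ p ∈ U ∧ ∃ (k : ℕ) (f : X → (Fin k → ℂ)),
    ContMDiffOn 𝓘(ℂ, E) 𝓘(ℂ, Fin k → ℂ) ω f U ∧ A ∩ U = {x ∈ U | f x = 0}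

/-- `p` is a smooth point of `A`, and `T` is the tangent space `T_p A`: near `p`, the set `A` is
cut out by holomorphic functions with linearly independent differentials at `p`, and `T` is the
common kernel of these differentials. -/
def IsSmoothPointWithTangent (A : Set X) (p : X) (T : Submodule ℂ (TangentSpace 𝓘(ℂ, E) p)) :
    Prop :=
  p ∈ A ∧ ∃ U : Set X, IsOpen U ∧ p ∈ U ∧ ∃ (k : ℕ) (f : X → (Fin k → ℂ)),
    ContMDiffOn 𝓘(ℂ, E) 𝓘(ℂ, Fin k → ℂ) ω f U ∧ A ∩ U = {x ∈ U | f x = 0} ∧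
    Function.Surjective (mfderiv 𝓘(ℂ, E) 𝓘(ℂ, Fin k → ℂ) f p) ∧
    ∀ v : TangentSpace 𝓘(ℂ, E) p,
      v ∈ T ↔ mfderiv 𝓘(ℂ, E) 𝓘(ℂ, Fin k → ℂ) f p v = 0

variable (E) in
/-- The local ring of germs at `x` of holomorphic functions. -/
def holGerm (x : X) : Subring (Germ (𝓝 x) ℂ) where
  carrier := {g | ∃ f : X → ℂ, ContMDiffAt 𝓘(ℂ, E) 𝓘(ℂ, ℂ) ω f x ∧ g = (f : Germ (𝓝 x) ℂ)}
  mul_mem' := by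
    rintro _ _ ⟨f, hf, rfl⟩ ⟨g, hg, rfl⟩
    exact ⟨f * g, hf.mul hg, rfl⟩
  one_mem' := ⟨1, contMDiffAt_const, rfl⟩
  add_mem' := by
    rintro _ _ ⟨f, hf, rfl⟩ ⟨g, hg, rfl⟩
    exact ⟨f + g, hf.add hg, rfl⟩
  zero_mem' := ⟨0, contMDiffAt_const, rfl⟩
  neg_mem' := by
    rintro _ ⟨f, hf, rfl⟩
    exact ⟨-f, hf.neg, rfl⟩

/-- `p : V → X` presents the subset `A` of `X` as a complex torus: `p` is a holomorphic immersion
with image `A` whose fibres are the cosets of a lattice `Γ` of `V`, so that it induces an injective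
holomorphic immersion of the compact complex manifold `V / Γ` with image `A`. -/
def IsTorusParametrization {V : Type*} [NormedAddCommGroup V] [NormedSpace ℂ V]
    (p : V → X) (A : Set X) : Prop :=
  ContMDiff 𝓘(ℂ, V) 𝓘(ℂ, E) ω p ∧ range p = A ∧
  (∀ x, Function.Injective (mfderiv 𝓘(ℂ, V) 𝓘(ℂ, E) p x)) ∧
  ∃ (Γ : Submodule ℤ V) (_ : DiscreteTopology Γ) (_ : IsZLattice ℝ Γ),
    ∀ x y, p x = p y ↔ x - y ∈ Γ

variable (E) in
/-- A subset of a complex manifold that is an (embedded) complex torus. -/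
def IsComplexTorus (A : Set X) : Prop :=
  ∃ (n : ℕ) (p : EuclideanSpace ℂ (Fin n) → X), IsTorusParametrization (E := E) p A

end Analytic

/-! ### Flat holomorphic maps -/

section Flat

variable {E E' : Type*} [NormedAddCommGroup E] [NormedSpace ℂ E]
  [NormedAddCommGroup E'] [NormedSpace ℂ E']
  {X Y : Type*} [TopologicalSpace X] [ChartedSpace E X] [TopologicalSpace Y] [ChartedSpace E' Y]

/-- The pull-back homomorphism `𝒪_{Y, H x} → 𝒪_{X, x}` of local rings of a holomorphic map. -/
def germPullback (H : X → Y) (hH : ContMDiff 𝓘(ℂ, E) 𝓘(ℂ, E') ω H) (x : X) :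
    holGerm E' (H x) →+* holGerm E x where
  toFun g := ⟨g.1.compTendsto H hH.continuous.continuousAt, by
    obtain ⟨_, f, hf, rfl⟩ := g
    exact ⟨f ∘ H, ContMDiffAt.comp x hf (hH x), rfl⟩⟩
  map_one' := rfl
  map_zero' := rfl
  map_mul' := by
    rintro ⟨_, f, hf, rfl⟩ ⟨_, g, hg, rfl⟩
    rfl
  map_add' := by
    rintro ⟨_, f, hf, rfl⟩ ⟨_, g, hg, rfl⟩
    rfl

/-- A holomorphic map is flat if all its homomorphisms of local rings are flat. -/
def IsFlatMap (H : X → Y) : Prop :=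
  ∃ hH : ContMDiff 𝓘(ℂ, E) 𝓘(ℂ, E') ω H, ∀ x, (germPullback H hH x).Flat

end Flat

/-! ### Holomorphic symplectic manifolds and completely integrable systems -/

section Symplectic

variable {E : Type*} [NormedAddCommGroup E] [NormedSpace ℂ E]
  {X : Type*} [TopologicalSpace X] [ChartedSpace E X]

/-- The expression of a field of 2-forms in the preferred chart around `x₀`. -/
def chartRep (Ω : ∀ x : X, (TangentSpace 𝓘(ℂ, E) x) [⋀^Fin 2]→L[ℂ] ℂ) (x₀ : X) :
    E → E [⋀^Fin 2]→L[ℂ] ℂ := fun z =>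
  (Ω ((chartAt E x₀).symm z)).compContinuousLinearMap
    (mfderiv 𝓘(ℂ, E) 𝓘(ℂ, E) (chartAt E x₀).symm z)

/-- A holomorphic symplectic form: a holomorphic, closed, non-degenerate 2-form. -/
structure IsHolomorphicSymplectic
    (Ω : ∀ x : X, (TangentSpace 𝓘(ℂ, E) x) [⋀^Fin 2]→L[ℂ] ℂ) : Prop where
  holomorphic : ∀ x₀, ContDiffOn ℂ ω (chartRep Ω x₀) (chartAt E x₀).target
  closed : ∀ x₀, ∀ z ∈ (chartAt E x₀).target, extDeriv (chartRep Ω x₀) z = 0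
  nondegenerate : ∀ x (v : TangentSpace 𝓘(ℂ, E) x), (∀ w, Ω x ![v, w] = 0) → v = 0

/-- `W` is a Lagrangian subspace of `T_x X`: it equals its own symplectic orthogonal. -/
def IsLagrangianSubspace (Ω : ∀ x : X, (TangentSpace 𝓘(ℂ, E) x) [⋀^Fin 2]→L[ℂ] ℂ) {x : X}
    (W : Submodule ℂ (TangentSpace 𝓘(ℂ, E) x)) : Prop :=
  ∀ v : TangentSpace 𝓘(ℂ, E) x, v ∈ W ↔ ∀ w ∈ W, Ω x ![v, w] = 0

/-- A Lagrangian subvariety: a closed analytic subset whose tangent spaces at smooth points are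
Lagrangian. -/
def IsLagrangianSubvariety (Ω : ∀ x : X, (TangentSpace 𝓘(ℂ, E) x) [⋀^Fin 2]→L[ℂ] ℂ)
    (L : Set X) : Prop :=
  IsAnalyticSubset (E := E) L ∧
    ∀ (x : X) (T : Submodule ℂ (TangentSpace 𝓘(ℂ, E) x)),
      IsSmoothPointWithTangent L x T → IsLagrangianSubspace Ω T

end Symplectic

universe u

variable {EM EB : Type*} [NormedAddCommGroup EM] [NormedSpace ℂ EM]
  [NormedAddCommGroup EB] [NormedSpace ℂ EB]
  {M : Type u} [TopologicalSpace M] [ChartedSpace EM M]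
  {B : Type*} [TopologicalSpace B] [ChartedSpace EB B]

variable (EM EB M B) in
/-- A completely integrable system on the complex manifold `M` over the complex manifold `B`:
a holomorphic symplectic form `Ω` and a proper flat holomorphic map `H : M → B` such that, off
a proper closed analytic subset `S` of `B`, the fibres of `H` are Lagrangian complex tori. Fibres
are taken as analytic spaces: the fibre of the flat map `H` over `b` is smooth exactly when `H` is
a submersion at all points over `b`, and its tangent spaces are then the kernels of `dH`. -/
structure IntegrableSystem where
  Ω : ∀ m : M, (TangentSpace 𝓘(ℂ, EM) m) [⋀^Fin 2]→L[ℂ] ℂ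
  symplectic : IsHolomorphicSymplectic Ω
  H : M → B
  proper : IsProperMap H
  flat : IsFlatMap (E := EM) (E' := EB) H
  S : Set B
  analytic_S : IsAnalyticSubset (E := EB) S
  S_ne_univ : S ≠ univ
  submersion : ∀ m, H m ∉ S → Function.Surjective (mfderiv 𝓘(ℂ, EM) 𝓘(ℂ, EB) H m)
  lagrangian : ∀ m, H m ∉ S →
    IsLagrangianSubspace Ω (LinearMap.ker (mfderiv 𝓘(ℂ, EM) 𝓘(ℂ, EB) H m).toLinearMap)
  torus : ∀ b, b ∉ S → IsComplexTorus EM (H ⁻¹' {b})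

namespace IntegrableSystem

variable (𝓢 : IntegrableSystem EM EB M B)

/-- The regular locus `B ∖ S`. -/
def regularLocus : Set B := 𝓢.Sᶜ

/-- For a point `m` over `b` and a covector `α ∈ T_b^∨ B`, the vector `v ∈ T_m M` is the value
at `m` of the vector field `X_α` along the fibre over `b` that is given by `Ω(X_α, ·) = H^* α`.
Since `H m = b`, the tangent spaces of `B` at `H m` and at `b` are the same copy of `EB`. -/
def IsFieldValue (b : B) (α : TangentSpace 𝓘(ℂ, EB) b →L[ℂ] ℂ) (m : M)
    (v : TangentSpace 𝓘(ℂ, EM) m) : Prop :=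
  𝓢.H m = b ∧ ∀ w : TangentSpace 𝓘(ℂ, EM) m,
    𝓢.Ω m ![v, w] = α (mfderiv 𝓘(ℂ, EM) 𝓘(ℂ, EB) 𝓢.H m w)

/-- `γ` is a (complex time) integral curve of the vector field `X_α` on the fibre over `b`. -/
def IsFlowLine (b : B) (α : TangentSpace 𝓘(ℂ, EB) b →L[ℂ] ℂ) (γ : ℂ → M) : Prop :=
  ∀ ζ : ℂ, MDifferentiableAt 𝓘(ℂ, ℂ) 𝓘(ℂ, EM) γ ζ ∧
    𝓢.IsFieldValue b α (γ ζ) (mfderiv 𝓘(ℂ, ℂ) 𝓘(ℂ, EM) γ ζ (1 : ℂ))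

/-- The period lattice `Λ_b ⊂ T_b^∨ B`: the covectors `α` for which the time-one flow of the
invariant vector field `X_α` is the identity of the fibre over `b`. Equivalently, the fibre is
`V_b M / Λ_b` once a base point is chosen, where `V_b M` is identified with `T_b^∨ B`. -/
def periodLattice (b : B) : Set (TangentSpace 𝓘(ℂ, EB) b →L[ℂ] ℂ) :=
  {α | ∀ m : M, 𝓢.H m = b → ∃ γ : ℂ → M, 𝓢.IsFlowLine b α γ ∧ γ 0 = m ∧ γ 1 = m}

/-- The lattice in `T_b B` of the integral affine structure: the dual of the period lattice. The
complex covector `α` is regarded as the real covector `Re α`. -/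
def affineLattice (b : B) : Set (TangentSpace 𝓘(ℂ, EB) b) :=
  {v | ∀ α ∈ 𝓢.periodLattice b, ∃ k : ℤ, (α v).re = k}

/-- A subspace of `T_b B` is rational for the integral affine structure if it is generated, as a
real vector space, by rational multiples of elements of the lattice. (Rationality involves only
the lattice and not the flat connection, for which lattice vectors extend to flat fields.) -/
def IsRationalSubspace (b : B) (T : Submodule ℂ EB) : Prop :=
  Submodule.span ℝ {v : EB | v ∈ T ∧ ∃ N : ℕ, N ≠ 0 ∧ (N • v : EB) ∈ 𝓢.affineLattice b}
    = T.restrictScalars ℝ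

/-- The annihilator in the cotangent space of a subspace of the tangent space. -/
def annihilator (T : Submodule ℂ EB) : Submodule ℂ (EB →L[ℂ] ℂ) where
  carrier := {α | ∀ v ∈ T, α v = 0}
  add_mem' := by
    intro α β hα hβ v hv
    simp [hα v hv, hβ v hv]
  zero_mem' := by
    intro v _
    rfl
  smul_mem' := by
    intro c α hα v hv
    simp [hα v hv]

/-- `A` is a complex torus in the fibre over `b` generated by the invariant vector fields `X_α`,
`α ∈ W`: it is presented as a quotient of the vector space `W` by a lattice, by a holomorphic map
`p` for which `dp` maps the constant vector field `α` to `X_α`, for all `α ∈ W`. -/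
def IsTorusGeneratedBy (b : B) (W : Submodule ℂ (EB →L[ℂ] ℂ)) (A : Set M) : Prop :=
  ∃ p : W → M, IsTorusParametrization (E := EM) p A ∧
    ∀ x α : W, 𝓢.IsFieldValue b (α : EB →L[ℂ] ℂ) (p x) (mfderiv 𝓘(ℂ, W) 𝓘(ℂ, EM) p x α)

/-- The restriction of `H` to `L` is a `C^∞` fibre bundle (with non-empty fibres) over the subset
`R` of `B`: locally on `R` there are a smooth manifold `F` and a `C^∞` isomorphism
`Φ : (R ∩ U) × F ≃ L ∩ H⁻¹ (R ∩ U)` over `R ∩ U`, with inverse `m ↦ (H m, Ψ m)`. -/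
def IsSmoothFibreBundleOver (L : Set M) (R : Set B) : Prop :=
  ∀ b ∈ R, ∃ U : Set B, IsOpen U ∧ b ∈ U ∧
    ∃ (d : ℕ) (F : Type u) (_ : TopologicalSpace F)
      (_ : ChartedSpace (EuclideanSpace ℝ (Fin d)) F) (_ : IsManifold (𝓡 d) ∞ F)
      (_ : Nonempty F) (Φ : B × F → M) (Ψ : M → F),
      ContMDiffOn (𝓘(ℝ, EB).prod (𝓡 d)) 𝓘(ℝ, EM) ∞ Φ ((R ∩ U) ×ˢ univ) ∧
      ContMDiffOn 𝓘(ℝ, EM) (𝓡 d) ∞ Ψ (L ∩ 𝓢.H ⁻¹' (R ∩ U)) ∧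
      (∀ x ∈ R ∩ U, ∀ y : F, Φ (x, y) ∈ L ∧ 𝓢.H (Φ (x, y)) = x ∧ Ψ (Φ (x, y)) = y) ∧
      ∀ m ∈ L, 𝓢.H m ∈ R ∩ U → Φ (𝓢.H m, Ψ m) = m

/-- `L` is a visible Lagrangian over the proper subvariety `B'` of `B`, with `S'` the proper
subvariety of `B'` off which `L → B'` is a smooth fibre bundle. -/
structure IsVisibleLagrangian (L : Set M) (B' S' : Set B) : Prop where
  lagrangian : IsLagrangianSubvariety 𝓢.Ω L
  analytic_base : IsAnalyticSubset (E := EB) B'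
  base_ne_univ : B' ≠ univ
  factors : MapsTo 𝓢.H L B'
  analytic_bad : IsAnalyticSubset (E := EB) S'
  bad_ssubset : S' ⊂ B'
  bundle : 𝓢.IsSmoothFibreBundleOver L (B' \ S')

end IntegrableSystem

end VisibleLagrangian

end

noncomputable section

namespace VisibleLagrangian

/-! ### Local structure of analytic sets -/

section

/-! Over a regular value `b` the fibre is a quotient `V / Γ` of a vector space by a lattice. For a
constant field `v` on `V`, the covector `β x` with `Ω(dp v, ·) = H^* (β x)` is a holomorphic,
`Γ`-periodic function of `x`, hence constant by Liouville. A dimension count then identifies `V`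
with the cotangent space at `b` (`exists_covector_equiv`), so the fibre is parametrized by
covectors, with the constant field `α` going to `X_α`.

The Lagrangian condition is given only at smooth points of `L`, whereas the bundle structure is only
a real one. Near a point over `b`, the bundle chart and a holomorphic slice of `B'` parametrize `L`
by a real `C¹` immersion. Regular points of an analytic set are dense (`exists_regular_point`), so
by continuity the immersion is isotropic everywhere, and its source has real dimension `dim_ℂ M`
(`isotropic_of_parametrization`, `exists_isotropic_parametrization`).

A vector tangent to the fibre of `L` over `b` is a value of some `X_α`. Every `t` in `T = T_b B'`
lifts to a vector tangent to `L`, and isotropy gives `α t = 0`. Hence the fibre of `L` is tangent to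
the annihilator of `T`; the dimensions agree, so it is locally a translate of the annihilator
(`fibre_eq_leaf`).

The fibre of `L` is therefore a compact union of orbits of the annihilator, each relatively open.
The orbits are its connected components (`connectedComponentIn_eq_orbit`), and compactness of one
orbit forces the elements of `Γ` in the annihilator to span it over the reals
(`span_periods_eq_top`). This makes the components tori. By duality (`span_dual_lattice`), `T` is
spanned by vectors that are integral on `Γ`. Since `Γ` contains the period lattice
(`periodLattice_subset`), these lie in the affine lattice. -/

/-- Inverse function theorem: a submersion `g` at `a` has a local parametrization `σ` of its fibre
through `a`, inverse to a linear projection onto the kernel of the derivative. -/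
theorem exists_slice {E Y : Type*} [NormedAddCommGroup E] [NormedSpace ℂ E] [FiniteDimensional ℂ E]
    [NormedAddCommGroup Y] [NormedSpace ℂ Y] [FiniteDimensional ℂ Y]
    {g : E → Y} {a : E} (hg : ContDiffAt ℂ ω g a)
    (hs : Function.Surjective (fderiv ℂ g a)) (T : Submodule ℂ E)
    (hT : ∀ v, v ∈ T ↔ fderiv ℂ g a v = 0) :
    ∃ (κ : E →L[ℂ] T) (σ : T → E), (∀ v : T, κ v = v) ∧ ContDiffAt ℂ ω σ 0 ∧ σ 0 = a ∧
      (∀ᶠ t in 𝓝 0, g (σ t) = g a ∧ κ (σ t - a) = t) ∧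
      (∀ᶠ x in 𝓝 a, g x = g a → σ (κ (x - a)) = x) ∧
      fderiv ℂ σ 0 = T.subtypeL := by
  obtain ⟨κ, hκ⟩ := Submodule.ClosedComplemented.of_finiteDimensional (𝕜 := ℂ) T
  have : CompleteSpace E := FiniteDimensional.complete ℂ E
  -- The projection `κ` onto the kernel completes `g` to a local biholomorphism; `σ` is its inverse
  -- restricted to `{g a} × T`.
  set Ψ : E → Y × T := fun x => (g x, κ (x - a)) with hΨ
  have hΨc : ContDiffAt ℂ ω Ψ a := by
    refine hg.prodMk ?_
    exact (κ.contDiff.contDiffAt.comp a (contDiffAt_id.sub contDiffAt_const))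
  have hΨd : HasFDerivAt Ψ ((fderiv ℂ g a).prod κ) a := by
    refine (hg.differentiableAt (by simp)).hasFDerivAt.prodMk ?_
    exact κ.hasFDerivAt.comp a ((hasFDerivAt_id a).sub_const a)
  have hbij : Function.Bijective ((fderiv ℂ g a).prod κ) := by
    constructor
    · rw [injective_iff_map_eq_zero]
      intro v hv
      have h1 : fderiv ℂ g a v = 0 := congrArg Prod.fst hv
      have h2 : κ v = 0 := congrArg Prod.snd hv
      have h3 := hκ ⟨v, (hT v).2 h1⟩
      rw [show κ ((⟨v, (hT v).2 h1⟩ : T) : E) = 0 from h2] at h3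
      exact (congrArg Subtype.val h3).symm
    · rintro ⟨y, t⟩
      obtain ⟨v, hv⟩ := hs y
      refine ⟨v - κ v + t, ?_⟩
      have h1 : fderiv ℂ g a (κ v) = 0 := (hT _).1 (κ v).2
      have h2 : fderiv ℂ g a t = 0 := (hT _).1 t.2
      simp [hv, h1, h2, hκ]
  let e : E ≃L[ℂ] (Y × T) := (LinearEquiv.ofBijective
    (((fderiv ℂ g a).prod κ : E →L[ℂ] Y × T) : E →ₗ[ℂ] Y × T) hbij).toContinuousLinearEquiv
  have he : (e : E →L[ℂ] Y × T) = (fderiv ℂ g a).prod κ := by ext v <;> rfl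
  rw [← he] at hΨd
  have hΨs : HasStrictFDerivAt Ψ (e : E →L[ℂ] Y × T) a := hΨc.hasStrictFDerivAt' hΨd (by simp)
  set θ := hΨs.localInverse Ψ e a with hθ
  have hθc : ContDiffAt ℂ ω θ (Ψ a) := hΨc.to_localInverse hΨd (by simp)
  have ha : Ψ a = (g a, 0) := by simp [hΨ]
  have hc : Continuous fun t : T => ((g a, t) : Y × T) := by fun_prop
  have hθ0 : θ (Ψ a) = a := hΨs.localInverse_apply_image
  refine ⟨κ, fun t => θ (g a, t), hκ, ?_, ?_, ?_, ?_, ?_⟩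
  · rw [ha] at hθc
    exact ContDiffAt.comp (g := θ) (f := fun t : T => ((g a, t) : Y × T)) 0 hθc
      (contDiffAt_const.prodMk contDiffAt_id)
  · simp only [← ha, hθ0]
  · have := hΨs.eventually_right_inverse
    rw [ha] at this
    filter_upwards [hc.continuousAt.eventually this] with t ht
    exact ⟨congrArg Prod.fst ht, congrArg Prod.snd ht⟩
  · filter_upwards [hΨs.eventually_left_inverse] with x hx hgx
    rw [← hgx]; exact hx
  · have h1 := hΨs.to_localInverse.hasFDerivAt
    rw [ha] at h1
    have h2 : HasFDerivAt (fun t : T => ((g a, t) : Y × T)) (ContinuousLinearMap.inr ℂ Y T) 0 := by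
      exact (hasFDerivAt_const (g a) (0 : T)).prodMk (hasFDerivAt_id 0)
    refine (HasFDerivAt.comp (0 : T) h1 h2).fderiv.trans ?_
    ext t
    have : e (t : E) = (0, t) := by
      change ((fderiv ℂ g a) t, κ t) = _
      rw [(hT _).1 t.2, hκ]
    simp [← this]

/-- Surjectivity of continuous linear maps to a finite-dimensional space is an open condition. -/
theorem eventually_surjective_of_continuousAt {𝕜 X E Y : Type*} [RCLike 𝕜] [TopologicalSpace X]
    [NormedAddCommGroup E] [NormedSpace 𝕜 E] [NormedAddCommGroup Y] [NormedSpace 𝕜 Y]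
    [FiniteDimensional 𝕜 Y] {A : X → E →L[𝕜] Y} {q : X} (hA : ContinuousAt A q)
    (hs : Function.Surjective (A q)) : ∀ᶠ x in 𝓝 q, Function.Surjective (A x) := by
  have : CompleteSpace Y := FiniteDimensional.complete 𝕜 Y
  obtain ⟨R, hR⟩ := ContinuousLinearMap.exists_rightInverse_of_surjective (A q)
    (LinearMap.range_eq_top.2 hs)
  -- `A x ∘L R` is the identity at `q`, so it is invertible for nearby `x`.
  have hc : ContinuousAt (fun x => A x ∘L R) q := hA.clm_comp continuousAt_const
  have h1 := ContinuousLinearEquiv.nhds (ContinuousLinearEquiv.refl 𝕜 Y)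
  have h2 : A q ∘L R = (ContinuousLinearEquiv.refl 𝕜 Y : Y →L[𝕜] Y) := hR
  rw [← h2] at h1
  filter_upwards [hc h1] with x hx
  obtain ⟨e, he⟩ := hx
  intro y
  refine ⟨R (e.symm y), ?_⟩
  have := congrArg (fun l => l (e.symm y)) he
  simpa using this.symm

/-- A holomorphic function on a ball all of whose iterated derivatives in every direction at the
centre vanish is zero. -/
theorem eqOn_zero_of_iterate_deriv {N : Type*} [NormedAddCommGroup N] [NormedSpace ℂ N]
    {ε : ℝ} {P : (N → ℂ) → Prop}
    (hP : ∀ u, P u → AnalyticOnNhd ℂ u (Metric.ball 0 ε) ∧ u 0 = 0 ∧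
      ∀ n, P fun t => fderiv ℂ u t n)
    {u : N → ℂ} (hu : P u) {n : N} (hn : n ∈ Metric.ball (0 : N) ε) : u n = 0 := by
  have hmem : ∀ ζ ∈ {ζ : ℂ | ζ • n ∈ Metric.ball (0 : N) ε}, AnalyticAt ℂ (fun ζ : ℂ => ζ • n) ζ :=
    fun ζ _ => by fun_prop
  set D : Set ℂ := {ζ : ℂ | ζ • n ∈ Metric.ball (0 : N) ε} with hD
  have hDo : IsOpen D := Metric.isOpen_ball.preimage (by fun_prop)
  have hDc : Convex ℝ D := by
    have := (convex_ball (0 : N) ε).linear_preimage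
      ((LinearMap.toSpanSingleton ℂ N n).restrictScalars ℝ)
    exact this
  have hε : 0 < ε := by
    rw [mem_ball_zero_iff] at hn
    exact (norm_nonneg n).trans_lt hn
  have h0 : (0 : ℂ) ∈ D := by simp [hD, hε]
  -- `P` is stable under directional derivatives, so each derivative along the line `ζ ↦ ζ • n` is
  -- again the restriction to that line of a function satisfying `P`.
  have hder : ∀ j : ℕ, ∀ u, P u → iteratedDeriv j (fun ζ : ℂ => u (ζ • n)) 0 = 0 := by
    intro j
    induction j with
    | zero => intro u hu; simpa using (hP u hu).2.1
    | succ j ih =>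
      intro u hu
      rw [iteratedDeriv_succ']
      have : deriv (fun ζ : ℂ => u (ζ • n)) =ᶠ[𝓝 0] fun ζ => fderiv ℂ u (ζ • n) n := by
        filter_upwards [hDo.mem_nhds h0] with ζ hζ
        have h1 := ((hP u hu).1 _ hζ).differentiableAt.hasFDerivAt
        have h2 : HasDerivAt (fun ζ : ℂ => ζ • n) n ζ := by
          simpa using (hasDerivAt_id ζ).smul_const n
        exact (h1.comp_hasDerivAt ζ h2).deriv
      rw [this.iteratedDeriv_eq]
      exact ih _ ((hP u hu).2.2 n)
  have han : AnalyticOnNhd ℂ (fun ζ : ℂ => u (ζ • n)) D := fun ζ hζ =>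
    AnalyticAt.fun_comp ((hP u hu).1 _ hζ) (hmem ζ hζ)
  have hev : (fun ζ : ℂ => u (ζ • n)) =ᶠ[𝓝 0] 0 := by
    obtain ⟨r, hr, hrD⟩ := Metric.isOpen_iff.1 hDo 0 h0
    filter_upwards [Metric.ball_mem_nhds 0 hr] with z hz
    have := Complex.taylorSeries_eq_on_ball' (c := 0) (r := r) (z := z)
      (f := fun ζ : ℂ => u (ζ • n)) hz
      (fun y hy => (han y (hrD hy)).differentiableAt.differentiableWithinAt)
    rw [← this]
    simp [hder _ u hu]
  have h1 : (1 : ℂ) ∈ D := by simpa [hD] using hn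
  simpa using han.eqOn_zero_of_preconnected_of_eventuallyEq_zero hDc.isPreconnected h0 hev h1

/-- Regular points are dense in an analytic set: near any point of an analytic set there are points
near which it is cut out by functions with independent differentials. -/
theorem exists_regular_point {E : Type*} [NormedAddCommGroup E] [NormedSpace ℂ E]
    [FiniteDimensional ℂ E] {A O : Set E} (hO : IsOpen O) {k : ℕ} {f : E → Fin k → ℂ}
    (hf : ContDiffOn ℂ ω f O) (hA : A ∩ O = {x ∈ O | f x = 0}) (hne : (A ∩ O).Nonempty) :
    ∃ q ∈ A ∩ O, ∃ O' ⊆ O, IsOpen O' ∧ q ∈ O' ∧ ∃ (r : ℕ) (g : E → Fin r → ℂ),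
      ContDiffOn ℂ ω g O' ∧ A ∩ O' = {x ∈ O' | g x = 0} ∧
      Function.Surjective (fderiv ℂ g q) := by
  classical
  have : CompleteSpace E := FiniteDimensional.complete ℂ E
  -- Take the largest `r` such that, at some point of `A ∩ O`, there are `r` functions vanishing on
  -- `A` with independent differentials. By maximality every equation of `A` will vanish on the
  -- slice `g = 0`, so the slice lies in `A`.
  let P : ℕ → Prop := fun r => ∃ q ∈ A ∩ O, ∃ g : E → Fin r → ℂ, ContDiffAt ℂ ω g q ∧
    (∀ᶠ x in 𝓝 q, x ∈ A → g x = 0) ∧ Function.Surjective (fderiv ℂ g q)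
  have hP0 : P 0 := by
    obtain ⟨q, hq⟩ := hne
    exact ⟨q, hq, fun _ => 0, contDiffAt_const, by simp, Function.surjective_to_subsingleton _⟩
  have hPb : ∀ r, P r → r ≤ Module.finrank ℂ E := by
    rintro r ⟨q, -, g, -, -, hs⟩
    simpa using LinearMap.finrank_le_finrank_of_surjective
      (f := (fderiv ℂ g q : E →ₗ[ℂ] Fin r → ℂ)) hs
  obtain ⟨r, hr, hmax⟩ : ∃ r, P r ∧ ¬ P (r + 1) := by
    by_contra! h
    have : ∀ r, P r := fun r => Nat.rec hP0 (fun r hr => h r hr) r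
    have := hPb _ (this (Module.finrank ℂ E + 1))
    omega
  obtain ⟨q, hq, g, hgc, hgA, hgs⟩ := hr
  set T := LinearMap.ker (fderiv ℂ g q : E →ₗ[ℂ] Fin r → ℂ) with hT
  obtain ⟨κ, σ, hκ, hσc, hσ0, hσ1, hσ2, hσd⟩ := exists_slice hgc hgs T (fun v => by simp [hT])
  have hgq : g q = 0 := hgA.self_of_nhds hq.1
  have hsurj : ∀ᶠ x in 𝓝 q, Function.Surjective (fderiv ℂ g x) := by
    have h1 : ContinuousAt (fderiv ℂ g) q :=
      (hgc.fderiv_right (m := 0) (by simp)).continuousAt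
    exact eventually_surjective_of_continuousAt h1 hgs
  -- a good neighbourhood of `q`
  have hX := (((hσ2.and hgA).and (hsurj.and (hgc.eventually (by simp)))).and
    (hO.mem_nhds hq.2)).eventually_nhds
  obtain ⟨O₁, hO₁, hO₁o, hqO₁⟩ := eventually_nhds_iff.1 hX
  have hσcont : ContinuousAt σ 0 := hσc.continuousAt
  have hY : ∀ᶠ t in 𝓝 (0 : T), (g (σ t) = g q ∧ κ (σ t - q) = t) ∧ ContDiffAt ℂ ω σ t ∧
      σ t ∈ O₁ := by
    refine hσ1.and ((hσc.eventually (by simp)).and ?_)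
    exact hσcont (hO₁o.mem_nhds (by rwa [hσ0]))
  obtain ⟨ε, hε, hball⟩ := Metric.eventually_nhds_iff_ball.1 hY
  have key : ∀ n ∈ Metric.ball (0 : T) ε, σ n ∈ A := by
    -- Functions on the slice that vanish at the parameters of points of `A`. Maximality of `r`
    -- makes this class stable under differentiation.
    let Q : (T → ℂ) → Prop := fun u => AnalyticOnNhd ℂ u (Metric.ball 0 ε) ∧
      ∀ t ∈ Metric.ball (0 : T) ε, σ t ∈ A → u t = 0
    have hQ : ∀ u, Q u → AnalyticOnNhd ℂ u (Metric.ball 0 ε) ∧ u 0 = 0 ∧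
        ∀ n, Q fun t => fderiv ℂ u t n := by
      rintro u ⟨hu, hu0⟩
      refine ⟨hu, hu0 0 (Metric.mem_ball_self hε) (by rw [hσ0]; exact hq.1), fun n => ⟨?_, ?_⟩⟩
      · intro t ht
        exact ((ContinuousLinearMap.apply ℂ ℂ n).analyticAt _).fun_comp (hu t ht).fderiv
      · intro t ht htA
        by_contra hne
        apply hmax
        obtain ⟨⟨h1, h2⟩, h3, h4⟩ := hball t ht
        have h5 := (hO₁ _ h4).self_of_nhds
        -- If a derivative of `u` were nonzero at a point of `A`, then `u ∘ κ` would join `g` as one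
        -- more independent function vanishing on `A` near that point.
        let G : E → (Fin r → ℂ) × ℂ := fun x => (g x, u (κ (x - q)))
        let L := ContinuousLinearEquiv.ofFinrankEq (𝕜 := ℂ) (E := (Fin r → ℂ) × ℂ)
          (F := Fin (r + 1) → ℂ) (by simp)
        have hk : ContDiffAt ℂ ω (fun x => κ (x - q)) (σ t) :=
          κ.contDiff.contDiffAt.comp _ (contDiffAt_id.sub contDiffAt_const)
        have hu' : ContDiffAt ℂ ω u (κ (σ t - q)) := by rw [h2]; exact (hu t ht).contDiffAt
        have hG : ContDiffAt ℂ ω G (σ t) := h5.1.2.2.prodMk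
          (ContDiffAt.comp (g := u) (f := fun x => κ (x - q)) (σ t) hu' hk)
        refine ⟨σ t, ⟨htA, h5.2⟩, fun x => L (G x), L.contDiff.contDiffAt.comp _ hG, ?_, ?_⟩
        · filter_upwards [hO₁ _ h4, hk.continuousAt (IsOpen.mem_nhds Metric.isOpen_ball
            (by rw [h2]; exact ht))] with x hx hxb hxA
          have e1 := hx.1.1.2 hxA
          have e2 := hx.1.1.1 (by rw [e1, hgq])
          have e3 := hu0 _ hxb (by rw [e2]; exact hxA)
          have e3 : u (κ (x - q)) = 0 := e3
          simp only [G, e1, e3]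
          exact map_zero L
        · have d1 : HasFDerivAt G ((fderiv ℂ g (σ t)).prod ((fderiv ℂ u t) ∘L κ)) (σ t) := by
            refine ((h5.1.2.2).differentiableAt (by simp)).hasFDerivAt.prodMk ?_
            have a1 : HasFDerivAt u (fderiv ℂ u t) (κ (σ t - q)) := by
              rw [h2]; exact (hu t ht).differentiableAt.hasFDerivAt
            have a2 : HasFDerivAt (fun x => κ (x - q)) κ (σ t) := by
              exact κ.hasFDerivAt.comp (σ t) ((hasFDerivAt_id (σ t)).sub_const q)
            exact HasFDerivAt.comp (σ t) a1 a2
          have d2 : fderiv ℂ (fun x => L (G x)) (σ t) =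
              (L : (Fin r → ℂ) × ℂ →L[ℂ] Fin (r + 1) → ℂ) ∘L
                ((fderiv ℂ g (σ t)).prod ((fderiv ℂ u t) ∘L κ)) :=
            (L.hasFDerivAt.comp (σ t) d1).fderiv
          rw [d2]
          refine L.surjective.comp ?_
          have hσt := (h3.differentiableAt (by simp)).hasFDerivAt
          have hev : ∀ᶠ s in 𝓝 t, g (σ s) = g q ∧ κ (σ s - q) = s := by
            filter_upwards [Metric.isOpen_ball.mem_nhds ht] with s hs using (hball s hs).1
          have z1 : fderiv ℂ g (σ t) (fderiv ℂ σ t n) = 0 := by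
            have b1 := HasFDerivAt.comp t
              ((h5.1.2.2).differentiableAt (by simp)).hasFDerivAt hσt
            have b2 : HasFDerivAt (g ∘ σ) (0 : T →L[ℂ] Fin r → ℂ) t :=
              (hasFDerivAt_const (g q) t).congr_of_eventuallyEq (hev.mono fun s hs => hs.1)
            exact congrArg (fun l => l n) (b1.unique b2)
          have z2 : κ (fderiv ℂ σ t n) = n := by
            have b1 := κ.hasFDerivAt.comp t (hσt.sub_const q)
            have b2 : HasFDerivAt (κ ∘ fun x => σ x - q) (ContinuousLinearMap.id ℂ T) t :=
              (hasFDerivAt_id t).congr_of_eventuallyEq (hev.mono fun s hs => hs.2)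
            exact congrArg (fun l => l n) (b1.unique b2)
          rintro ⟨y, c⟩
          obtain ⟨v, hv⟩ := h5.1.2.1 y
          -- Along `fderiv ℂ σ t n` the differential of `g` is zero and that of `u ∘ κ` is `fderiv ℂ
          -- u t n`, so the last coordinate can be adjusted independently.
          refine ⟨v + ((c - fderiv ℂ u t (κ v)) / fderiv ℂ u t n) • fderiv ℂ σ t n, ?_⟩
          have hne' : fderiv ℂ u t n ≠ 0 := hne
          simp [hv, z1, z2, hne']
    intro n hn
    have hnO : σ n ∈ O := ((hO₁ _ (hball n hn).2.2).self_of_nhds).2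
    have hmem : f (σ n) = 0 := by
      ext i
      have hfi : Q fun t => f (σ t) i := by
        refine ⟨fun t ht => ?_, fun t ht htA => ?_⟩
        · have hO' : σ t ∈ O := ((hO₁ _ (hball t ht).2.2).self_of_nhds).2
          have c1 : ContDiffAt ℂ ω (fun t => f (σ t)) t :=
            (hf.contDiffAt (hO.mem_nhds hO')).comp t (hball t ht).2.1
          exact ((contDiffAt_pi.1 c1) i).analyticAt
        · have hO' : σ t ∈ O := ((hO₁ _ (hball t ht).2.2).self_of_nhds).2
          have : σ t ∈ {x ∈ O | f x = 0} := hA ▸ ⟨htA, hO'⟩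
          simp [this.2]
      exact eqOn_zero_of_iterate_deriv hQ hfi hn
    exact ((Set.ext_iff.1 hA (σ n)).2 ⟨hnO, hmem⟩).1
  have hκc : ContinuousAt (fun x => κ (x - q)) q := by fun_prop
  have hfin : ∀ᶠ x in 𝓝 q, x ∈ O₁ ∧ κ (x - q) ∈ Metric.ball (0 : T) ε := by
    refine Filter.Eventually.and (hO₁o.mem_nhds hqO₁) (hκc ?_)
    simpa using Metric.ball_mem_nhds (0 : T) hε
  obtain ⟨O', hO', hO'o, hqO'⟩ := eventually_nhds_iff.1 hfin
  have hprop := fun x (hx : x ∈ O') => (hO₁ _ (hO' x hx).1).self_of_nhds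
  refine ⟨q, hq, O', fun x hx => (hprop x hx).2, hO'o, hqO', r, g,
    fun x hx => (hprop x hx).1.2.2.contDiffWithinAt, ?_, hgs⟩
  ext x
  constructor
  · rintro ⟨hxA, hx⟩
    exact ⟨hx, (hprop x hx).1.1.2 hxA⟩
  · rintro ⟨hx, hgx⟩
    refine ⟨?_, hx⟩
    have e := (hprop x hx).1.1.1 (by rw [hgx, hgq])
    rw [← e]
    exact key _ (hO' x hx).2

end

/-! ### Isotropy of real parametrizations of Lagrangian analytic sets -/

section

section Pairing

variable {X : Type*} [NormedAddCommGroup X] [NormedSpace ℂ X]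

/-- The bilinear form of a 2-form. -/
def pairing (ϖ : X [⋀^Fin 2]→L[ℂ] ℂ) : X →ₗ[ℂ] X →ₗ[ℂ] ℂ :=
  LinearMap.mk₂ ℂ (fun v w => ϖ ![v, w])
    (fun v v' w => by
      have := congrArg (fun l => l ![w]) (map_add ϖ.curryLeft v v'); exact this)
    (fun c v w => by
      have := congrArg (fun l => l ![w]) (map_smul ϖ.curryLeft c v); exact this)
    (fun v w w' => by
      have := congrArg (fun l => l ![]) (map_add (ϖ.curryLeft v).curryLeft w w'); exact this)
    (fun c v w => by
      have := congrArg (fun l => l ![]) (map_smul (ϖ.curryLeft v).curryLeft c w); exact this)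

@[simp] theorem pairing_apply (ϖ : X [⋀^Fin 2]→L[ℂ] ℂ) (v w : X) : pairing ϖ v w = ϖ ![v, w] := rfl

theorem two_form_swap (ϖ : X [⋀^Fin 2]→L[ℂ] ℂ) (v w : X) : ϖ ![v, w] = - ϖ ![w, v] := by
  have := ϖ.toAlternatingMap.map_swap ![w, v] (i := 0) (j := 1) (by simp)
  have h : (![w, v] ∘ (Equiv.swap (0 : Fin 2) 1)) = ![v, w] := by
    ext i; fin_cases i <;> simp
  rw [h] at this
  exact this

/-- A Lagrangian subspace has half the dimension of the ambient space. -/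
theorem two_mul_finrank_of_lagrangian [FiniteDimensional ℂ X] {ϖ : X [⋀^Fin 2]→L[ℂ] ℂ}
    (hnd : ∀ v, (∀ w, ϖ ![v, w] = 0) → v = 0) {W : Submodule ℂ X}
    (hW : ∀ v, v ∈ W ↔ ∀ w ∈ W, ϖ ![v, w] = 0) :
    2 * Module.finrank ℂ W = Module.finrank ℂ X := by
  have hrefl : (pairing ϖ).IsRefl := fun v w h => by
    rw [pairing_apply] at h ⊢; rw [two_form_swap, h, neg_zero]
  have hB : LinearMap.BilinForm.Nondegenerate (pairing ϖ) := by
    refine hrefl.nondegenerate_iff_separatingLeft.2 ?_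
    exact fun v hv => hnd v hv
  have h1 := LinearMap.BilinForm.finrank_orthogonal hB W
  have h2 : LinearMap.BilinForm.orthogonal (pairing ϖ) W = W := by
    ext v
    rw [LinearMap.BilinForm.mem_orthogonal_iff, hW]
    refine forall₂_congr fun w _ => ?_
    rw [pairing_apply, two_form_swap, neg_eq_zero]
  rw [h2] at h1
  have := Submodule.finrank_le W
  omega

/-- If the kernel of a surjection `l` is isotropic, then the contraction of `ϖ` with a vector in
the kernel is pulled back along `l`. -/
theorem exists_covector {Y : Type*} [NormedAddCommGroup Y] [NormedSpace ℂ Y]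
    [FiniteDimensional ℂ Y] (ϖ : X [⋀^Fin 2]→L[ℂ] ℂ) {l : X →L[ℂ] Y}
    (hl : Function.Surjective l) {v : X} (hv : ∀ w, l w = 0 → ϖ ![v, w] = 0) :
    ∃ β : Y →L[ℂ] ℂ, ∀ w, ϖ ![v, w] = β (l w) := by
  obtain ⟨R, hR⟩ := ContinuousLinearMap.exists_rightInverse_of_surjective l
    (LinearMap.range_eq_top.2 hl)
  have hR' : ∀ y, l (R y) = y := fun y => congrArg (fun k => k y) hR
  -- Contract with `v` after the right inverse `R`; this is independent of lifts because `w - R (l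
  -- w)` lies in the kernel.
  refine ⟨LinearMap.toContinuousLinearMap (pairing ϖ v ∘ₗ R.toLinearMap), fun w => ?_⟩
  have := hv (w - R (l w)) (by simp [hR'])
  rw [← pairing_apply, map_sub, sub_eq_zero] at this
  simpa using this

end Pairing

/-- Let an analytic set `A` be parametrized in an open set `O` by a real `C¹` map `G` with a
differentiable inverse. If the tangent spaces of `A` at its regular points are Lagrangian, then
all tangent spaces of the parametrization are isotropic of half the real dimension. -/
theorem isotropic_of_parametrization {X P : Type*} [NormedAddCommGroup X] [NormedSpace ℂ X]
    [FiniteDimensional ℂ X] [NormedAddCommGroup P] [NormedSpace ℝ P]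
    {A O : Set X} (hO : IsOpen O) {k : ℕ} {f : X → Fin k → ℂ} (hf : ContDiffOn ℂ ω f O)
    (hA : A ∩ O = {x ∈ O | f x = 0}) {Ω : X → X [⋀^Fin 2]→L[ℂ] ℂ} (hΩ : ContinuousOn Ω O)
    (hnd : ∀ z ∈ O, ∀ v, (∀ w, Ω z ![v, w] = 0) → v = 0)
    (hLag : ∀ (q : X) (O' : Set X) (r : ℕ) (g : X → Fin r → ℂ), q ∈ A → q ∈ O' → O' ⊆ O →
      IsOpen O' → ContDiffOn ℂ ω g O' → A ∩ O' = {x ∈ O' | g x = 0} →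
      Function.Surjective (fderiv ℂ g q) →
      ∀ v, fderiv ℂ g q v = 0 ↔ ∀ w, fderiv ℂ g q w = 0 → Ω q ![v, w] = 0)
    {D : Set P} (hD : IsOpen D) {G : P → X} (hG : ContDiffOn ℝ 1 G D) {Q : X → P}
    (hQ : DifferentiableOn ℝ Q (A ∩ O)) (hGm : MapsTo G D (A ∩ O)) (hQG : ∀ u ∈ D, Q (G u) = u)
    (hGQ : ∀ x ∈ A ∩ O, G (Q x) = x) :
    (∀ u ∈ D, ∀ v w, Ω (G u) ![fderiv ℝ G u v, fderiv ℝ G u w] = 0) ∧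
    (∀ u ∈ D, Function.Injective (fderiv ℝ G u)) ∧
    (D.Nonempty → Module.finrank ℝ P = Module.finrank ℂ X) := by
  have hGd : ∀ u ∈ D, HasFDerivAt G (fderiv ℝ G u) u := fun u hu =>
    ((hG.contDiffAt (hD.mem_nhds hu)).differentiableAt (by simp)).hasFDerivAt
  have hinj : ∀ u ∈ D, Function.Injective (fderiv ℝ G u) := by
    intro u hu
    -- Differentiability of `Q` within `A ∩ O` suffices for the chain rule, as `G` takes values
    -- there; `Q'` is then a left inverse of the derivative of `G`.
    obtain ⟨Q', hQ'⟩ := hQ _ (hGm hu)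
    have h1 := hQ'.comp_hasFDerivAt u (hGd u hu) (by
      filter_upwards [hD.mem_nhds hu] with y hy using hGm hy)
    have h2 : HasFDerivAt (Q ∘ G) (ContinuousLinearMap.id ℝ P) u :=
      (hasFDerivAt_id u).congr_of_eventuallyEq (by
        filter_upwards [hD.mem_nhds hu] with y hy using hQG y hy)
    exact Function.LeftInverse.injective (g := Q') fun v => congrArg (fun l => l v) (h1.unique h2)
  -- regular points
  have hreg : ∀ D₁ ⊆ D, IsOpen D₁ → D₁.Nonempty → ∃ u ∈ D₁,
      (∀ v w, Ω (G u) ![fderiv ℝ G u v, fderiv ℝ G u w] = 0) ∧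
      Module.finrank ℝ P = Module.finrank ℂ X := by
    intro D₁ hD₁ hD₁o ⟨u₁, hu₁⟩
    -- `Q` is continuous on `A ∩ O`, so a regular point sought in `O ∩ O₁` has its parameter in the
    -- prescribed open set `D₁`.
    obtain ⟨O₁, hO₁, hQO₁⟩ := (continuousOn_iff'.1 hQ.continuousOn) D₁ hD₁o
    have hmem : G u₁ ∈ A ∩ (O ∩ O₁) := by
      have h1 := hGm (hD₁ hu₁)
      have : G u₁ ∈ Q ⁻¹' D₁ ∩ (A ∩ O) := ⟨by simpa [hQG u₁ (hD₁ hu₁)] using hu₁, h1⟩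
      rw [hQO₁] at this
      exact ⟨h1.1, h1.2, this.1⟩
    obtain ⟨q, hq, O', hO', hO'o, hqO', r, g, hg, hgA, hgs⟩ :=
      exists_regular_point (A := A) (hO.inter hO₁) (hf.mono inter_subset_left) (by
        ext x
        constructor
        · rintro ⟨h1, h2, h3⟩
          exact ⟨⟨h2, h3⟩, ((Set.ext_iff.1 hA x).1 ⟨h1, h2⟩).2⟩
        · rintro ⟨⟨h2, h3⟩, h4⟩
          exact ⟨((Set.ext_iff.1 hA x).2 ⟨h2, h4⟩).1, h2, h3⟩) ⟨_, hmem⟩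
    have hqAO : q ∈ A ∩ O := ⟨hq.1, hq.2.1⟩
    have hQq : Q q ∈ D₁ := by
      have : q ∈ O₁ ∩ (A ∩ O) := ⟨hq.2.2, hqAO⟩
      rw [← hQO₁] at this
      exact this.1
    have hGq := hGQ q hqAO
    have hlag := hLag q O' r g hq.1 hqO' (hO'.trans inter_subset_left) hO'o hg hgA hgs
    have hgc : ContDiffAt ℂ ω g q := hg.contDiffAt (hO'o.mem_nhds hqO')
    have hgd : HasFDerivAt g (fderiv ℂ g q) q := (hgc.differentiableAt (by simp)).hasFDerivAt
    have hGQd := hGd _ (hD₁ hQq)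
    have hrange : ∀ v, fderiv ℂ g q (fderiv ℝ G (Q q) v) = 0 := by
      intro v
      have h1 : HasFDerivAt g ((fderiv ℂ g q).restrictScalars ℝ) (G (Q q)) := by
        rw [hGq]; exact hgd.restrictScalars ℝ
      have h2 := HasFDerivAt.comp (Q q) h1 hGQd
      have h3 : HasFDerivAt (g ∘ G) (0 : P →L[ℝ] Fin r → ℂ) (Q q) := by
        refine (hasFDerivAt_const (0 : Fin r → ℂ) (Q q)).congr_of_eventuallyEq ?_
        have h4 : ∀ᶠ y in 𝓝 (Q q), G y ∈ O' :=
          hGQd.continuousAt (hO'o.mem_nhds (by rwa [hGq]))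
        filter_upwards [h4, hD.mem_nhds (hD₁ hQq)] with y hy hyD
        exact ((Set.ext_iff.1 hgA (G y)).1 ⟨(hGm hyD).1, hy⟩).2
      exact congrArg (fun l => l v) (h2.unique h3)
    refine ⟨Q q, hQq, fun v w => ?_, ?_⟩
    · rw [hGq]
      exact (hlag _).1 (hrange v) _ (hrange w)
    · set W : Submodule ℂ X := LinearMap.ker (fderiv ℂ g q : X →ₗ[ℂ] Fin r → ℂ) with hW
      have hWmem : ∀ v, v ∈ W ↔ fderiv ℂ g q v = 0 := fun v => by simp [hW]
      have hdim := two_mul_finrank_of_lagrangian (hnd q hqAO.2) (W := W) (fun v => by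
        simp only [hWmem]; exact hlag v)
      obtain ⟨κ, σ, -, hσc, hσ0, hσ1, -, hσd⟩ := exists_slice hgc hgs W hWmem
      have hσ : HasFDerivAt σ (W.subtypeL.restrictScalars ℝ) 0 := by
        have := (hσc.differentiableAt (by simp)).hasFDerivAt
        rw [hσd] at this
        exact this.restrictScalars ℝ
      have hgq : g q = 0 := ((Set.ext_iff.1 hgA q).1 ⟨hq.1, hqO'⟩).2
      have hσA : ∀ᶠ t in 𝓝 0, σ t ∈ A ∩ O := by
        have h4 : ∀ᶠ t in 𝓝 0, σ t ∈ O' := hσ.continuousAt (hO'o.mem_nhds (by rwa [hσ0]))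
        filter_upwards [h4, hσ1] with t ht ht'
        exact ⟨((Set.ext_iff.1 hgA (σ t)).2 ⟨ht, by rw [ht'.1, hgq]⟩).1, (hO' ht).1⟩
      -- The slice `σ` lies in `A`, so it factors as `G ∘ Q ∘ σ`; differentiating, `W` lies in the
      -- range of the derivative of `G`. With `hrange` the two coincide, whence `dim_ℝ P = 2 dim_ℂ W
      -- = dim_ℂ X`.
      obtain ⟨Q', hQ'⟩ := hQ q hqAO
      have h5 : HasFDerivAt (Q ∘ σ) (Q' ∘L (W.subtypeL.restrictScalars ℝ)) 0 :=
        HasFDerivWithinAt.comp_hasFDerivAt 0 (by rwa [hσ0]) hσ hσA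
      have h6 : HasFDerivAt G (fderiv ℝ G (Q q)) ((Q ∘ σ) 0) := by
        simpa [hσ0] using hGQd
      have h7 := h6.comp 0 h5
      have h8 : HasFDerivAt (G ∘ Q ∘ σ) (W.subtypeL.restrictScalars ℝ) 0 :=
        hσ.congr_of_eventuallyEq (hσA.mono fun t ht => hGQ _ ht)
      have h9 := h7.unique h8
      have hlin : LinearMap.range (fderiv ℝ G (Q q) : P →ₗ[ℝ] X) = W.restrictScalars ℝ := by
        ext v
        constructor
        · rintro ⟨y, rfl⟩
          exact (hWmem _).2 (hrange y)
        · intro hv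
          exact ⟨_, congrArg (fun l => l ⟨v, hv⟩) h9⟩
      have h10 := LinearMap.finrank_range_of_inj (f := (fderiv ℝ G (Q q) : P →ₗ[ℝ] X))
        (hinj _ (hD₁ hQq))
      rw [hlin] at h10
      rw [← h10, ← hdim]
      exact finrank_real_of_complex W
  refine ⟨fun u hu v w => ?_, hinj, fun hne => ?_⟩
  · have hcont : ContinuousOn (fun u => Ω (G u) ![fderiv ℝ G u v, fderiv ℝ G u w]) D := by
      have c1 : ContinuousOn (fun u => Ω (G u)) D :=
        hΩ.comp hG.continuousOn fun u hu => (hGm hu).2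
      have c2 : ContinuousOn (fderiv ℝ G) D := hG.continuousOn_fderiv_of_isOpen hD (by simp)
      refine c1.eval (continuousOn_pi.2 fun i => ?_)
      fin_cases i
      · exact c2.clm_apply continuousOn_const
      · exact c2.clm_apply continuousOn_const
    -- A nonzero value would persist on an open set of parameters, which contains the parameter of a
    -- regular point.
    by_contra hne
    have hopen := hcont.isOpen_inter_preimage hD (isOpen_compl_singleton (x := (0 : ℂ)))
    obtain ⟨u', hu', h0, -⟩ := hreg _ inter_subset_left hopen ⟨u, hu, hne⟩
    exact hu'.2 (h0 v w)
  · obtain ⟨-, -, -, h⟩ := hreg D Subset.rfl hD hne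
    exact h

end

/-! ### Maps and analytic subsets in charts -/

section

theorem IsAnalyticSubset.isClosed {E : Type*} [NormedAddCommGroup E] [NormedSpace ℂ E]
    {X : Type*} [TopologicalSpace X] [ChartedSpace E X] {A : Set X} 
    (hA : IsAnalyticSubset (E := E) A) : IsClosed A := by
  rw [← isOpen_compl_iff, isOpen_iff_mem_nhds]
  intro x hx
  obtain ⟨U, hU, hxU, k, f, hf, hfA⟩ := hA x
  have h1 : ContinuousOn f U := hf.continuousOn
  have h2 := h1.isOpen_inter_preimage hU (isOpen_compl_singleton (x := (0 : Fin k → ℂ)))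
  have key : ∀ y ∈ U, y ∈ A ↔ f y = 0 := fun y hy =>
    ⟨fun h => ((Set.ext_iff.1 hfA y).1 ⟨h, hy⟩).2, fun h => ((Set.ext_iff.1 hfA y).2 ⟨hy, h⟩).1⟩
  refine mem_of_superset (h2.mem_nhds ⟨hxU, fun h => hx ((key x hxU).2 h)⟩) ?_
  exact fun y hy hyA => hy.2 ((key y hy.1).1 hyA)

section LocalRep

variable {E E' X Y : Type*} [NormedAddCommGroup E] [NormedAddCommGroup E']
  [TopologicalSpace X] [ChartedSpace E X] [TopologicalSpace Y] [ChartedSpace E' Y]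

variable (E E') in
/-- The expression of a map in the charts around `x₀` and `y₀`. -/
def localRep (H : X → Y) (x₀ : X) (y₀ : Y) : E → E' :=
  fun z => chartAt E' y₀ (H ((chartAt E x₀).symm z))

variable (E E') in
/-- The domain of `localRep`. -/
def localDomain (H : X → Y) (x₀ : X) (y₀ : Y) : Set E :=
  {z | z ∈ (chartAt E x₀).target ∧ H ((chartAt E x₀).symm z) ∈ (chartAt E' y₀).source}

theorem isOpen_localDomain {H : X → Y} (hH : Continuous H) (x₀ : X) (y₀ : Y) :
    IsOpen (localDomain E E' H x₀ y₀) :=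
  (chartAt E x₀).symm.isOpen_inter_preimage ((chartAt E' y₀).open_source.preimage hH)

end LocalRep

section Charts

variable {E : Type*} [NormedAddCommGroup E] [NormedSpace ℂ E]
  {X : Type*} [TopologicalSpace X] [ChartedSpace E X] [IsManifold 𝓘(ℂ, E) ω X]
  {E' : Type*} [NormedAddCommGroup E'] [NormedSpace ℂ E']
  {Y : Type*} [TopologicalSpace Y] [ChartedSpace E' Y] [IsManifold 𝓘(ℂ, E') ω Y]

variable (E) in
/-- The derivative of the inverse of the chart around `x₀`. -/
def chartFrame (x₀ : X) (z : E) : E →L[ℂ] E :=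
  mfderiv 𝓘(ℂ, E) 𝓘(ℂ, E) (chartAt E x₀).symm z

variable (E) in
/-- The derivative of the chart around `x₀`. -/
def chartCoframe (x₀ : X) (x : X) : E →L[ℂ] E :=
  mfderiv 𝓘(ℂ, E) 𝓘(ℂ, E) (chartAt E x₀) x

theorem chartCoframe_frame (x₀ : X) {z : E} (hz : z ∈ (chartAt E x₀).target) (v : E) :
    chartCoframe E x₀ ((chartAt E x₀).symm z) (chartFrame E x₀ z v) = v := by
  have : IsManifold 𝓘(ℂ, E) 1 X := IsManifold.of_le (n := ω) le_top
  exact congrArg (fun l : E →L[ℂ] E => l v)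
    ((mdifferentiable_chart (I := 𝓘(ℂ, E)) x₀).comp_symm_deriv hz)

theorem chartFrame_coframe (x₀ : X) {x : X} (hx : x ∈ (chartAt E x₀).source) (v : E) :
    chartFrame E x₀ (chartAt E x₀ x) (chartCoframe E x₀ x v) = v := by
  have : IsManifold 𝓘(ℂ, E) 1 X := IsManifold.of_le (n := ω) le_top
  exact congrArg (fun l : E →L[ℂ] E => l v)
    ((mdifferentiable_chart (I := 𝓘(ℂ, E)) x₀).symm_comp_deriv hx)

/-- The tangent space at `x₀` is modelled on `E` through the preferred chart at `x₀`. This is why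
covectors at `b` need no transport when the base is read in the chart at `b`. -/
theorem chartCoframe_self (x₀ : X) (v : E) : chartCoframe E x₀ x₀ v = v := by
  have : IsManifold 𝓘(ℂ, E) 1 X := IsManifold.of_le (n := ω) le_top
  have h := mfderiv_chartAt_eq_tangentCoordChange (I := 𝓘(ℂ, E)) (x := x₀) (y := x₀)
    (mem_chart_source E x₀)
  have h2 := tangentCoordChange_self (I := 𝓘(ℂ, E)) (x := x₀) (z := x₀) (v := v)
    (mem_extChartAt_source x₀)
  rw [← h] at h2
  exact h2

theorem chartFrame_self (x₀ : X) (v : E) : chartFrame E x₀ (chartAt E x₀ x₀) v = v := by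
  have := chartFrame_coframe x₀ (mem_chart_source E x₀) v
  rwa [chartCoframe_self] at this

theorem chartFrame_bijective (x₀ : X) {z : E} (hz : z ∈ (chartAt E x₀).target) :
    Function.Bijective (chartFrame E x₀ z) := by
  refine ⟨Function.LeftInverse.injective (chartCoframe_frame x₀ hz), fun v => ?_⟩
  have := chartFrame_coframe x₀ ((chartAt E x₀).map_target hz) v
  rw [(chartAt E x₀).right_inv hz] at this
  exact ⟨_, this⟩

theorem chartCoframe_bijective (x₀ : X) {x : X} (hx : x ∈ (chartAt E x₀).source) :
    Function.Bijective (chartCoframe E x₀ x) := by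
  refine ⟨Function.LeftInverse.injective (chartFrame_coframe x₀ hx), fun v => ?_⟩
  have := chartCoframe_frame x₀ ((chartAt E x₀).map_source hx) v
  rw [(chartAt E x₀).left_inv hx] at this
  exact ⟨_, this⟩

theorem contDiffOn_localRep {H : X → Y} (hH : ContMDiff 𝓘(ℂ, E) 𝓘(ℂ, E') ω H) (x₀ : X) (y₀ : Y) :
    ContDiffOn ℂ ω (localRep E E' H x₀ y₀) (localDomain E E' H x₀ y₀) := by
  rw [← contMDiffOn_iff_contDiffOn]
  intro z hz
  have h1 : ContMDiffAt 𝓘(ℂ, E) 𝓘(ℂ, E) ω (chartAt E x₀).symm z :=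
    (contMDiffOn_chart_symm (n := ω)).contMDiffAt ((chartAt E x₀).open_target.mem_nhds hz.1)
  have h2 : ContMDiffAt 𝓘(ℂ, E') 𝓘(ℂ, E') ω (chartAt E' y₀) (H ((chartAt E x₀).symm z)) :=
    (contMDiffOn_chart).contMDiffAt ((chartAt E' y₀).open_source.mem_nhds hz.2)
  exact (h2.comp z ((hH _).comp z h1)).contMDiffWithinAt

theorem fderiv_localRep {H : X → Y} (hH : ContMDiff 𝓘(ℂ, E) 𝓘(ℂ, E') ω H) {x₀ : X} {y₀ : Y} {z : E}
    (hz : z ∈ localDomain E E' H x₀ y₀) (v : E) :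
    fderiv ℂ (localRep E E' H x₀ y₀) z v =
      chartCoframe E' y₀ (H ((chartAt E x₀).symm z))
        (mfderiv 𝓘(ℂ, E) 𝓘(ℂ, E') H ((chartAt E x₀).symm z) (chartFrame E x₀ z v)) := by
  have : IsManifold 𝓘(ℂ, E) 1 X := IsManifold.of_le (n := ω) le_top
  have : IsManifold 𝓘(ℂ, E') 1 Y := IsManifold.of_le (n := ω) le_top
  have h1 : MDifferentiableAt 𝓘(ℂ, E) 𝓘(ℂ, E) (chartAt E x₀).symm z :=
    mdifferentiableAt_atlas_symm (chart_mem_atlas E x₀) hz.1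
  have h2 : MDifferentiableAt 𝓘(ℂ, E') 𝓘(ℂ, E') (chartAt E' y₀) (H ((chartAt E x₀).symm z)) :=
    mdifferentiableAt_atlas (chart_mem_atlas E' y₀) hz.2
  have h3 := (hH ((chartAt E x₀).symm z)).mdifferentiableAt (by simp)
  rw [← mfderiv_eq_fderiv]
  have h4 := mfderiv_comp z h2 (h3.comp z h1)
  rw [mfderiv_comp z h3 h1] at h4
  exact congrArg (fun l : E →L[ℂ] E' => l v) h4

end Charts

section SubsetsInCharts

variable {E : Type*} [NormedAddCommGroup E] [NormedSpace ℂ E]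
  {X : Type*} [TopologicalSpace X] [ChartedSpace E X] [IsManifold 𝓘(ℂ, E) ω X]

theorem contDiffOn_comp_chart_symm {k : ℕ} {f : X → Fin k → ℂ} {U : Set X}
    (hf : ContMDiffOn 𝓘(ℂ, E) 𝓘(ℂ, Fin k → ℂ) ω f U) (x₀ : X) :
    ContDiffOn ℂ ω (fun z => f ((chartAt E x₀).symm z))
      ((chartAt E x₀).target ∩ (chartAt E x₀).symm ⁻¹' U) := by
  rw [← contMDiffOn_iff_contDiffOn]
  exact hf.comp ((contMDiffOn_chart_symm (n := ω)).mono inter_subset_left) fun z hz => hz.2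

theorem IsAnalyticSubset.exists_equations {A : Set X} (hA : IsAnalyticSubset (E := E) A) (x₀ : X)
    {z : E} (hz : z ∈ (chartAt E x₀).target) :
    ∃ O ⊆ (chartAt E x₀).target, IsOpen O ∧ z ∈ O ∧ ∃ (k : ℕ) (f : E → Fin k → ℂ),
      ContDiffOn ℂ ω f O ∧ (chartAt E x₀).symm ⁻¹' A ∩ O = {y ∈ O | f y = 0} := by
  obtain ⟨U, hU, hzU, k, f, hf, hfA⟩ := hA ((chartAt E x₀).symm z)
  refine ⟨_, inter_subset_left, (chartAt E x₀).symm.isOpen_inter_preimage hU, ⟨hz, hzU⟩, k, _,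
    contDiffOn_comp_chart_symm hf x₀, ?_⟩
  ext y
  have := Set.ext_iff.1 hfA ((chartAt E x₀).symm y)
  simp only [mem_inter_iff, mem_ofPred_eq, mem_preimage] at this ⊢
  constructor
  · rintro ⟨h1, h2, h3⟩
    exact ⟨⟨h2, h3⟩, (this.1 ⟨h1, h3⟩).2⟩
  · rintro ⟨⟨h2, h3⟩, h4⟩
    exact ⟨(this.2 ⟨h3, h4⟩).1, h2, h3⟩

theorem IsSmoothPointWithTangent.exists_equations {A : Set X} {x : X}
    {T : Submodule ℂ (TangentSpace 𝓘(ℂ, E) x)} (hT : IsSmoothPointWithTangent A x T) :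
    ∃ O ⊆ (chartAt E x).target, IsOpen O ∧ chartAt E x x ∈ O ∧ ∃ (k : ℕ) (f : E → Fin k → ℂ),
      ContDiffOn ℂ ω f O ∧ (chartAt E x).symm ⁻¹' A ∩ O = {y ∈ O | f y = 0} ∧
      Function.Surjective (fderiv ℂ f (chartAt E x x)) ∧
      ∀ v : E, v ∈ (T : Submodule ℂ E) ↔ fderiv ℂ f (chartAt E x x) v = 0 := by
  obtain ⟨-, U, hU, hxU, k, f, hf, hfA, hs, hker⟩ := hT
  have hx := mem_chart_target E x
  have hsymm := (chartAt E x).left_inv (mem_chart_source E x)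
  have : IsManifold 𝓘(ℂ, E) 1 X := IsManifold.of_le (n := ω) le_top
  have hd : ∀ v : E, fderiv ℂ (fun z => f ((chartAt E x).symm z)) (chartAt E x x) v =
      mfderiv 𝓘(ℂ, E) 𝓘(ℂ, Fin k → ℂ) f x v := by
    intro v
    have h1 : MDifferentiableAt 𝓘(ℂ, E) 𝓘(ℂ, E) (chartAt E x).symm (chartAt E x x) :=
      mdifferentiableAt_atlas_symm (chart_mem_atlas E x) hx
    have h3 : MDifferentiableAt 𝓘(ℂ, E) 𝓘(ℂ, Fin k → ℂ) f ((chartAt E x).symm (chartAt E x x)) := by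
      rw [hsymm]
      exact (hf.contMDiffAt (hU.mem_nhds hxU)).mdifferentiableAt (by simp)
    rw [← mfderiv_eq_fderiv]
    have h4 := mfderiv_comp (chartAt E x x) h3 h1
    have h5 := congrArg (fun l : E →L[ℂ] (Fin k → ℂ) => l v) h4
    refine h5.trans ?_
    change (mfderiv 𝓘(ℂ, E) 𝓘(ℂ, Fin k → ℂ) f ((chartAt E x).symm (chartAt E x x)) : E → _)
      (chartFrame E x (chartAt E x x) v) = _
    rw [chartFrame_self, hsymm]
  refine ⟨_, inter_subset_left, (chartAt E x).symm.isOpen_inter_preimage hU,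
    ⟨hx, by simpa [hsymm] using hxU⟩, k, _, contDiffOn_comp_chart_symm hf x, ?_, ?_, ?_⟩
  · ext y
    have := Set.ext_iff.1 hfA ((chartAt E x).symm y)
    simp only [mem_inter_iff, mem_ofPred_eq, mem_preimage] at this ⊢
    constructor
    · rintro ⟨h1, h2, h3⟩
      exact ⟨⟨h2, h3⟩, (this.1 ⟨h1, h3⟩).2⟩
    · rintro ⟨⟨h2, h3⟩, h4⟩
      exact ⟨(this.2 ⟨h3, h4⟩).1, h2, h3⟩
  · intro y
    obtain ⟨v, hv⟩ := hs y
    exact ⟨v, (hd v).trans hv⟩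
  · intro v
    rw [hd]
    exact hker v

end SubsetsInCharts

end

/-! ### The integrable system in charts -/

section

universe u

variable {EM EB : Type*} [NormedAddCommGroup EM] [NormedSpace ℂ EM]
  [NormedAddCommGroup EB] [NormedSpace ℂ EB]
  {M : Type u} [TopologicalSpace M] [ChartedSpace EM M]
  {B : Type*} [TopologicalSpace B] [ChartedSpace EB B]

namespace IntegrableSystem

theorem contMDiff (𝓢 : IntegrableSystem EM EB M B) : ContMDiff 𝓘(ℂ, EM) 𝓘(ℂ, EB) ω 𝓢.H :=
  𝓢.flat.choose

/-- The derivative of the map `H`, on the model spaces. -/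
def dH (𝓢 : IntegrableSystem EM EB M B) (m : M) : EM →L[ℂ] EB :=
  mfderiv 𝓘(ℂ, EM) 𝓘(ℂ, EB) 𝓢.H m

/-- The symplectic form, on the model space. -/
def form (𝓢 : IntegrableSystem EM EB M B) (m : M) : EM [⋀^Fin 2]→L[ℂ] ℂ := 𝓢.Ω m

/-- The symplectic form in the chart around `m₀`. -/
def localForm (𝓢 : IntegrableSystem EM EB M B) (m₀ : M) : EM → EM [⋀^Fin 2]→L[ℂ] ℂ :=
  chartRep 𝓢.Ω m₀

theorem isFieldValue_def (𝓢 : IntegrableSystem EM EB M B) (b : B) (α : EB →L[ℂ] ℂ) (m : M)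
    (v : EM) : 𝓢.IsFieldValue b α m v ↔ 𝓢.H m = b ∧ ∀ w, 𝓢.form m ![v, w] = α (𝓢.dH m w) :=
  Iff.rfl

theorem form_nondegenerate (𝓢 : IntegrableSystem EM EB M B) (m : M) (v : EM)
    (hv : ∀ w, 𝓢.form m ![v, w] = 0) : v = 0 :=
  𝓢.symplectic.nondegenerate m v hv

theorem dH_surjective (𝓢 : IntegrableSystem EM EB M B) {m : M} (hm : 𝓢.H m ∉ 𝓢.S) :
    Function.Surjective (𝓢.dH m) :=
  𝓢.submersion m hm

theorem form_lagrangian (𝓢 : IntegrableSystem EM EB M B) {m : M} (hm : 𝓢.H m ∉ 𝓢.S) (v : EM) :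
    𝓢.dH m v = 0 ↔ ∀ w, 𝓢.dH m w = 0 → 𝓢.form m ![v, w] = 0 :=
  𝓢.lagrangian m hm v

theorem localForm_apply (𝓢 : IntegrableSystem EM EB M B) (m₀ : M) (z v w : EM) :
    𝓢.localForm m₀ z ![v, w] = 𝓢.form ((chartAt EM m₀).symm z)
      ![chartFrame EM m₀ z v, chartFrame EM m₀ z w] := by
  change 𝓢.form ((chartAt EM m₀).symm z) (chartFrame EM m₀ z ∘ ![v, w]) = _
  congr 1
  ext i
  fin_cases i <;> rfl

theorem localForm_continuousOn (𝓢 : IntegrableSystem EM EB M B) (m₀ : M) :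
    ContinuousOn (𝓢.localForm m₀) (chartAt EM m₀).target :=
  (𝓢.symplectic.holomorphic m₀).continuousOn

theorem localForm_differentiableOn (𝓢 : IntegrableSystem EM EB M B) (m₀ : M) :
    DifferentiableOn ℂ (𝓢.localForm m₀) (chartAt EM m₀).target :=
  (𝓢.symplectic.holomorphic m₀).differentiableOn (by simp)

section ChartRep

variable [IsManifold 𝓘(ℂ, EM) ω M] (𝓢 : IntegrableSystem EM EB M B)

theorem localForm_nondegenerate {m₀ : M} {z : EM} (hz : z ∈ (chartAt EM m₀).target) (v : EM)
    (hv : ∀ w, 𝓢.localForm m₀ z ![v, w] = 0) : v = 0 := by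
  have hb := chartFrame_bijective m₀ hz
  apply hb.1
  rw [map_zero]
  refine 𝓢.form_nondegenerate ((chartAt EM m₀).symm z) _ fun w => ?_
  obtain ⟨w, rfl⟩ := hb.2 w
  rw [← localForm_apply]
  exact hv w

variable [IsManifold 𝓘(ℂ, EB) ω B]

theorem fderiv_localRep_eq {m₀ : M} {b : B} {z : EM}
    (hz : z ∈ localDomain EM EB 𝓢.H m₀ b) (v : EM) :
    fderiv ℂ (localRep EM EB 𝓢.H m₀ b) z v =
      chartCoframe EB b (𝓢.H ((chartAt EM m₀).symm z))
        (𝓢.dH ((chartAt EM m₀).symm z) (chartFrame EM m₀ z v)) :=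
  fderiv_localRep 𝓢.contMDiff hz v

theorem fderiv_localRep_surjective {m₀ : M} {b : B} {z : EM}
    (hz : z ∈ localDomain EM EB 𝓢.H m₀ b) (hS : 𝓢.H ((chartAt EM m₀).symm z) ∉ 𝓢.S) :
    Function.Surjective (fderiv ℂ (localRep EM EB 𝓢.H m₀ b) z) := by
  intro y
  obtain ⟨y', rfl⟩ := (chartCoframe_bijective b hz.2).2 y
  obtain ⟨v, hv⟩ := 𝓢.dH_surjective hS y'
  obtain ⟨v', hv'⟩ := (chartFrame_bijective m₀ hz.1).2 v
  exact ⟨v', by rw [𝓢.fderiv_localRep_eq hz, hv', hv]⟩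

/-- The chart on `B` is the one at the image point `b` itself, so its derivative is the identity and
the same `α` appears on both sides. -/
theorem isFieldValue_iff {m₀ : M} {b : B} {z : EM} (hz : z ∈ (chartAt EM m₀).target)
    (hb : 𝓢.H ((chartAt EM m₀).symm z) = b) (α : EB →L[ℂ] ℂ) (v : EM) :
    𝓢.IsFieldValue b α ((chartAt EM m₀).symm z) (chartFrame EM m₀ z v) ↔
      ∀ w, 𝓢.localForm m₀ z ![v, w] = α (fderiv ℂ (localRep EM EB 𝓢.H m₀ b) z w) := by
  have hz' : z ∈ localDomain EM EB 𝓢.H m₀ b := ⟨hz, by rw [hb]; exact mem_chart_source EB b⟩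
  have hd : ∀ w, fderiv ℂ (localRep EM EB 𝓢.H m₀ b) z w =
      𝓢.dH ((chartAt EM m₀).symm z) (chartFrame EM m₀ z w) := by
    intro w
    rw [𝓢.fderiv_localRep_eq hz', hb, chartCoframe_self]
  rw [isFieldValue_def]
  constructor
  · rintro ⟨-, h⟩ w
    rw [hd, localForm_apply]
    exact h _
  · refine fun h => ⟨hb, fun w => ?_⟩
    obtain ⟨w', rfl⟩ := (chartFrame_bijective m₀ hz).2 w
    rw [← hd, ← localForm_apply]
    exact h w'

theorem isFieldValue_iff_of_mem_source {m₀ m : M} {b : B} (hm : m ∈ (chartAt EM m₀).source)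
    (hb : 𝓢.H m = b) (α : EB →L[ℂ] ℂ) (v : EM) :
    𝓢.IsFieldValue b α m (chartFrame EM m₀ (chartAt EM m₀ m) v) ↔
      ∀ w, 𝓢.localForm m₀ (chartAt EM m₀ m) ![v, w] =
        α (fderiv ℂ (localRep EM EB 𝓢.H m₀ b) (chartAt EM m₀ m) w) := by
  have hinv := (chartAt EM m₀).left_inv hm
  have h := 𝓢.isFieldValue_iff ((chartAt EM m₀).map_source hm) (congrArg 𝓢.H hinv |>.trans hb) α v
  rw [isFieldValue_def, hinv] at h
  rw [isFieldValue_def]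
  exact h

end ChartRep

variable [IsManifold 𝓘(ℂ, EM) ω M] (𝓢 : IntegrableSystem EM EB M B)

/-- The Lagrangian condition at regular points of a Lagrangian subvariety, in a chart. -/
theorem lagrangian_at_regular_point {L : Set M} (hL : IsLagrangianSubvariety 𝓢.Ω L) (m₀ : M)
    {q : EM} {O' : Set EM} {r : ℕ} {g : EM → Fin r → ℂ} (hqL : (chartAt EM m₀).symm q ∈ L)
    (hqO' : q ∈ O') (hO't : O' ⊆ (chartAt EM m₀).target) (hO' : IsOpen O')
    (hg : ContDiffOn ℂ ω g O') (hgL : (chartAt EM m₀).symm ⁻¹' L ∩ O' = {x ∈ O' | g x = 0})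
    (hgs : Function.Surjective (fderiv ℂ g q)) (v : EM) :
    fderiv ℂ g q v = 0 ↔ ∀ w, fderiv ℂ g q w = 0 → 𝓢.localForm m₀ q ![v, w] = 0 := by
  have h1M : IsManifold 𝓘(ℂ, EM) 1 M := IsManifold.of_le (n := ω) le_top
  set φ := chartAt EM m₀ with hφ
  set x := φ.symm q with hx
  have hqt : q ∈ φ.target := hO't hqO'
  have hxs : x ∈ φ.source := φ.map_target hqt
  have hxq : φ x = q := φ.right_inv hqt
  set U : Set M := φ.source ∩ φ ⁻¹' O' with hU
  have hUo : IsOpen U := φ.isOpen_inter_preimage hO'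
  have hxU : x ∈ U := ⟨hxs, by rw [mem_preimage, hxq]; exact hqO'⟩
  have hgU : ContMDiffOn 𝓘(ℂ, EM) 𝓘(ℂ, Fin r → ℂ) ω (g ∘ φ) U :=
    (contMDiffOn_iff_contDiffOn.2 hg).comp
      ((contMDiffOn_chart (n := ω) (x := m₀)).mono inter_subset_left) fun y hy => hy.2
  have hd : ∀ w : EM, (mfderiv 𝓘(ℂ, EM) 𝓘(ℂ, Fin r → ℂ) (g ∘ φ) x : EM → Fin r → ℂ) w =
      fderiv ℂ g q (chartCoframe EM m₀ x w) := by
    intro w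
    have h2 : MDifferentiableAt 𝓘(ℂ, EM) 𝓘(ℂ, EM) φ x :=
      mdifferentiableAt_atlas (chart_mem_atlas EM m₀) hxs
    have h3 : MDifferentiableAt 𝓘(ℂ, EM) 𝓘(ℂ, Fin r → ℂ) g (φ x) := by
      rw [hxq, mdifferentiableAt_iff_differentiableAt]
      exact (hg.contDiffAt (hO'.mem_nhds hqO')).differentiableAt (by simp)
    have h4 := mfderiv_comp x h3 h2
    rw [mfderiv_eq_fderiv] at h4
    have h5 := congrArg (fun l : EM →L[ℂ] (Fin r → ℂ) => l w) h4
    refine h5.trans ?_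
    change fderiv ℂ g (φ x) (chartCoframe EM m₀ x w) = _
    rw [hxq]
  -- The preferred chart at `x` may differ from the one at `m₀`, so the tangent space of `L` at `x`
  -- is the kernel of `dg` pulled back by the coframe.
  let W : Submodule ℂ EM := LinearMap.ker ((fderiv ℂ g q ∘L chartCoframe EM m₀ x) :
    EM →ₗ[ℂ] Fin r → ℂ)
  have hW : ∀ w, w ∈ W ↔ fderiv ℂ g q (chartCoframe EM m₀ x w) = 0 := fun w => by simp [W]
  have hsm : IsSmoothPointWithTangent (E := EM) L x W := by
    refine ⟨hqL, U, hUo, hxU, r, g ∘ φ, hgU, ?_, ?_, fun w => ?_⟩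
    · ext y
      constructor
      · rintro ⟨h1, h2⟩
        refine ⟨h2, ((Set.ext_iff.1 hgL (φ y)).1 ⟨?_, h2.2⟩).2⟩
        rw [mem_preimage, φ.left_inv h2.1]
        exact h1
      · rintro ⟨h1, h2⟩
        refine ⟨?_, h1⟩
        have := ((Set.ext_iff.1 hgL (φ y)).2 ⟨h1.2, h2⟩).1
        rwa [mem_preimage, φ.left_inv h1.1] at this
    · intro y
      obtain ⟨v, hv⟩ := hgs y
      obtain ⟨v', hv'⟩ := (chartCoframe_bijective m₀ hxs).2 v
      refine ⟨v', (hd v').trans ?_⟩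
      rw [hv', hv]
    · exact (hW w).trans (Eq.congr (hd w) rfl).symm
  have hlag : ∀ v, v ∈ W ↔ ∀ w ∈ W, 𝓢.form x ![v, w] = 0 := hL.2 x W hsm
  have hframe : ∀ w, chartFrame EM m₀ q w ∈ W ↔ fderiv ℂ g q w = 0 := by
    intro w
    rw [hW, chartCoframe_frame m₀ hqt]
  rw [← hframe, hlag]
  refine ⟨fun h w hw => ?_, fun h w hw => ?_⟩
  · rw [localForm_apply]
    exact h _ ((hframe w).2 hw)
  · obtain ⟨w', rfl⟩ := (chartFrame_bijective m₀ hqt).2 w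
    have h2 := h w' ((hframe w').1 hw)
    rwa [localForm_apply] at h2

end IntegrableSystem

end

/-! ### Invariant vector fields on torus fibres -/

section

universe u

section ChartOfMap

variable {E : Type*} [NormedAddCommGroup E] [NormedSpace ℂ E]
  {X : Type*} [TopologicalSpace X] [ChartedSpace E X] [IsManifold 𝓘(ℂ, E) ω X]
  {V : Type*} [NormedAddCommGroup V] [NormedSpace ℂ V]

variable (E) in
/-- The derivative of a map from a vector space to a manifold, on the model space. -/
def dMap (f : V → X) (x : V) : V →L[ℂ] E := mfderiv 𝓘(ℂ, V) 𝓘(ℂ, E) f x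

theorem fderiv_chart_comp {f : V → X} {x : V} (hf : MDifferentiableAt 𝓘(ℂ, V) 𝓘(ℂ, E) f x) {x₀ : X}
    (hx : f x ∈ (chartAt E x₀).source) :
    HasFDerivAt (fun y => chartAt E x₀ (f y)) (chartCoframe E x₀ (f x) ∘L dMap E f x) x := by
  have : IsManifold 𝓘(ℂ, E) 1 X := IsManifold.of_le (n := ω) le_top
  have h1 : MDifferentiableAt 𝓘(ℂ, E) 𝓘(ℂ, E) (chartAt E x₀) (f x) :=
    mdifferentiableAt_atlas (chart_mem_atlas E x₀) hx
  have h2 := mfderiv_comp x h1 hf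
  have h3 := (mdifferentiableAt_iff_differentiableAt.1 (h1.comp x hf)).hasFDerivAt
  rw [← mfderiv_eq_fderiv, h2] at h3
  exact h3

theorem contDiffAt_chart_comp {f : V → X} {x : V} (hf : ContMDiffAt 𝓘(ℂ, V) 𝓘(ℂ, E) ω f x) {x₀ : X}
    (hx : f x ∈ (chartAt E x₀).source) : ContDiffAt ℂ ω (fun y => chartAt E x₀ (f y)) x := by
  rw [← contMDiffAt_iff_contDiffAt]
  exact ((contMDiffOn_chart (n := ω)).contMDiffAt ((chartAt E x₀).open_source.mem_nhds hx)).comp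
    x hf

theorem chartFrame_fderiv_chart_comp {f : V → X} {x : V}
    (hf : MDifferentiableAt 𝓘(ℂ, V) 𝓘(ℂ, E) f x) {x₀ : X}
    (hx : f x ∈ (chartAt E x₀).source) (v : V) :
    chartFrame E x₀ (chartAt E x₀ (f x)) (fderiv ℂ (fun y => chartAt E x₀ (f y)) x v) =
      dMap E f x v := by
  rw [(fderiv_chart_comp hf hx).fderiv]
  exact chartFrame_coframe x₀ hx _

end ChartOfMap

variable {EM EB : Type*} [NormedAddCommGroup EM] [NormedSpace ℂ EM]
  [NormedAddCommGroup EB] [NormedSpace ℂ EB]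
  {M : Type u} [TopologicalSpace M] [ChartedSpace EM M]
  {B : Type*} [TopologicalSpace B] [ChartedSpace EB B]

namespace IntegrableSystem

theorem isFieldValue_unique (𝓢 : IntegrableSystem EM EB M B) {b : B} {α : EB →L[ℂ] ℂ} {m : M}
    {v v' : EM} (h : 𝓢.IsFieldValue b α m v) (h' : 𝓢.IsFieldValue b α m v') : v = v' := by
  rw [isFieldValue_def] at h h'
  rw [← sub_eq_zero]
  refine 𝓢.form_nondegenerate m _ fun w => ?_
  rw [← pairing_apply, map_sub, LinearMap.sub_apply, pairing_apply, pairing_apply, h.2, h'.2,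
    sub_self]

/-- `dH` is surjective over regular values, so a covector is determined by its pullback at a single
point of the fibre. -/
theorem covector_unique (𝓢 : IntegrableSystem EM EB M B) {b : B} (hb : b ∉ 𝓢.S)
    {α β : EB →L[ℂ] ℂ} {m : M} {v : EM} (h : 𝓢.IsFieldValue b α m v)
    (h' : 𝓢.IsFieldValue b β m v) : α = β := by
  rw [isFieldValue_def] at h h'
  ext e
  obtain ⟨w, rfl⟩ := 𝓢.dH_surjective (m := m) (by rw [h.1]; exact hb) e
  rw [← h.2, h'.2]

theorem isFieldValue_linear (𝓢 : IntegrableSystem EM EB M B) {b : B} {α β : EB →L[ℂ] ℂ} {m : M}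
    {v w : EM} (c : ℂ) (h : 𝓢.IsFieldValue b α m v) (h' : 𝓢.IsFieldValue b β m w) :
    𝓢.IsFieldValue b (c • α + β) m (c • v + w) := by
  rw [isFieldValue_def] at *
  refine ⟨h.1, fun y => ?_⟩
  rw [← pairing_apply, map_add, map_smul, LinearMap.add_apply, LinearMap.smul_apply, pairing_apply,
    pairing_apply, h.2, h'.2]
  simp

/-- The kernel of `dH` is Lagrangian, so the contraction of `Ω` with a vertical vector kills the
kernel and descends along `dH`. -/
theorem exists_isFieldValue [FiniteDimensional ℂ EB] (𝓢 : IntegrableSystem EM EB M B) {b : B}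
    (hb : b ∉ 𝓢.S) {m : M} (hm : 𝓢.H m = b) {v : EM} (hv : 𝓢.dH m v = 0) :
    ∃ α : EB →L[ℂ] ℂ, 𝓢.IsFieldValue b α m v := by
  have hS : 𝓢.H m ∉ 𝓢.S := by rwa [hm]
  obtain ⟨β, hβ⟩ := exists_covector (𝓢.form m) (𝓢.dH_surjective hS) (v := v)
    ((𝓢.form_lagrangian hS v).1 hv)
  exact ⟨β, hm, hβ⟩

theorem finrank_eq [FiniteDimensional ℂ EM] [FiniteDimensional ℂ EB]
    (𝓢 : IntegrableSystem EM EB M B) {m : M} (hS : 𝓢.H m ∉ 𝓢.S) :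
    Module.finrank ℂ EM = 2 * Module.finrank ℂ EB := by
  have h1 := two_mul_finrank_of_lagrangian (𝓢.form_nondegenerate m)
    (W := LinearMap.ker (𝓢.dH m : EM →ₗ[ℂ] EB)) (fun v => by
      simpa using 𝓢.form_lagrangian hS v)
  have h2 := LinearMap.finrank_range_add_finrank_ker (𝓢.dH m : EM →ₗ[ℂ] EB)
  have h3 : LinearMap.range (𝓢.dH m : EM →ₗ[ℂ] EB) = ⊤ :=
    LinearMap.range_eq_top.2 (𝓢.dH_surjective hS)
  rw [h3, finrank_top] at h2
  omega

theorem localRep_eq_of_mem_fibre (𝓢 : IntegrableSystem EM EB M B) {m₀ m : M} {b : B}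
    (hm : m ∈ (chartAt EM m₀).source) (hmb : 𝓢.H m = b) :
    localRep EM EB 𝓢.H m₀ b (chartAt EM m₀ m) = chartAt EB b b := by
  simp only [localRep, (chartAt EM m₀).left_inv hm, hmb]

theorem dH_dMap {V : Type*} [NormedAddCommGroup V] [NormedSpace ℂ V] {b : B} {p : V → M}
    (𝓢 : IntegrableSystem EM EB M B) (hp : ContMDiff 𝓘(ℂ, V) 𝓘(ℂ, EM) ω p)
    (hpb : ∀ x, 𝓢.H (p x) = b) (x v : V) : 𝓢.dH (p x) (dMap EM p x v) = 0 := by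
  have h1 := (𝓢.contMDiff (p x)).mdifferentiableAt (n := ω) (by simp)
  have h2 := (hp x).mdifferentiableAt (n := ω) (by simp)
  have h3 := mfderiv_comp x h1 h2
  have h4 : 𝓢.H ∘ p = fun _ => b := funext hpb
  rw [h4, mfderiv_const] at h3
  exact (congrArg (fun l : V →L[ℂ] EB => l v) h3).symm

/-- Supplies the periodicity needed for the Liouville argument in `exists_constant_covector`. -/
theorem dMap_eq_of_periodic {V : Type*} [NormedAddCommGroup V] [NormedSpace ℂ V] {p : V → M}
    (hp : ContMDiff 𝓘(ℂ, V) 𝓘(ℂ, EM) ω p) {c : V}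
    (hc : ∀ x, p (x + c) = p x) (x : V) : dMap EM p (x + c) = dMap EM p x := by
  have h1 := (hp (x + c)).mdifferentiableAt (n := ω) (by simp)
  have h2 : HasFDerivAt (fun y : V => y + c) (ContinuousLinearMap.id ℂ V) x :=
    (hasFDerivAt_id x).add_const c
  have h3 := HasMFDerivAt.comp (f := fun y : V => y + c) x h1.hasMFDerivAt h2.hasMFDerivAt
  have h4 : p ∘ (fun y : V => y + c) = p := funext hc
  rw [h4] at h3
  exact h3.mfderiv.symm

variable [IsManifold 𝓘(ℂ, EM) ω M] [IsManifold 𝓘(ℂ, EB) ω B]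

/-- Local parametrization, in a chart, of the fibre over a regular value. -/
theorem exists_fibre_slice [FiniteDimensional ℂ EM] [FiniteDimensional ℂ EB]
    (𝓢 : IntegrableSystem EM EB M B) {b : B} (hb : b ∉ 𝓢.S) {m₀ : M} (hm₀ : 𝓢.H m₀ = b) :
    ∃ (T : Submodule ℂ EM) (κ : EM →L[ℂ] T) (σ : T → EM),
      (∀ v, v ∈ T ↔ fderiv ℂ (localRep EM EB 𝓢.H m₀ b) (chartAt EM m₀ m₀) v = 0) ∧
      Module.finrank ℂ T = Module.finrank ℂ EB ∧
      (∀ v : T, κ v = v) ∧ ContinuousAt σ 0 ∧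
      (∀ᶠ t in 𝓝 0, σ t ∈ (chartAt EM m₀).target ∧ 𝓢.H ((chartAt EM m₀).symm (σ t)) = b ∧
        κ (σ t - chartAt EM m₀ m₀) = t) ∧
      ∀ᶠ m in 𝓝 m₀, 𝓢.H m = b → σ (κ (chartAt EM m₀ m - chartAt EM m₀ m₀)) = chartAt EM m₀ m := by
  set φ := chartAt EM m₀ with hφ
  set h := localRep EM EB 𝓢.H m₀ b with hh
  have hs0 : m₀ ∈ φ.source := mem_chart_source EM m₀
  have hz : φ m₀ ∈ localDomain EM EB 𝓢.H m₀ b :=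
    ⟨mem_chart_target EM m₀, by rw [φ.left_inv hs0, hm₀]; exact mem_chart_source EB b⟩
  have hS : 𝓢.H (φ.symm (φ m₀)) ∉ 𝓢.S := by rwa [φ.left_inv hs0, hm₀]
  have hZo := isOpen_localDomain (E := EM) (E' := EB) 𝓢.contMDiff.continuous m₀ b
  have hsurj := 𝓢.fderiv_localRep_surjective hz hS
  have hc : ContDiffAt ℂ ω h (φ m₀) :=
    (contDiffOn_localRep 𝓢.contMDiff m₀ b).contDiffAt (hZo.mem_nhds hz)
  have hh0 : h (φ m₀) = chartAt EB b b := 𝓢.localRep_eq_of_mem_fibre hs0 hm₀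
  let T : Submodule ℂ EM := LinearMap.ker (fderiv ℂ h (φ m₀) : EM →ₗ[ℂ] EB)
  have hT : ∀ v, v ∈ T ↔ fderiv ℂ h (φ m₀) v = 0 := fun v => by simp [T]
  obtain ⟨κ, σ, hκ, hσc, hσ0, hσ1, hσ2, -⟩ := exists_slice hc hsurj T hT
  refine ⟨T, κ, σ, hT, ?_, hκ, hσc.continuousAt, ?_, ?_⟩
  · have h2 := LinearMap.finrank_range_add_finrank_ker (fderiv ℂ h (φ m₀) : EM →ₗ[ℂ] EB)
    have h3 : LinearMap.range (fderiv ℂ h (φ m₀) : EM →ₗ[ℂ] EB) = ⊤ :=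
      LinearMap.range_eq_top.2 hsurj
    have h4 := 𝓢.finrank_eq (m := m₀) (by rwa [hm₀])
    rw [h3, finrank_top] at h2
    change Module.finrank ℂ EB + Module.finrank ℂ T = _ at h2
    omega
  · have h5 : ∀ᶠ t in 𝓝 0, σ t ∈ localDomain EM EB 𝓢.H m₀ b :=
      hσc.continuousAt (hZo.mem_nhds (by rwa [hσ0]))
    filter_upwards [h5, hσ1] with t ht1 ht2
    refine ⟨ht1.1, ?_, ht2.2⟩
    refine (chartAt EB b).injOn ht1.2 (mem_chart_source EB b) ?_
    exact ht2.1.trans hh0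
  · have h6 : ContinuousAt φ m₀ := φ.continuousAt hs0
    filter_upwards [h6.eventually hσ2, φ.open_source.mem_nhds hs0] with m hm hms hmb
    exact hm (by rw [hh0]; exact 𝓢.localRep_eq_of_mem_fibre hms hmb)

section Torus

variable [FiniteDimensional ℂ EB]
  {V : Type*} [NormedAddCommGroup V] [NormedSpace ℂ V]
  {b : B} {p : V → M}

/-- The dimension of a parametrizing vector space is at least that of the fibre. -/
theorem finrank_le_of_range_eq [FiniteDimensional ℂ EM] [FiniteDimensional ℂ V] 
    (𝓢 : IntegrableSystem EM EB M B) (hb : b ∉ 𝓢.S)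
    (hp : ContMDiff 𝓘(ℂ, V) 𝓘(ℂ, EM) ω p) (hrange : range p = 𝓢.H ⁻¹' {b}) :
    Module.finrank ℂ EB ≤ Module.finrank ℂ V := by
  have hpb : ∀ x, 𝓢.H (p x) = b := fun x => by
    have : p x ∈ 𝓢.H ⁻¹' {b} := hrange ▸ mem_range_self x
    exact this
  obtain ⟨T, κ, σ, -, hdim, -, -, hσ, -⟩ := 𝓢.exists_fibre_slice hb (hpb 0)
  set φ := chartAt EM (p 0) with hφ
  let U : Set V := p ⁻¹' φ.source
  let q : V → T := fun x => κ (φ (p x) - φ (p 0))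
  have hq : ∀ x ∈ U, ContDiffAt ℝ 1 q x := fun x hx => by
    have h1 : ContDiffAt ℂ ω q x := κ.contDiff.contDiffAt.comp x
      ((contDiffAt_chart_comp (hp x) hx).sub contDiffAt_const)
    exact (h1.restrict_scalars ℝ).of_le le_top
  -- The definition of a torus leaves the dimension of `V` free. Since `p` is onto the fibre, the
  -- `C¹` map `q` covers a neighbourhood of `0` in `T`, and such a map does not raise Hausdorff
  -- dimension.
  have himage : q '' U ∈ 𝓝 (0 : T) := by
    filter_upwards [hσ] with t ⟨ht1, ht2, ht3⟩
    obtain ⟨x, hx⟩ : φ.symm (σ t) ∈ range p := by rw [hrange]; exact ht2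
    refine ⟨x, ?_, ?_⟩
    · change p x ∈ φ.source
      rw [hx]
      exact φ.map_target ht1
    · simp only [q, hx, φ.right_inv ht1]
      exact ht3
  have : FiniteDimensional ℝ V := FiniteDimensional.complexToReal V
  have : FiniteDimensional ℝ T := FiniteDimensional.complexToReal T
  have h1 : dimH (q '' U) ≤ dimH U := dimH_image_le_of_locally_lipschitzOn fun x hx => by
    obtain ⟨K, t, ht, hK⟩ := (hq x hx).exists_lipschitzOnWith
    exact ⟨K, t, mem_nhdsWithin_of_mem_nhds ht, hK⟩
  have h2 : dimH U ≤ Module.finrank ℝ V := (dimH_mono (subset_univ U)).trans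
    (Real.dimH_univ_eq_finrank V).le
  have h3 := (Real.dimH_of_mem_nhds himage).symm.le.trans (h1.trans h2)
  have h4 : Module.finrank ℝ T ≤ Module.finrank ℝ V := by exact_mod_cast h3
  rw [finrank_real_of_complex, finrank_real_of_complex] at h4
  omega

/-- The covector of a constant vector field on a torus fibre does not depend on the point. -/
theorem exists_constant_covector [FiniteDimensional ℂ V] 
    (𝓢 : IntegrableSystem EM EB M B) (hb : b ∉ 𝓢.S)
    (hp : ContMDiff 𝓘(ℂ, V) 𝓘(ℂ, EM) ω p) (hpb : ∀ x, 𝓢.H (p x) = b)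
    (Γ : Submodule ℤ V) [DiscreteTopology Γ] [IsZLattice ℝ Γ]
    (hΓ : ∀ x y, p x = p y ↔ x - y ∈ Γ) (v : V) :
    ∃ α : EB →L[ℂ] ℂ, ∀ x, 𝓢.IsFieldValue b α (p x) (dMap EM p x v) := by
  have : CompleteSpace EB := FiniteDimensional.complete ℂ EB
  have : FiniteDimensional ℝ V := FiniteDimensional.complexToReal V
  -- The covector `β x` is holomorphic and `Γ`-periodic in `x`, hence bounded, hence constant by
  -- Liouville.
  choose β hβ using fun x => 𝓢.exists_isFieldValue hb (hpb x) (𝓢.dH_dMap hp hpb x v)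
  have hper : ∀ x c, c ∈ Γ → β (x + c) = β x := by
    intro x c hc
    have hc' : ∀ x, p (x + c) = p x := fun x => (hΓ _ _).2 (by simpa using hc)
    have h1 := hβ (x + c)
    rw [hc', dMap_eq_of_periodic hp hc'] at h1
    exact 𝓢.covector_unique hb h1 (hβ x)
  have hdiff : ∀ e, Differentiable ℂ fun x => β x e := by
    intro e x₀
    set m₀ := p x₀ with hm₀
    set φ := chartAt EM m₀ with hφ
    set h := localRep EM EB 𝓢.H m₀ b with hh
    have hs0 : m₀ ∈ φ.source := mem_chart_source EM m₀
    have hz : φ m₀ ∈ localDomain EM EB 𝓢.H m₀ b :=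
      ⟨mem_chart_target EM m₀, by rw [φ.left_inv hs0, hpb]; exact mem_chart_source EB b⟩
    have hS : 𝓢.H (φ.symm (φ m₀)) ∉ 𝓢.S := by rw [φ.left_inv hs0, hpb]; exact hb
    have hZo := isOpen_localDomain (E := EM) (E' := EB) 𝓢.contMDiff.continuous m₀ b
    have hsurj := 𝓢.fderiv_localRep_surjective hz hS
    have hc : ContDiffAt ℂ ω h (φ m₀) :=
      (contDiffOn_localRep 𝓢.contMDiff m₀ b).contDiffAt (hZo.mem_nhds hz)
    obtain ⟨R, hR⟩ := ContinuousLinearMap.exists_rightInverse_of_surjective _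
      (LinearMap.range_eq_top.2 hsurj)
    set P : V → EM := fun x => φ (p x) with hP
    have hPc : ContDiffAt ℂ ω P x₀ := contDiffAt_chart_comp (hp x₀) hs0
    have hPd : DifferentiableAt ℂ P x₀ := hPc.differentiableAt (by simp)
    -- `R` lifts along `dh` only at the base point; composing with the inverse of `C x` corrects it
    -- at nearby points. Pairing with this lift in `hev` expresses `β x e` by holomorphic data.
    let C : V → EB →L[ℂ] EB := fun x => fderiv ℂ h (P x) ∘L R
    have hC0 : C x₀ = ContinuousLinearMap.id ℂ EB := hR
    have hCd : DifferentiableAt ℂ C x₀ := by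
      have h1 : DifferentiableAt ℂ (fderiv ℂ h) (P x₀) :=
        (hc.fderiv_right (m := ω) (by simp)).differentiableAt (by simp)
      have h2 : DifferentiableAt ℂ (fun x => fderiv ℂ h (P x)) x₀ := h1.comp x₀ hPd
      exact h2.clm_comp (differentiableAt_const R)
    have hinv : DifferentiableAt ℂ ContinuousLinearMap.inverse (C x₀) := by
      rw [hC0]
      exact (contDiffAt_map_inverse (𝕜 := ℂ) (n := 1)
        (ContinuousLinearEquiv.refl ℂ EB)).differentiableAt (by simp)
    have hCinv : ∀ᶠ x in 𝓝 x₀, (C x).IsInvertible := by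
      have h1 := ContinuousLinearEquiv.nhds (ContinuousLinearEquiv.refl ℂ EB)
      have h2 : C x₀ = (ContinuousLinearEquiv.refl ℂ EB : EB →L[ℂ] EB) := hC0
      rw [← h2] at h1
      exact hCd.continuousAt h1
    have hsrc : ∀ᶠ x in 𝓝 x₀, p x ∈ φ.source :=
      hp.continuous.continuousAt (φ.open_source.mem_nhds hs0)
    have hev : (fun x => β x e) =ᶠ[𝓝 x₀] fun x =>
        𝓢.localForm m₀ (P x) ![fderiv ℂ P x v, R ((C x).inverse e)] := by
      filter_upwards [hCinv, hsrc] with x hx hxs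
      have h1 := hβ x
      rw [← chartFrame_fderiv_chart_comp ((hp x).mdifferentiableAt (by simp)) hxs] at h1
      have h2 := (𝓢.isFieldValue_iff_of_mem_source hxs (hpb x) _ _).1 h1 (R ((C x).inverse e))
      refine Eq.trans ?_ h2.symm
      congr 1
      exact (hx.self_apply_inverse e).symm
    refine DifferentiableAt.congr_of_eventuallyEq ?_ hev
    have d1 : DifferentiableAt ℂ (fun x => 𝓢.localForm m₀ (P x)) x₀ :=
      ((𝓢.localForm_differentiableOn m₀).differentiableAt
        (φ.open_target.mem_nhds (mem_chart_target EM m₀))).comp x₀ hPd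
    have d2 : DifferentiableAt ℂ (fun x => fderiv ℂ P x v) x₀ :=
      ((hPc.fderiv_right (m := ω) (by simp)).differentiableAt (by simp)).clm_apply
        (differentiableAt_const v)
    have d3 : DifferentiableAt ℂ (fun x => R ((C x).inverse e)) x₀ :=
      R.differentiableAt.comp x₀ ((hinv.comp x₀ hCd).clm_apply (differentiableAt_const e))
    refine d1.continuousAlternatingMap_apply fun i => ?_
    fin_cases i
    · exact d2
    · exact d3
  refine ⟨β 0, fun x => ?_⟩
  have : β x = β 0 := by
    ext e
    refine (hdiff e).apply_eq_apply_of_bounded ?_ x 0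
    exact (IsZLattice.isCompact_range_of_periodic Γ _ (hdiff e).continuous
      fun z w hw => by rw [hper z w hw]).isBounded
  rw [← this]
  exact hβ x

/-- The invariant vector fields on a torus fibre are the constant vector fields. -/
theorem exists_covector_equiv [FiniteDimensional ℂ EM] [FiniteDimensional ℂ V] 
    (𝓢 : IntegrableSystem EM EB M B) (hb : b ∉ 𝓢.S)
    (hp : IsTorusParametrization (E := EM) p (𝓢.H ⁻¹' {b})) :
    ∃ e : V ≃L[ℂ] (EB →L[ℂ] ℂ), ∀ x v, 𝓢.IsFieldValue b (e v) (p x) (dMap EM p x v) := by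
  obtain ⟨hpc, hrange, hinj, Γ, hd, hl, hΓ⟩ := hp
  have hpb : ∀ x, 𝓢.H (p x) = b := fun x => by
    have : p x ∈ 𝓢.H ⁻¹' {b} := hrange ▸ mem_range_self x
    exact this
  choose β hβ using fun v => 𝓢.exists_constant_covector hb hpc hpb Γ hΓ v
  let l : V →ₗ[ℂ] (EB →L[ℂ] ℂ) :=
    { toFun := β
      map_add' := fun v w => by
        have h1 := 𝓢.isFieldValue_linear 1 (hβ v 0) (hβ w 0)
        rw [one_smul, one_smul, ← map_add] at h1
        exact 𝓢.covector_unique hb (hβ _ 0) h1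
      map_smul' := fun c v => by
        have h0 : 𝓢.IsFieldValue b (0 : EB →L[ℂ] ℂ) (p 0) (0 : EM) := by
          rw [isFieldValue_def]
          refine ⟨hpb 0, fun w => ?_⟩
          rw [← pairing_apply, map_zero]
          simp
        have h1 := 𝓢.isFieldValue_linear c (hβ v 0) h0
        rw [add_zero, add_zero, ← map_smul] at h1
        exact 𝓢.covector_unique hb (hβ _ 0) h1 }
  -- A zero covector gives a zero field by nondegeneracy, and `p` is an immersion.
  have hl : Function.Injective l := by
    rw [← LinearMap.ker_eq_bot, LinearMap.ker_eq_bot']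
    intro v hv
    have h1 := hβ v 0
    have hv' : β v = 0 := hv
    rw [hv'] at h1
    have h1 := (𝓢.isFieldValue_def b _ _ _).1 h1
    have h2 := 𝓢.form_nondegenerate (p 0) _ fun w => by rw [h1.2 w]; rfl
    exact hinj 0 (h2.trans (map_zero (dMap EM p 0)).symm)
  have hdim : Module.finrank ℂ (EB →L[ℂ] ℂ) = Module.finrank ℂ EB := by
    rw [← Subspace.dual_finrank_eq (K := ℂ) (V := EB)]
    exact (LinearMap.toContinuousLinearMap : (EB →ₗ[ℂ] ℂ) ≃ₗ[ℂ] (EB →L[ℂ] ℂ)).finrank_eq.symm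
  -- Surjectivity of `p` onto the fibre bounds `dim V` below by `dim B`, injectivity of `l` bounds
  -- it above; so `l` is an isomorphism.
  have hge := 𝓢.finrank_le_of_range_eq hb hpc hrange
  have hle := LinearMap.finrank_le_finrank_of_injective hl
  let e := (LinearEquiv.ofInjectiveOfFinrankEq l hl (by omega)).toContinuousLinearEquiv
  exact ⟨e, fun x v => hβ v x⟩

end Torus

end IntegrableSystem

end

/-! ### Local inverses, flow lines and periods -/

section

universe u

variable {EM EB : Type*} [NormedAddCommGroup EM] [NormedSpace ℂ EM] [FiniteDimensional ℂ EM]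
  [NormedAddCommGroup EB] [NormedSpace ℂ EB] [FiniteDimensional ℂ EB]
  {M : Type u} [TopologicalSpace M] [ChartedSpace EM M] [IsManifold 𝓘(ℂ, EM) ω M]
  {B : Type*} [TopologicalSpace B] [ChartedSpace EB B] [IsManifold 𝓘(ℂ, EB) ω B]
  {V : Type*} [NormedAddCommGroup V] [NormedSpace ℂ V] [FiniteDimensional ℂ V]
  {b : B} {p : V → M}

namespace IntegrableSystem

/-- A parametrization of a regular fibre has local holomorphic inverses. -/
theorem exists_local_inverse (𝓢 : IntegrableSystem EM EB M B)
    (hb : b ∉ 𝓢.S) (hp : ContMDiff 𝓘(ℂ, V) 𝓘(ℂ, EM) ω p) (hpb : ∀ x, 𝓢.H (p x) = b)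
    (hinj : ∀ x, Function.Injective (dMap EM p x))
    (hdim : Module.finrank ℂ V = Module.finrank ℂ EB) (x₀ : V) :
    ∃ r : EM → V, ContDiffAt ℂ ω r (chartAt EM (p x₀) (p x₀)) ∧
      r (chartAt EM (p x₀) (p x₀)) = x₀ ∧
      ∀ᶠ m in 𝓝 (p x₀), 𝓢.H m = b → p (r (chartAt EM (p x₀) m)) = m := by
  have : CompleteSpace V := FiniteDimensional.complete ℂ V
  obtain ⟨T, κ, σ, hT, hTdim, hκ, -, -, hσ⟩ := 𝓢.exists_fibre_slice hb (hpb x₀)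
  set m₀ := p x₀ with hm₀
  set φ := chartAt EM m₀ with hφ
  set h := localRep EM EB 𝓢.H m₀ b with hh
  have hs0 : m₀ ∈ φ.source := mem_chart_source EM m₀
  set P : V → EM := fun x => φ (p x) with hP
  have hPc : ContDiffAt ℂ ω P x₀ := contDiffAt_chart_comp (hp x₀) hs0
  have hPd : HasFDerivAt P (fderiv ℂ P x₀) x₀ := (hPc.differentiableAt (by simp)).hasFDerivAt
  have hsrc : ∀ᶠ x in 𝓝 x₀, p x ∈ φ.source :=
    hp.continuous.continuousAt (φ.open_source.mem_nhds hs0)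
  have hPinj : Function.Injective (fderiv ℂ P x₀) := by
    rw [(fderiv_chart_comp ((hp x₀).mdifferentiableAt (by simp)) hs0).fderiv]
    exact (chartCoframe_bijective m₀ hs0).1.comp (hinj x₀)
  have hPT : ∀ v, fderiv ℂ P x₀ v ∈ T := by
    intro v
    rw [hT]
    have hz : φ m₀ ∈ localDomain EM EB 𝓢.H m₀ b :=
      ⟨mem_chart_target EM m₀, by rw [φ.left_inv hs0, hpb]; exact mem_chart_source EB b⟩
    have hZo := isOpen_localDomain (E := EM) (E' := EB) 𝓢.contMDiff.continuous m₀ b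
    have h1 : HasFDerivAt h (fderiv ℂ h (P x₀)) (P x₀) :=
      (((contDiffOn_localRep 𝓢.contMDiff m₀ b).contDiffAt (hZo.mem_nhds hz)).differentiableAt
        (by simp)).hasFDerivAt
    have h2 := h1.comp x₀ hPd
    have h3 : HasFDerivAt (h ∘ P) (0 : V →L[ℂ] EB) x₀ :=
      (hasFDerivAt_const (chartAt EB b b) x₀).congr_of_eventuallyEq (by
        filter_upwards [hsrc] with x hx using 𝓢.localRep_eq_of_mem_fibre hx (hpb x))
    exact congrArg (fun l => l v) (h2.unique h3)
  -- The derivative of `P` maps injectively into `T`, which has the dimension of `V`; so `q` is a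
  -- local biholomorphism, and its inverse composed with `κ` is the desired `r`.
  let q : V → T := fun x => κ (P x - φ m₀)
  have hqc : ContDiffAt ℂ ω q x₀ := κ.contDiff.contDiffAt.comp x₀ (hPc.sub contDiffAt_const)
  have hqd : HasFDerivAt q (κ ∘L fderiv ℂ P x₀) x₀ :=
    κ.hasFDerivAt.comp x₀ (hPd.sub_const _)
  have hqinj : Function.Injective (κ ∘L fderiv ℂ P x₀) := by
    intro v w hvw
    have h1 : κ (fderiv ℂ P x₀ v) = κ (fderiv ℂ P x₀ w) := hvw
    have h2 := hκ ⟨_, hPT v⟩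
    have h3 := hκ ⟨_, hPT w⟩
    exact hPinj (Subtype.ext_iff.1 (h2.symm.trans (h1.trans h3)))
  let e : V ≃L[ℂ] T := (LinearEquiv.ofInjectiveOfFinrankEq
    ((κ ∘L fderiv ℂ P x₀ : V →L[ℂ] T) : V →ₗ[ℂ] T) hqinj
    (by rw [hdim, hTdim])).toContinuousLinearEquiv
  have he : (e : V →L[ℂ] T) = κ ∘L fderiv ℂ P x₀ := by ext v; rfl
  rw [← he] at hqd
  have hqs : HasStrictFDerivAt q (e : V →L[ℂ] T) x₀ := hqc.hasStrictFDerivAt' hqd (by simp)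
  set θ := hqs.localInverse q e x₀ with hθ
  have hθc : ContDiffAt ℂ ω θ (q x₀) := hqc.to_localInverse hqd (by simp)
  have hq0 : q x₀ = κ (φ m₀ - φ m₀) := rfl
  have hθ0 : θ (κ (φ m₀ - φ m₀)) = x₀ := hqs.localInverse_apply_image
  have hκc : ContDiffAt ℂ ω (fun z => κ (z - φ m₀)) (φ m₀) :=
    κ.contDiff.contDiffAt.comp _ (contDiffAt_id.sub contDiffAt_const)
  have hr : ContDiffAt ℂ ω (fun z => θ (κ (z - φ m₀))) (φ m₀) :=
    ContDiffAt.comp (g := θ) (φ m₀) (by rwa [hq0] at hθc) hκc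
  refine ⟨fun z => θ (κ (z - φ m₀)), hr, hθ0, ?_⟩
  have hφc : ContinuousAt φ m₀ := φ.continuousAt hs0
  have hrc : Tendsto (fun m => θ (κ (φ m - φ m₀))) (𝓝 m₀) (𝓝 x₀) := by
    have := hr.continuousAt.tendsto.comp hφc.tendsto
    rwa [hθ0] at this
  have h1 : ∀ᶠ m in 𝓝 m₀, q (θ (κ (φ m - φ m₀))) = κ (φ m - φ m₀) := by
    have h2 := hqs.eventually_right_inverse
    rw [hq0] at h2
    exact (hκc.continuousAt.tendsto.comp hφc.tendsto).eventually h2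
  -- Both `m` and `p (r (φ m))` lie in the fibre and have the same `κ`-coordinate, from which `σ`
  -- recovers a point of the fibre.
  filter_upwards [hσ, h1, φ.open_source.mem_nhds hs0, hrc.eventually hsrc,
    (hrc.eventually (hp.continuous.continuousAt.eventually hσ))] with m h2 h3 h4 h5 h6 hm
  refine φ.injOn h5 h4 ?_
  have h7 := h6 (hpb _)
  have h8 := h2 hm
  exact h7.symm.trans ((congrArg σ h3).trans h8)

/-- Flow lines of invariant vector fields are the images of lines. -/
theorem flowLine_eq [T2Space M] (𝓢 : IntegrableSystem EM EB M B)
    (hb : b ∉ 𝓢.S) (hp : ContMDiff 𝓘(ℂ, V) 𝓘(ℂ, EM) ω p)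
    (hinj : ∀ x, Function.Injective (dMap EM p x)) (e : V ≃L[ℂ] (EB →L[ℂ] ℂ))
    (he : ∀ x v, 𝓢.IsFieldValue b (e v) (p x) (dMap EM p x v)) {v : V} {γ : ℂ → M}
    (hγ : 𝓢.IsFlowLine b (e v) γ) {x : V} (hx : γ 0 = p x) (ζ : ℂ) : γ ζ = p (x + ζ • v) := by
  have hpb : ∀ x, 𝓢.H (p x) = b := fun x => (he x 0).1
  have hdim : Module.finrank ℂ V = Module.finrank ℂ EB := by
    rw [e.toLinearEquiv.finrank_eq, ← Subspace.dual_finrank_eq (K := ℂ) (V := EB)]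
    exact (LinearMap.toContinuousLinearMap : (EB →ₗ[ℂ] ℂ) ≃ₗ[ℂ] (EB →L[ℂ] ℂ)).finrank_eq.symm
  have hγc : Continuous γ := continuous_iff_continuousAt.2 fun ζ => (hγ ζ).1.continuousAt
  have hclosed : IsClosed {ζ : ℂ | γ ζ = p (x + ζ • v)} :=
    isClosed_eq hγc (hp.continuous.comp (by fun_prop))
  have hopen : IsOpen {ζ : ℂ | γ ζ = p (x + ζ • v)} := by
    rw [isOpen_iff_mem_nhds]
    intro ζ₀ hζ₀
    set x₀ := x + ζ₀ • v with hx₀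
    have hζ₀ : γ ζ₀ = p x₀ := hζ₀
    obtain ⟨r, hr, hr0, hrp⟩ := 𝓢.exists_local_inverse hb hp hpb hinj hdim x₀
    set φ := chartAt EM (p x₀) with hφ
    have hs0 : p x₀ ∈ φ.source := mem_chart_source EM (p x₀)
    have hφc : ContinuousAt φ (p x₀) := φ.continuousAt hs0
    have hgood : ∀ᶠ m in 𝓝 (p x₀), m ∈ φ.source ∧ ContDiffAt ℂ ω r (φ m) ∧
        (𝓢.H m = b → p (r (φ m)) = m) :=
      Eventually.and (φ.open_source.mem_nhds hs0)
        ((hφc.eventually (hr.eventually (by simp))).and hrp)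
    have hgood' := (hγc.tendsto ζ₀).eventually (by rw [hζ₀]; exact hgood)
    obtain ⟨ε, hε, hball⟩ := Metric.eventually_nhds_iff_ball.1 hgood'
    -- A local lift of `γ` through `p`. Both `dγ(1)` and `dp(v)` are the value of the field with
    -- covector `e v`, so injectivity of `dp` gives `y' = v`, and `y` is affine.
    set y : ℂ → V := fun ζ => r (φ (γ ζ)) with hy
    have hyd : ∀ ζ ∈ Metric.ball ζ₀ ε, HasDerivAt y v ζ := by
      intro ζ hζ
      obtain ⟨h1, h2, h3⟩ := hball ζ hζ
      have h4 := (h2.differentiableAt (by simp)).hasFDerivAt.comp ζ (fderiv_chart_comp (hγ ζ).1 h1)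
      set D : ℂ →L[ℂ] V := (fderiv ℂ r (φ (γ ζ))) ∘L (chartCoframe EM (p x₀) (γ ζ) ∘L dMap EM γ ζ)
      have h5 : HasMFDerivAt 𝓘(ℂ, ℂ) 𝓘(ℂ, V) y ζ D := HasFDerivAt.hasMFDerivAt h4
      have h6 := ((hp (y ζ)).mdifferentiableAt (by simp)).hasMFDerivAt.comp ζ h5
      have h7 : γ =ᶠ[𝓝 ζ] p ∘ y := by
        filter_upwards [Metric.isOpen_ball.mem_nhds hζ] with ζ' hζ'
        exact ((hball ζ' hζ').2.2 (hγ ζ').2.1).symm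
      have h8 : dMap EM γ ζ = dMap EM p (y ζ) ∘L D := (h6.congr_of_eventuallyEq h7).mfderiv
      have h9 : 𝓢.IsFieldValue b (e v) (γ ζ) (dMap EM γ ζ 1) := (hγ ζ).2
      have h10 : p (y ζ) = γ ζ := h3 (hγ ζ).2.1
      have h11 := he (y ζ) v
      rw [h10] at h11
      have h12 := 𝓢.isFieldValue_unique h9 h11
      rw [h8] at h12
      have h13 : D 1 = v := hinj (y ζ) h12
      have h14 : HasFDerivAt y D ζ := h4
      have h15 := h14.hasDerivAt
      rwa [h13] at h15
    have hconst : ∀ ζ ∈ Metric.ball ζ₀ ε, y ζ - ζ • v = y ζ₀ - ζ₀ • v := by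
      intro ζ hζ
      have hd : ∀ ζ ∈ Metric.ball ζ₀ ε, HasDerivAt (fun ζ => y ζ - ζ • v) 0 ζ := by
        intro ζ hζ
        have := (hyd ζ hζ).sub ((hasDerivAt_id ζ).smul_const v)
        rw [one_smul, sub_self] at this
        exact this
      exact Metric.isOpen_ball.is_const_of_deriv_eq_zero (convex_ball ζ₀ ε).isPreconnected
        (fun ζ hζ => (hd ζ hζ).differentiableAt.differentiableWithinAt)
        (fun ζ hζ => (hd ζ hζ).deriv) hζ (Metric.mem_ball_self hε)
    filter_upwards [Metric.ball_mem_nhds ζ₀ hε] with ζ hζ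
    have h1 : y ζ₀ = x₀ := by simp only [hy, hζ₀]; exact hr0
    have h2 : y ζ = x + ζ • v := by
      have := hconst ζ hζ
      rw [h1, hx₀, add_sub_cancel_right, sub_eq_iff_eq_add] at this
      exact this
    rw [← ((hball ζ hζ).2.2 (hγ ζ).2.1)]
    exact congrArg p h2
  have huniv : {ζ : ℂ | γ ζ = p (x + ζ • v)} = univ :=
    IsClopen.eq_univ ⟨hclosed, hopen⟩ ⟨0, by simpa using hx⟩
  exact huniv.symm.subset (mem_univ ζ)

/-- The flow line from `p 0` is `ζ ↦ p (ζ • v)`, so returning at time one means `v ∈ Γ`. Only this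
inclusion is needed: the dual of `Γ` is then contained in the dual of the period lattice. -/
theorem periodLattice_subset [T2Space M] (𝓢 : IntegrableSystem EM EB M B)
    (hb : b ∉ 𝓢.S) (hp : ContMDiff 𝓘(ℂ, V) 𝓘(ℂ, EM) ω p)
    (hinj : ∀ x, Function.Injective (dMap EM p x)) (e : V ≃L[ℂ] (EB →L[ℂ] ℂ))
    (he : ∀ x v, 𝓢.IsFieldValue b (e v) (p x) (dMap EM p x v)) {Γ : Submodule ℤ V}
    (hΓ : ∀ x y, p x = p y ↔ x - y ∈ Γ) {α : EB →L[ℂ] ℂ} (hα : α ∈ 𝓢.periodLattice b) :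
    e.symm α ∈ Γ := by
  obtain ⟨γ, hγ, hγ0, hγ1⟩ := hα (p 0) (he 0 0).1
  have hγ' : 𝓢.IsFlowLine b (e (e.symm α)) γ := by rw [e.apply_symm_apply]; exact hγ
  have h := 𝓢.flowLine_eq hb hp hinj e he hγ' hγ0 1
  rw [hγ1, one_smul, zero_add] at h
  simpa using (hΓ _ _).1 h.symm

end IntegrableSystem

end

/-! ### A visible Lagrangian near a point over a smooth point of its base -/

section

universe u

variable {EM EB : Type*} [NormedAddCommGroup EM] [NormedSpace ℂ EM] [FiniteDimensional ℂ EM]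
  [NormedAddCommGroup EB] [NormedSpace ℂ EB] [FiniteDimensional ℂ EB]
  {M : Type u} [TopologicalSpace M] [ChartedSpace EM M] [IsManifold 𝓘(ℂ, EM) ω M]
  {B : Type*} [TopologicalSpace B] [ChartedSpace EB B] [IsManifold 𝓘(ℂ, EB) ω B]

namespace IntegrableSystem

/-- Near a point of a visible Lagrangian over a smooth point `b` of its base, the Lagrangian is
parametrized, in a chart, by a real `C¹` immersion with isotropic tangent spaces, compatibly with
the projection to the base. -/
theorem exists_isotropic_parametrization (𝓢 : IntegrableSystem EM EB M B) {L : Set M}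
    {B' S' : Set B} (hL : 𝓢.IsVisibleLagrangian L B' S') {b : B} (hb : b ∈ B' \ S')
    {T : Submodule ℂ EB} (hT : IsSmoothPointWithTangent (E := EB) B' b T)
    {m₀ : M} (hm₀L : m₀ ∈ L) (hm₀ : 𝓢.H m₀ = b) :
    ∃ (d : ℕ) (G : T × EuclideanSpace ℝ (Fin d) → EM) (c : M → EuclideanSpace ℝ (Fin d))
      (D : Set (T × EuclideanSpace ℝ (Fin d))), IsOpen D ∧ (0, c m₀) ∈ D ∧ ContDiffOn ℝ 1 G D ∧
      (∀ u ∈ D, ∀ v w, 𝓢.localForm m₀ (G u) ![fderiv ℝ G u v, fderiv ℝ G u w] = 0) ∧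
      (∀ u ∈ D, Function.Injective (fderiv ℝ G u)) ∧
      2 * Module.finrank ℂ T + d = Module.finrank ℂ EM ∧
      (∀ s, (0, s) ∈ D → G (0, s) ∈ (chartAt EM m₀).target ∧
        (chartAt EM m₀).symm (G (0, s)) ∈ L ∧ 𝓢.H ((chartAt EM m₀).symm (G (0, s))) = b ∧
        ∀ t : T, fderiv ℂ (localRep EM EB 𝓢.H m₀ b) (G (0, s)) (fderiv ℝ G (0, s) (t, 0)) = t) ∧
      G (0, c m₀) = chartAt EM m₀ m₀ ∧
      Tendsto c (𝓝[L ∩ 𝓢.H ⁻¹' {b}] m₀) (𝓝 (c m₀)) ∧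
      ∀ᶠ m in 𝓝[L ∩ 𝓢.H ⁻¹' {b}] m₀, G (0, c m) = chartAt EM m₀ m := by
  obtain ⟨U, hU, hbU, d, F, _, _, _, -, Φ, Ψ, hΦ, hΨ, hΦΨ, hΨΦ⟩ := hL.bundle b hb
  set φ := chartAt EM m₀ with hφ
  set ψ := chartAt EB b with hψ
  set h := localRep EM EB 𝓢.H m₀ b with hh
  set R := B' \ S' with hR
  set y₀ := Ψ m₀ with hy₀
  set χ := chartAt (EuclideanSpace ℝ (Fin d)) y₀ with hχ
  have hΦ0 : Φ (b, y₀) = m₀ := by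
    have := hΨΦ m₀ hm₀L (by rw [hm₀]; exact ⟨hb, hbU⟩)
    rwa [hm₀] at this
  have hs0 : m₀ ∈ φ.source := mem_chart_source EM m₀
  have ht0 : φ m₀ ∈ φ.target := mem_chart_target EM m₀
  have hb0 : b ∈ ψ.source := mem_chart_source EB b
  have hbt : ψ b ∈ ψ.target := mem_chart_target EB b
  have hy0 : y₀ ∈ χ.source := mem_chart_source _ y₀
  have hz : φ m₀ ∈ localDomain EM EB 𝓢.H m₀ b :=
    ⟨ht0, by rw [φ.left_inv hs0, hm₀]; exact hb0⟩
  have hZo := isOpen_localDomain (E := EM) (E' := EB) 𝓢.contMDiff.continuous m₀ b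
  have hh0 : h (φ m₀) = ψ b := 𝓢.localRep_eq_of_mem_fibre hs0 hm₀
  -- the local sections `Φ` and `Ψ` in charts
  have hΦ1 := hΦ (b, y₀) ⟨⟨hb, hbU⟩, mem_univ _⟩
  have hΦc : ContinuousWithinAt Φ ((R ∩ U) ×ˢ univ) (b, y₀) := hΦ1.continuousWithinAt
  rw [contMDiffWithinAt_iff, hΦ0] at hΦ1
  let Φ' : EB × EuclideanSpace ℝ (Fin d) → EM := fun u => φ (Φ (ψ.symm u.1, χ.symm u.2))
  let S₁ : Set (EB × EuclideanSpace ℝ (Fin d)) := {u | ψ.symm u.1 ∈ R ∩ U}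
  have hΦ2 : ContDiffWithinAt ℝ ∞ Φ' S₁ (ψ b, χ y₀) := by
    exact hΦ1.2.mono fun u hu => ⟨⟨hu, mem_univ _⟩, ⟨u, rfl⟩⟩
  -- Smoothness within `S₁` at one point gives `C¹` on a relative neighbourhood `u₁`, which is all
  -- that the isotropy argument requires.
  obtain ⟨u₁, hu₁, -, hΦ3⟩ := hΦ2.contDiffOn (m := 1) (by exact_mod_cast le_top) (by simp)
  have hΨ1 := hΨ m₀ ⟨hm₀L, by rw [mem_preimage, hm₀]; exact ⟨hb, hbU⟩⟩
  have hΨc : ContinuousWithinAt Ψ (L ∩ 𝓢.H ⁻¹' (R ∩ U)) m₀ := hΨ1.continuousWithinAt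
  rw [contMDiffWithinAt_iff] at hΨ1
  let Ψ' : EM → EuclideanSpace ℝ (Fin d) := fun x => χ (Ψ (φ.symm x))
  let S₂ : Set EM := {x | φ.symm x ∈ L ∩ 𝓢.H ⁻¹' (R ∩ U)}
  have hΨ2 : ContDiffWithinAt ℝ ∞ Ψ' S₂ (φ m₀) := by
    exact hΨ1.2.mono fun u hu => ⟨hu, ⟨u, rfl⟩⟩
  obtain ⟨u₂, hu₂, -, hΨ3⟩ := hΨ2.contDiffOn (m := 1) (by exact_mod_cast le_top) (by simp)
  -- the base
  obtain ⟨O₁, hO₁t, hO₁, hbO₁, k, f, hf, hfB, hfs, hfT⟩ := hT.exists_equations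
  obtain ⟨κ, σ, hκ, hσc, hσ0, hσ1, hσ2, hσd⟩ :=
    exists_slice (hf.contDiffAt (hO₁.mem_nhds hbO₁)) hfs T hfT
  have hf0 : f (ψ b) = 0 :=
    ((Set.ext_iff.1 hfB (ψ b)).1 ⟨by rw [mem_preimage, ψ.left_inv hb0]; exact hb.1, hbO₁⟩).2
  have hS'c : IsClosed S' := hL.analytic_bad.isClosed
  -- Inside this open set, membership in `B'` and in `B' \ S'` agree, so the equations of `B'`
  -- describe the base of the bundle.
  have hW : IsOpen (U \ S') := hU.sdiff hS'c
  -- the parametrization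
  let G : T × EuclideanSpace ℝ (Fin d) → EM := fun u => Φ' (σ u.1, u.2)
  -- Inverse to `G` along `L`: the base coordinate is `κ` of the projection, the fibre coordinate is
  -- `Ψ`.
  let Q : EM → T × EuclideanSpace ℝ (Fin d) := fun x => (κ (h x - ψ b), Ψ' x)
  have hσcont : ContinuousAt σ 0 := hσc.continuousAt
  have hσR : ∀ᶠ t in 𝓝 (0 : T), σ t ∈ ψ.target ∧ ψ.symm (σ t) ∈ R ∩ U ∧
      κ (σ t - ψ b) = t ∧ ContDiffAt ℝ 1 σ t := by
    have e1 : ∀ᶠ t in 𝓝 (0 : T), σ t ∈ O₁ := hσcont (hO₁.mem_nhds (by rwa [hσ0]))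
    have e2 : ∀ᶠ t in 𝓝 (0 : T), ψ.symm (σ t) ∈ U \ S' := by
      have : ContinuousAt ψ.symm (σ 0) := by rw [hσ0]; exact ψ.symm.continuousAt hbt
      refine (this.comp hσcont) (hW.mem_nhds ?_)
      rw [Function.comp_apply, hσ0, ψ.left_inv hb0]
      exact ⟨hbU, hb.2⟩
    filter_upwards [e1, e2, hσ1, hσc.eventually (by simp)] with t h1 h2 h3 h4
    have h5 := ((Set.ext_iff.1 hfB (σ t)).2 ⟨h1, h3.1.trans hf0⟩).1
    exact ⟨hO₁t h1, ⟨⟨h5, h2.2⟩, h2.1⟩, h3.2, (h4.restrict_scalars ℝ).of_le le_top⟩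
  have hpair : Tendsto (fun u : T × EuclideanSpace ℝ (Fin d) => (σ u.1, u.2)) (𝓝 (0, χ y₀))
      (𝓝 (ψ b, χ y₀)) := by
    have h1 : ContinuousAt (fun u : T × EuclideanSpace ℝ (Fin d) => (σ u.1, u.2)) (0, χ y₀) := by
      refine ContinuousAt.prodMk ?_ continuousAt_snd
      exact ContinuousAt.comp (g := σ) hσcont continuousAt_fst
    have h2 := h1.tendsto
    rwa [hσ0] at h2
  have hfst : ∀ᶠ u in 𝓝 ((0 : T), χ y₀), σ u.1 ∈ ψ.target ∧ ψ.symm (σ u.1) ∈ R ∩ U ∧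
      κ (σ u.1 - ψ b) = u.1 ∧ ContDiffAt ℝ 1 σ u.1 :=
    (continuous_fst.tendsto ((0 : T), χ y₀)).eventually hσR
  have hpairS : Tendsto (fun u : T × EuclideanSpace ℝ (Fin d) => (σ u.1, u.2)) (𝓝 (0, χ y₀))
      (𝓝[insert (ψ b, χ y₀) S₁] (ψ b, χ y₀)) :=
    tendsto_nhdsWithin_iff.2 ⟨hpair, hfst.mono fun u hu => mem_insert_of_mem _ hu.2.1⟩
  have hD0 : ∀ᶠ u in 𝓝 ((0 : T), χ y₀), (σ u.1 ∈ ψ.target ∧ ψ.symm (σ u.1) ∈ R ∩ U ∧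
      κ (σ u.1 - ψ b) = u.1 ∧ ContDiffAt ℝ 1 σ u.1) ∧ (σ u.1, u.2) ∈ u₁ ∧ u.2 ∈ χ.target ∧
      Φ (ψ.symm (σ u.1), χ.symm u.2) ∈ φ.source := by
    refine hfst.and ((hpairS.eventually hu₁).and (Eventually.and ?_ ?_))
    · exact (continuous_snd.tendsto ((0 : T), χ y₀)).eventually
        (χ.open_target.mem_nhds (χ.map_source hy0))
    · have h1 : ContinuousAt ψ.symm (ψ b) := ψ.symm.continuousAt hbt
      have h2 : ContinuousAt χ.symm (χ y₀) := χ.symm.continuousAt (χ.map_source hy0)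
      have h3 := (h1.prodMap h2).tendsto.comp hpair
      simp only [Prod.map_apply, ψ.left_inv hb0, χ.left_inv hy0] at h3
      have h4 := hΦc.tendsto.comp (tendsto_nhdsWithin_iff.2
        ⟨h3, hfst.mono fun u hu => ⟨hu.2.1, mem_univ _⟩⟩)
      rw [hΦ0] at h4
      exact h4 (φ.open_source.mem_nhds hs0)
  obtain ⟨D₀, hD₀, hD₀o, hD₀m⟩ := eventually_nhds_iff.1 hD0
  have hGc : ContDiffOn ℝ 1 G D₀ := by
    refine hΦ3.comp (fun u hu => ?_) fun u hu => (hD₀ u hu).2.1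
    have h1 : ContDiffAt ℝ 1 (fun u : T × EuclideanSpace ℝ (Fin d) => σ u.1) u :=
      ContDiffAt.comp (g := σ) u (hD₀ u hu).1.2.2.2 contDiffAt_fst
    exact (h1.prodMk contDiffAt_snd).contDiffWithinAt
  have hG0 : G (0, χ y₀) = φ m₀ := by
    simp only [G, Φ', hσ0, χ.left_inv hy0]
    rw [← hψ, ψ.left_inv hb0, hΦ0]
  -- the neighbourhood in the chart
  obtain ⟨O₂, hO₂t, hO₂, hm₀O₂, k', f', hf', hf'L⟩ :=
    hL.lagrangian.1.exists_equations m₀ ht0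
  have hhc : ContinuousAt h (φ m₀) :=
    ((contDiffOn_localRep 𝓢.contMDiff m₀ b).continuousOn).continuousAt (hZo.mem_nhds hz)
  have hsymm : ContinuousAt φ.symm (φ m₀) := φ.symm.continuousAt ht0
  have hHc : ContinuousAt (fun x => 𝓢.H (φ.symm x)) (φ m₀) :=
    (𝓢.contMDiff.continuous.continuousAt).comp hsymm
  have hbase : ∀ᶠ x in 𝓝 (φ m₀), 𝓢.H (φ.symm x) ∈ U \ S' ∧ h x ∈ O₁ ∧
      (f (h x) = f (ψ b) → σ (κ (h x - ψ b)) = h x) := by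
    refine Eventually.and (hHc (hW.mem_nhds ?_)) (Eventually.and (hhc (hO₁.mem_nhds ?_)) ?_)
    · simp only [φ.left_inv hs0, hm₀]
      exact ⟨hbU, hb.2⟩
    · rwa [hh0]
    · rw [← hh0] at hσ2 ⊢
      exact hhc.eventually hσ2
  have hbase' : ∀ᶠ x in 𝓝 (φ m₀), x ∈ φ.target ∧ (φ.symm x ∈ L → φ.symm x ∈ 𝓢.H ⁻¹' (R ∩ U)) := by
    filter_upwards [φ.open_target.mem_nhds ht0, hbase] with x h1 h2
    exact ⟨h1, fun h3 => ⟨⟨hL.factors h3, h2.1.2⟩, h2.1.1⟩⟩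
  have hΨev : ∀ᶠ x in 𝓝 (φ m₀), φ.symm x ∈ L → x ∈ u₂ ∧ Ψ (φ.symm x) ∈ χ.source := by
    have h1 : ∀ᶠ x in 𝓝[insert (φ m₀) S₂] (φ m₀), x ∈ u₂ := hu₂
    rw [eventually_nhdsWithin_iff] at h1
    have h2 : ∀ᶠ m in 𝓝 m₀, m ∈ L ∩ 𝓢.H ⁻¹' (R ∩ U) → Ψ m ∈ χ.source :=
      eventually_nhdsWithin_iff.1 (hΨc (χ.open_source.mem_nhds hy0))
    have h3 : Tendsto φ.symm (𝓝 (φ m₀)) (𝓝 m₀) := by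
      have := hsymm.tendsto
      rwa [φ.left_inv hs0] at this
    filter_upwards [h1, h3.eventually h2, hbase'] with x h4 h5 h6 h7
    exact ⟨h4 (mem_insert_of_mem _ ⟨h7, h6.2 h7⟩), h5 ⟨h7, h6.2 h7⟩⟩
  obtain ⟨O, hO, hOo, hm₀O⟩ := eventually_nhds_iff.1
    (((hbase.and hbase').and hΨev).and
      (Eventually.and (hO₂.mem_nhds hm₀O₂) (hZo.mem_nhds hz)))
  set A : Set EM := φ.symm ⁻¹' L with hA
  have hprop : ∀ x ∈ A ∩ O, h x = ψ (𝓢.H (φ.symm x)) ∧ σ (κ (h x - ψ b)) = h x ∧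
      𝓢.H (φ.symm x) ∈ ψ.source ∧ φ.symm x ∈ 𝓢.H ⁻¹' (R ∩ U) := by
    rintro x ⟨hxA, hxO⟩
    obtain ⟨⟨⟨⟨h1, h2, h3⟩, h4, h5⟩, h6⟩, h7, h8⟩ := hO x hxO
    refine ⟨rfl, h3 ?_, h8.2, h5 hxA⟩
    have h9 : h x ∈ ψ.symm ⁻¹' B' ∩ O₁ := by
      refine ⟨?_, h2⟩
      change ψ.symm (ψ (𝓢.H (φ.symm x))) ∈ B'
      rw [ψ.left_inv h8.2]
      exact (h5 hxA).1.1
    rw [hf0]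
    exact ((Set.ext_iff.1 hfB _).1 h9).2
  have hGQ : ∀ x ∈ A ∩ O, G (Q x) = x := by
    intro x hx
    obtain ⟨h1, h2, h3, h4⟩ := hprop x hx
    have h5 := (hO x hx.2).1.2 hx.1
    change φ (Φ (ψ.symm (σ (κ (h x - ψ b))), χ.symm (χ (Ψ (φ.symm x))))) = x
    rw [h2, h1, ψ.left_inv h3, χ.left_inv h5.2, hΨΦ _ hx.1 h4,
      φ.right_inv (hO x hx.2).1.1.2.1]
  set D : Set (T × EuclideanSpace ℝ (Fin d)) := D₀ ∩ G ⁻¹' O with hD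
  have hDo : IsOpen D := hGc.continuousOn.isOpen_inter_preimage hD₀o hOo
  have hDm : ((0 : T), χ y₀) ∈ D := ⟨hD₀m, by rw [mem_preimage, hG0]; exact hm₀O⟩
  have hDG : ∀ u ∈ D, φ.symm (G u) = Φ (ψ.symm (σ u.1), χ.symm u.2) := fun u hu =>
    φ.left_inv (hD₀ u hu.1).2.2.2
  have hDΦ : ∀ u ∈ D, φ.symm (G u) ∈ L ∧ 𝓢.H (φ.symm (G u)) = ψ.symm (σ u.1) ∧
      Ψ (φ.symm (G u)) = χ.symm u.2 := fun u hu => by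
    rw [hDG u hu]
    exact hΦΨ _ (hD₀ u hu.1).1.2.1 _
  have hGm : MapsTo G D (A ∩ O) := fun u hu => ⟨(hDΦ u hu).1, hu.2⟩
  have hhG : ∀ u ∈ D, h (G u) = σ u.1 := fun u hu => by
    change ψ (𝓢.H (φ.symm (G u))) = _
    rw [(hDΦ u hu).2.1, ψ.right_inv (hD₀ u hu.1).1.1]
  have hQG : ∀ u ∈ D, Q (G u) = u := by
    intro u hu
    refine Prod.ext ?_ ?_
    · change κ (h (G u) - ψ b) = u.1
      rw [hhG u hu, (hD₀ u hu.1).1.2.2.1]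
    · change χ (Ψ (φ.symm (G u))) = u.2
      rw [(hDΦ u hu).2.2, χ.right_inv (hD₀ u hu.1).2.2.1]
  have hhd : ∀ x ∈ O, HasFDerivAt h (fderiv ℂ h x) x := fun x hx =>
    (((contDiffOn_localRep 𝓢.contMDiff m₀ b).contDiffAt
      (hZo.mem_nhds (hO x hx).2.2)).differentiableAt (by simp)).hasFDerivAt
  have hQd : DifferentiableOn ℝ Q (A ∩ O) := by
    intro x hx
    have h1 : DifferentiableAt ℝ (fun x => κ (h x - ψ b)) x :=
      ((κ.hasFDerivAt.comp x ((hhd x hx.2).sub_const (ψ b))).restrictScalars ℝ).differentiableAt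
    have h2 : DifferentiableWithinAt ℝ Ψ' (A ∩ O) x :=
      (hΨ3.differentiableOn (by simp) x ((hO x hx.2).1.2 hx.1).1).mono fun y hy =>
        ((hO y hy.2).1.2 hy.1).1
    exact h1.differentiableWithinAt.prodMk h2
  have hiso := isotropic_of_parametrization (A := A) hOo
    (hf'.mono fun x hx => (hO x hx).2.1) (by
      ext x
      constructor
      · rintro ⟨h1, h2⟩
        exact ⟨h2, ((Set.ext_iff.1 hf'L x).1 ⟨h1, (hO x h2).2.1⟩).2⟩
      · rintro ⟨h1, h2⟩
        exact ⟨((Set.ext_iff.1 hf'L x).2 ⟨(hO x h1).2.1, h2⟩).1, h1⟩)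
    ((𝓢.localForm_continuousOn m₀).mono fun x hx => (hO x hx).1.1.2.1)
    (fun z hz => 𝓢.localForm_nondegenerate (hO z hz).1.1.2.1)
    (fun q O' r g hqA hqO' hO'O hO'o hg hgA hgs =>
      𝓢.lagrangian_at_regular_point hL.lagrangian m₀ hqA hqO'
        (fun x hx => (hO x (hO'O hx)).1.1.2.1) hO'o hg hgA hgs)
    hDo (hGc.mono inter_subset_left) hQd hGm hQG hGQ
  refine ⟨d, G, fun m => χ (Ψ m), D, hDo, hDm, hGc.mono inter_subset_left, hiso.1, hiso.2.1, ?_,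
    ?_, hG0, ?_, ?_⟩
  · have h1 := hiso.2.2 ⟨_, hDm⟩
    have : FiniteDimensional ℝ T := FiniteDimensional.complexToReal T
    rw [Module.finrank_prod, finrank_real_of_complex, finrank_euclideanSpace_fin] at h1
    exact h1
  · intro s hs
    refine ⟨(hO _ hs.2).1.1.2.1, (hDΦ _ hs).1, ?_, fun t => ?_⟩
    · rw [(hDΦ _ hs).2.1, hσ0, ψ.left_inv hb0]
    · have h1 : HasFDerivAt G (fderiv ℝ G (0, s)) (0, s) :=
        ((hGc.contDiffAt (hD₀o.mem_nhds hs.1)).differentiableAt (by simp)).hasFDerivAt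
      have h2 := ((hhd _ hs.2).restrictScalars ℝ).comp (0, s) h1
      have h3 : HasFDerivAt σ (T.subtypeL.restrictScalars ℝ) 0 := by
        have := (hσc.differentiableAt (by simp)).hasFDerivAt
        rw [hσd] at this
        exact this.restrictScalars ℝ
      have h4 : HasFDerivAt (fun u : T × EuclideanSpace ℝ (Fin d) => σ u.1)
          ((T.subtypeL.restrictScalars ℝ) ∘L ContinuousLinearMap.fst ℝ T _) (0, s) :=
        HasFDerivAt.comp (g := σ) (0, s) h3 hasFDerivAt_fst
      -- `h ∘ G` is `σ` of the first coordinate, and `σ` has the inclusion of `T` as derivative at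
      -- `0`; so `(t, 0)` gives a vector tangent to `L` lying over `t`.
      have h5 : HasFDerivAt (h ∘ G)
          ((T.subtypeL.restrictScalars ℝ) ∘L ContinuousLinearMap.fst ℝ T _) (0, s) :=
        h4.congr_of_eventuallyEq (by
          filter_upwards [hDo.mem_nhds hs] with u hu using hhG u hu)
      exact congrArg (fun l => l (t, 0)) (h2.unique h5)
  · have h1 : ContinuousAt χ y₀ := χ.continuousAt hy0
    refine h1.tendsto.comp (hΨc.mono_left (nhdsWithin_mono _ ?_))
    rintro m ⟨hm1, hm2⟩
    refine ⟨hm1, ?_⟩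
    rw [mem_preimage, show 𝓢.H m = b from hm2]
    exact ⟨hb, hbU⟩
  · have h1 : ContinuousAt φ m₀ := φ.continuousAt hs0
    have h2 : ∀ᶠ m in 𝓝 m₀, φ m ∈ O ∧ m ∈ φ.source :=
      Eventually.and (h1 (hOo.mem_nhds hm₀O)) (φ.open_source.mem_nhds hs0)
    filter_upwards [self_mem_nhdsWithin, nhdsWithin_le_nhds h2] with m hm hm'
    have h3 : φ m ∈ A ∩ O := ⟨by rw [hA, mem_preimage, φ.left_inv hm'.2]; exact hm.1, hm'.1⟩
    have h4 := hGQ _ h3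
    have h5 : h (φ m) = ψ b := 𝓢.localRep_eq_of_mem_fibre hm'.2 hm.2
    have h6 : Q (φ m) = (0, χ (Ψ m)) := by
      change (κ (h (φ m) - ψ b), χ (Ψ (φ.symm (φ m)))) = _
      rw [h5, sub_self, map_zero, φ.left_inv hm'.2]
    rwa [h6] at h4

end IntegrableSystem

end

/-! ### The fibre of a visible Lagrangian as a leaf of the annihilator -/

section

universe u

/-- The annihilator of a subspace has complementary dimension. -/
theorem finrank_annihilator {E : Type*} [NormedAddCommGroup E] [NormedSpace ℂ E]
    [FiniteDimensional ℂ E] (T : Submodule ℂ E) :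
    Module.finrank ℂ T + Module.finrank ℂ (IntegrableSystem.annihilator T) =
      Module.finrank ℂ E := by
  rw [← Subspace.finrank_add_finrank_dualAnnihilator_eq T]
  congr 1
  let c : (E →ₗ[ℂ] ℂ) ≃ₗ[ℂ] (E →L[ℂ] ℂ) := LinearMap.toContinuousLinearMap
  have h : T.dualAnnihilator.map (c : (E →ₗ[ℂ] ℂ) →ₗ[ℂ] (E →L[ℂ] ℂ)) =
      IntegrableSystem.annihilator T := by
    ext α
    constructor
    · rintro ⟨β, hβ, rfl⟩ v hv
      exact (Submodule.mem_dualAnnihilator β).1 hβ v hv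
    · intro hα
      exact ⟨(α : E →ₗ[ℂ] ℂ), (Submodule.mem_dualAnnihilator _).2 hα, rfl⟩
  rw [← h]
  exact c.finrank_map_eq T.dualAnnihilator

variable {EM EB : Type*} [NormedAddCommGroup EM] [NormedSpace ℂ EM] [FiniteDimensional ℂ EM]
  [NormedAddCommGroup EB] [NormedSpace ℂ EB] [FiniteDimensional ℂ EB]
  {M : Type u} [TopologicalSpace M] [ChartedSpace EM M] [IsManifold 𝓘(ℂ, EM) ω M]
  {B : Type*} [TopologicalSpace B] [ChartedSpace EB B] [IsManifold 𝓘(ℂ, EB) ω B]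
  {V : Type*} [NormedAddCommGroup V] [NormedSpace ℂ V] [FiniteDimensional ℂ V]
  {b : B} {p : V → M}

namespace IntegrableSystem

/-- Near each of its points, the fibre of a visible Lagrangian over a smooth point of its base is
the image of the translates of the subspace of invariant fields annihilating the tangent space. -/
theorem fibre_eq_leaf (𝓢 : IntegrableSystem EM EB M B) {L : Set M}
    {B' S' : Set B} (hL : 𝓢.IsVisibleLagrangian L B' S') (hb : b ∈ B' \ S') (hbS : b ∉ 𝓢.S)
    {T : Submodule ℂ EB} (hT : IsSmoothPointWithTangent (E := EB) B' b T)
    (hp : ContMDiff 𝓘(ℂ, V) 𝓘(ℂ, EM) ω p)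
    (hinj : ∀ x, Function.Injective (dMap EM p x)) (e : V ≃L[ℂ] (EB →L[ℂ] ℂ))
    (he : ∀ x v, 𝓢.IsFieldValue b (e v) (p x) (dMap EM p x v)) {W : Submodule ℂ V}
    (hW : ∀ v, v ∈ W ↔ e v ∈ annihilator T) {x₀ : V} (hx₀ : p x₀ ∈ L) :
    (∀ᶠ w : W in 𝓝 0, p (x₀ + w) ∈ L) ∧
      ∀ N ∈ 𝓝 (0 : W), ∀ᶠ m in 𝓝[L ∩ 𝓢.H ⁻¹' {b}] (p x₀), ∃ w ∈ N, p (x₀ + w) = m := by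
  have hpb : ∀ x, 𝓢.H (p x) = b := fun x => (he x 0).1
  have hdim : Module.finrank ℂ V = Module.finrank ℂ EB := by
    rw [e.toLinearEquiv.finrank_eq, ← Subspace.dual_finrank_eq (K := ℂ) (V := EB)]
    exact (LinearMap.toContinuousLinearMap : (EB →ₗ[ℂ] ℂ) ≃ₗ[ℂ] (EB →L[ℂ] ℂ)).finrank_eq.symm
  have : FiniteDimensional ℝ W := FiniteDimensional.complexToReal W
  have : CompleteSpace W := FiniteDimensional.complete ℝ W
  set m₀ := p x₀ with hm₀
  set φ := chartAt EM m₀ with hφ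
  obtain ⟨r, hr, hr0, hrp⟩ := 𝓢.exists_local_inverse hbS hp hpb hinj hdim x₀
  obtain ⟨d, G, c, D, hD, hs₀, hG, hiso, hGinj, hGdim, hG1, hG0, hc, hc'⟩ :=
    𝓢.exists_isotropic_parametrization hL hb hT hx₀ (hpb x₀)
  set s₀ := c m₀ with hs₀'
  have hs0 : m₀ ∈ φ.source := mem_chart_source EM m₀
  have hms : ContinuousAt φ.symm (φ m₀) := φ.symm.continuousAt (mem_chart_target EM m₀)
  have hGc : ContinuousAt (fun s => G (0, s)) s₀ :=
    ContinuousAt.comp (g := G) (hG.continuousOn.continuousAt (hD.mem_nhds hs₀))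
      (by fun_prop)
  have hGt : Tendsto (fun s => G (0, s)) (𝓝 s₀) (𝓝 (φ m₀)) := by
    have := hGc.tendsto
    rwa [hG0] at this
  have hmt : Tendsto (fun s => φ.symm (G (0, s))) (𝓝 s₀) (𝓝 m₀) := by
    have := hms.tendsto.comp hGt
    rwa [φ.left_inv hs0] at this
  have hrt : Tendsto (fun s => r (G (0, s))) (𝓝 s₀) (𝓝 x₀) := by
    have := hr.continuousAt.tendsto.comp hGt
    rwa [hr0] at this
  -- The part of the parametrization lying over `b`, lifted through `p` to the vector space `V`.
  let g : EuclideanSpace ℝ (Fin d) → V := fun s => r (G (0, s))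
  have hgood : ∀ᶠ s in 𝓝 s₀, ((0 : T), s) ∈ D ∧ ContDiffAt ℂ ω r (G (0, s)) ∧
      p (g s) = φ.symm (G (0, s)) ∧ p (g s) ∈ φ.source := by
    have e1 : ∀ᶠ s in 𝓝 s₀, ((0 : T), s) ∈ D :=
      (show Continuous fun s => ((0 : T), s) by fun_prop).continuousAt (hD.mem_nhds hs₀)
    filter_upwards [e1, hGt.eventually (hr.eventually (by simp)), hmt.eventually hrp,
      hrt (hp.continuous.continuousAt (φ.open_source.mem_nhds hs0))] with s h1 h2 h3 h4
    refine ⟨h1, h2, ?_, h4⟩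
    obtain ⟨h5, -, h6, -⟩ := hG1 s h1
    have h7 := h3 h6
    rwa [φ.right_inv h5] at h7
  obtain ⟨ε, hε, hball⟩ := Metric.eventually_nhds_iff_ball.1 hgood
  have hpG : ∀ s ∈ Metric.ball s₀ ε, φ (p (g s)) = G (0, s) := fun s hs => by
    rw [(hball s hs).2.2.1]
    exact φ.right_inv (hG1 s (hball s hs).1).1
  have hgd : ∀ s ∈ Metric.ball s₀ ε, ContDiffAt ℝ 1 g s := fun s hs => by
    have h1 : ContDiffAt ℝ 1 r (G (0, s)) :=
      ((hball s hs).2.1.restrict_scalars ℝ).of_le le_top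
    have h2 : ContDiffAt ℝ 1 (fun s => G (0, s)) s :=
      ContDiffAt.comp (g := G) s (hG.contDiffAt (hD.mem_nhds (hball s hs).1))
        (contDiffAt_const.prodMk contDiffAt_id)
    exact h1.comp s h2
  have hgD : ∀ s ∈ Metric.ball s₀ ε, HasFDerivAt g (fderiv ℝ g s) s := fun s hs =>
    ((hgd s hs).differentiableAt (by simp)).hasFDerivAt
  have hchain : ∀ s ∈ Metric.ball s₀ ε, ∀ v, fderiv ℂ (fun x => φ (p x)) (g s) (fderiv ℝ g s v) =
      fderiv ℝ G (0, s) (0, v) := by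
    intro s hs v
    have h1 : HasFDerivAt (fun x => φ (p x)) (fderiv ℂ (fun x => φ (p x)) (g s)) (g s) :=
      ((contDiffAt_chart_comp (hp (g s)) (hball s hs).2.2.2).differentiableAt (by simp)).hasFDerivAt
    have h2 := (h1.restrictScalars ℝ).comp s (hgD s hs)
    have h3 : HasFDerivAt (fun s => G (0, s))
        (fderiv ℝ G (0, s) ∘L ContinuousLinearMap.inr ℝ T (EuclideanSpace ℝ (Fin d))) s := by
      have h4 : HasFDerivAt G (fderiv ℝ G (0, s)) (0, s) :=
        ((hG.contDiffAt (hD.mem_nhds (hball s hs).1)).differentiableAt (by simp)).hasFDerivAt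
      exact HasFDerivAt.comp (g := G) s h4 ((hasFDerivAt_const (0 : T) s).prodMk (hasFDerivAt_id s))
    have h5 : HasFDerivAt ((fun x => φ (p x)) ∘ g) (fderiv ℝ G (0, s) ∘L
        ContinuousLinearMap.inr ℝ T (EuclideanSpace ℝ (Fin d))) s :=
      h3.congr_of_eventuallyEq (by
        filter_upwards [Metric.isOpen_ball.mem_nhds hs] with s' hs' using hpG s' hs')
    exact congrArg (fun l => l v) (h2.unique h5)
  -- The central use of isotropy: for `α = e (dg v)` and `t ∈ T`, the value `α t` is the pairing of
  -- two tangent vectors of `L`, namely `dG(0, v)` and the lift `dG(t, 0)` of `t`, hence zero.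
  have hgW : ∀ s ∈ Metric.ball s₀ ε, ∀ v, fderiv ℝ g s v ∈ W := by
    intro s hs v
    rw [hW]
    intro t ht
    have h1 := he (g s) (fderiv ℝ g s v)
    rw [← chartFrame_fderiv_chart_comp ((hp (g s)).mdifferentiableAt (by simp))
      (hball s hs).2.2.2] at h1
    have h2 := (𝓢.isFieldValue_iff_of_mem_source (hball s hs).2.2.2 (hpb _) _ _).1 h1
      (fderiv ℝ G (0, s) (⟨t, ht⟩, 0))
    rw [← hφ, hpG s hs, hchain s hs, hiso _ (hball s hs).1,
      (hG1 s (hball s hs).1).2.2.2 ⟨t, ht⟩] at h2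
    exact h2.symm
  -- the projection to `W`
  obtain ⟨κ, hκ⟩ := Submodule.ClosedComplemented.of_finiteDimensional (𝕜 := ℂ) W
  have hg0 : g s₀ = x₀ := by simp only [g, hG0]; exact hr0
  let q : EuclideanSpace ℝ (Fin d) → W := fun s => κ (g s - x₀)
  have hs₀b : s₀ ∈ Metric.ball s₀ ε := Metric.mem_ball_self hε
  have hqD : ∀ s ∈ Metric.ball s₀ ε, HasFDerivAt q (κ.restrictScalars ℝ ∘L fderiv ℝ g s) s :=
    fun s hs => (κ.restrictScalars ℝ).hasFDerivAt.comp s ((hgD s hs).sub_const x₀)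
  have hq0 : q s₀ = 0 := by simp only [q, hg0, sub_self, map_zero]
  -- `dg` takes values in `W`, where `κ` is the identity, so `g - q` has zero derivative on the
  -- ball.
  have hgq : ∀ s ∈ Metric.ball s₀ ε, g s = x₀ + q s := by
    intro s hs
    have h1 : ∀ s ∈ Metric.ball s₀ ε, HasFDerivAt (fun s => g s - (q s : V))
        (0 : EuclideanSpace ℝ (Fin d) →L[ℝ] V) s := by
      intro s hs
      have h2 := (hgD s hs).sub ((W.subtypeL.restrictScalars ℝ).hasFDerivAt.comp s (hqD s hs))
      refine h2.congr_fderiv ?_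
      ext1 v
      have h3 := congrArg Subtype.val (hκ ⟨_, hgW s hs v⟩)
      simpa [sub_eq_zero] using h3.symm
    have h2 := Metric.isOpen_ball.is_const_of_fderiv_eq_zero (𝕜 := ℝ)
      (convex_ball s₀ ε).isPreconnected
      (fun s hs => (h1 s hs).differentiableAt.differentiableWithinAt)
      (fun s hs => (h1 s hs).fderiv) hs hs₀b
    simp only [hg0, hq0, ZeroMemClass.coe_zero, sub_zero] at h2
    rw [← h2, sub_add_cancel]
  have hqs : HasStrictFDerivAt q (κ.restrictScalars ℝ ∘L fderiv ℝ g s₀) s₀ := by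
    have h1 : ContDiffAt ℝ 1 q s₀ :=
      (κ.restrictScalars ℝ).contDiff.contDiffAt.comp s₀ ((hgd s₀ hs₀b).sub contDiffAt_const)
    exact h1.hasStrictFDerivAt' (hqD s₀ hs₀b) (by simp)
  have hsurj : Function.Surjective (κ.restrictScalars ℝ ∘L fderiv ℝ g s₀) := by
    have h1 : Function.Injective (κ.restrictScalars ℝ ∘L fderiv ℝ g s₀) := by
      rw [injective_iff_map_eq_zero]
      intro v hv
      have h2 : κ (fderiv ℝ g s₀ v) = 0 := hv
      have h3 := congrArg Subtype.val (hκ ⟨_, hgW s₀ hs₀b v⟩)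
      rw [show κ ((⟨fderiv ℝ g s₀ v, hgW s₀ hs₀b v⟩ : W) : V) = 0 from h2] at h3
      have h4 : fderiv ℝ g s₀ v = 0 := h3.symm
      have h5 := hchain s₀ hs₀b v
      rw [h4, map_zero] at h5
      have h6 := hGinj _ hs₀ (h5.symm.trans (map_zero (fderiv ℝ G (0, s₀))).symm)
      exact congrArg Prod.snd h6
    -- From `2 dim T + d = dim M = 2 dim B` one gets `d = 2 (dim B - dim T)`, the real dimension of
    -- the annihilator.
    have h2 : Module.finrank ℝ (EuclideanSpace ℝ (Fin d)) = Module.finrank ℝ W := by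
      have h3 : Module.finrank ℂ W = Module.finrank ℂ (annihilator T) := by
        have h4 : W.map (e.toLinearEquiv : V →ₗ[ℂ] (EB →L[ℂ] ℂ)) = annihilator T := by
          ext α
          constructor
          · rintro ⟨v, hv, rfl⟩
            exact (hW v).1 hv
          · intro hα
            exact ⟨e.symm α, (hW _).2 (by rwa [e.apply_symm_apply]), e.apply_symm_apply α⟩
        rw [← h4]
        exact (e.toLinearEquiv.finrank_map_eq W).symm
      have h5 := 𝓢.finrank_eq (m := m₀) (by rwa [hpb x₀])
      have h6 := finrank_annihilator T
      rw [finrank_real_of_complex, finrank_euclideanSpace_fin, h3]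
      omega
    exact (LinearMap.injective_iff_surjective_of_finrank_eq_finrank
      (f := (κ.restrictScalars ℝ ∘L fderiv ℝ g s₀ : EuclideanSpace ℝ (Fin d) →ₗ[ℝ] W)) h2).1 h1
  -- A map with surjective strict derivative is open at the point, so all small `w` occur as `q s`;
  -- this yields the first claim.
  have hmap : map q (𝓝 s₀) = 𝓝 0 := by
    rw [← hq0]
    exact hqs.map_nhds_eq_of_surj (LinearMap.range_eq_top.2 hsurj)
  have hpq : ∀ s ∈ Metric.ball s₀ ε, p (x₀ + q s) = φ.symm (G (0, s)) := fun s hs => by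
    rw [← hgq s hs]
    exact (hball s hs).2.2.1
  refine ⟨?_, fun N hN => ?_⟩
  · rw [← hmap, eventually_map]
    filter_upwards [Metric.ball_mem_nhds s₀ hε] with s hs
    rw [hpq s hs]
    exact (hG1 s (hball s hs).1).2.1
  -- Points of `L` over `b` near `p x₀` have parameter `c m` near `s₀`, so `q (c m)` lies in the
  -- given neighbourhood `N`.
  · rw [← hmap] at hN
    have h1 : ∀ᶠ s in 𝓝 s₀, q s ∈ N ∧ s ∈ Metric.ball s₀ ε :=
      Eventually.and hN (Metric.ball_mem_nhds s₀ hε)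
    filter_upwards [hc.eventually h1, hc', nhdsWithin_le_nhds (φ.open_source.mem_nhds hs0)] with
      m h2 h3 h4
    refine ⟨q (c m), h2.1, ?_⟩
    rw [hpq _ h2.2, h3]
    exact φ.left_inv h4

end IntegrableSystem

end

/-! ### Orbits of a subspace: components, periods and subtori -/

section

universe u

section Orbits

variable {V : Type*} [NormedAddCommGroup V] [NormedSpace ℂ V] {X : Type*} [TopologicalSpace X]
  {p : V → X} {Γ : Submodule ℤ V} {W : Submodule ℂ V} {K : Set X}

/-- A closed set that locally contains the orbits of `W` through its points contains them. -/
theorem orbit_subset (hpc : Continuous p) (hK : IsClosed K)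
    (hmem : ∀ x, p x ∈ K → ∀ᶠ w : W in 𝓝 0, p (x + w) ∈ K) {x : V} (hx : p x ∈ K) (w : W) :
    p (x + w) ∈ K := by
  have hc : Continuous fun w : W => p (x + w) := by fun_prop
  have ho : IsOpen {w : W | p (x + w) ∈ K} := by
    rw [isOpen_iff_eventually]
    intro w hw
    rw [← map_add_left_nhds_zero, eventually_map]
    filter_upwards [hmem (x + w) hw] with w' hw'
    simpa [add_assoc] using hw'
  have : PreconnectedSpace W := ⟨(convex_univ (𝕜 := ℝ)).isPreconnected⟩
  have h := IsClopen.eq_univ (s := {w : W | p (x + w) ∈ K}) ⟨hK.preimage hc, ho⟩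
    ⟨0, by simpa using hx⟩
  exact h.ge (mem_univ w)

/-- If the orbits of `W` in a closed set are relatively open, then they are its connected
components. -/
theorem connectedComponentIn_eq_orbit (hpc : Continuous p) (hΓ : ∀ x y, p x = p y ↔ x - y ∈ Γ)
    (hK : IsClosed K) (hKp : K ⊆ range p)
    (hmem : ∀ x, p x ∈ K → ∀ᶠ w : W in 𝓝 0, p (x + w) ∈ K)
    (hopen : ∀ x, p x ∈ K → ∀ N ∈ 𝓝 (0 : W), ∀ᶠ m in 𝓝[K] (p x), ∃ w ∈ N, p (x + w) = m)
    {x : V} (hx : p x ∈ K) :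
    connectedComponentIn K (p x) = range fun w : W => p (x + w) := by
  have hc : Continuous fun w : W => p (x + w) := by fun_prop
  have : PreconnectedSpace W := ⟨(convex_univ (𝕜 := ℝ)).isPreconnected⟩
  apply subset_antisymm
  · intro m hm
    have hsub : connectedComponentIn K (p x) ⊆ K := connectedComponentIn_subset K _
    -- Being on a common orbit is an equivalence relation that holds locally on `K` by `hopen`, so
    -- it relates any two points of a connected subset. Transitivity holds because translations by
    -- `Γ` and `W` commute.
    have h := isPreconnected_connectedComponentIn.induction₂ (s := connectedComponentIn K (p x))
      (fun m m' => ∃ z, ∃ w : W, p z = m ∧ p (z + w) = m')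
      (fun m hm => by
        obtain ⟨z, rfl⟩ := hKp (hsub hm)
        filter_upwards [nhdsWithin_mono _ hsub (hopen z (hsub hm) univ univ_mem)] with m' hm'
        obtain ⟨w, -, hw⟩ := hm'
        exact ⟨z, w, rfl, hw⟩)
      (by
        rintro _ _ _ - - - ⟨z, w, rfl, rfl⟩ ⟨z', w', h1, rfl⟩
        refine ⟨z, w + w', rfl, ?_⟩
        rw [hΓ] at h1 ⊢
        have h2 : z + ((w + w' : W) : V) - (z' + w') = -(z' - (z + w)) := by
          push_cast
          abel
        rw [h2]
        exact Γ.neg_mem h1)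
      (by
        rintro _ _ - - ⟨z, w, rfl, rfl⟩
        exact ⟨z + w, -w, rfl, by simp⟩)
      (mem_connectedComponentIn hx) hm
    obtain ⟨z, w, h1, rfl⟩ := h
    refine ⟨w, ?_⟩
    change p (x + w) = p (z + w)
    rw [hΓ] at h1 ⊢
    rw [add_sub_add_right_eq_sub, ← neg_sub]
    exact Γ.neg_mem h1
  · refine (isPreconnected_range hc).subset_connectedComponentIn ⟨0, by simp⟩ ?_
    rintro _ ⟨w, rfl⟩
    exact orbit_subset hpc hK hmem hx w

/-- If an orbit of `W` in a compact set is relatively open, then the periods in `W` span `W`. -/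
theorem span_periods_eq_top [FiniteDimensional ℂ V] (hpc : Continuous p)
    (hΓ : ∀ x y, p x = p y ↔ x - y ∈ Γ) (hK : IsClosed K) (hKc : IsCompact K) (hKp : K ⊆ range p)
    (hmem : ∀ x, p x ∈ K → ∀ᶠ w : W in 𝓝 0, p (x + w) ∈ K)
    (hopen : ∀ x, p x ∈ K → ∀ N ∈ 𝓝 (0 : W), ∀ᶠ m in 𝓝[K] (p x), ∃ w ∈ N, p (x + w) = m)
    {x : V} (hx : p x ∈ K) :
    Submodule.span ℝ {w : W | (w : V) ∈ Γ} = ⊤ := by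
  have hC := connectedComponentIn_eq_orbit hpc hΓ hK hKp hmem hopen hx
  have hCK : (range fun w : W => p (x + w)) ⊆ K := by
    rw [← hC]
    exact connectedComponentIn_subset K _
  have hCc : IsCompact (range fun w : W => p (x + w)) := by
    rw [← hC]
    have h := connectedComponentIn_subset K (p x)
    refine hKc.of_isClosed_subset (closure_subset_iff_isClosed.1 ?_) h
    exact isPreconnected_connectedComponentIn.closure.subset_connectedComponentIn
      (subset_closure (mem_connectedComponentIn hx)) (closure_minimal h hK)
  -- The images of unit balls are relatively open in the orbit; finitely many cover it, so a bounded
  -- part of `W` already reaches every point.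
  obtain ⟨R, hR⟩ : ∃ R : ℝ, ∀ m ∈ range fun w : W => p (x + w),
      ∃ w : W, ‖w‖ ≤ R ∧ p (x + w) = m := by
    refine hCc.induction_on (p := fun t => ∃ R : ℝ, ∀ m ∈ t, ∃ w : W, ‖w‖ ≤ R ∧ p (x + w) = m)
      ⟨0, fun m hm => hm.elim⟩ ?_ ?_ ?_
    · rintro s t hst ⟨R, hR⟩
      exact ⟨R, fun m hm => hR m (hst hm)⟩
    · rintro s t ⟨R, hR⟩ ⟨R', hR'⟩
      refine ⟨max R R', fun m hm => ?_⟩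
      rcases hm with hm | hm
      · obtain ⟨w, hw, h⟩ := hR m hm
        exact ⟨w, hw.trans (le_max_left _ _), h⟩
      · obtain ⟨w, hw, h⟩ := hR' m hm
        exact ⟨w, hw.trans (le_max_right _ _), h⟩
    · rintro _ ⟨w, rfl⟩
      refine ⟨_, nhdsWithin_mono _ hCK (hopen (x + w) (hCK ⟨w, rfl⟩) _
        (Metric.ball_mem_nhds 0 one_pos)), ‖w‖ + 1, ?_⟩
      rintro m ⟨w', hw', rfl⟩
      refine ⟨w + w', ?_, by simp [add_assoc]⟩
      rw [mem_ball_zero_iff] at hw'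
      exact (norm_add_le _ _).trans (by linarith)
  by_contra hne
  -- If the periods did not span, a nonzero real functional would vanish on them, descend to the
  -- orbit and so be bounded on `W`.
  obtain ⟨f, hf0, hf⟩ := Submodule.exists_le_ker_of_lt_top _ (lt_top_iff_ne_top.2 hne)
  have : FiniteDimensional ℝ W := FiniteDimensional.complexToReal W
  let F : W →L[ℝ] ℝ := LinearMap.toContinuousLinearMap f
  have hbd : ∀ w : W, |f w| ≤ ‖F‖ * R := by
    intro w
    obtain ⟨w', hw', h⟩ := hR _ ⟨w, rfl⟩
    have h1 : ((w' - w : W) : V) ∈ Γ := by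
      have h2 := (hΓ _ _).1 h
      rwa [add_sub_add_left_eq_sub] at h2
    have h2 : f (w' - w) = 0 := hf (Submodule.subset_span h1)
    rw [map_sub, sub_eq_zero] at h2
    rw [← h2]
    exact (F.le_opNorm w').trans (by gcongr)
  obtain ⟨w, hw⟩ : ∃ w, f w ≠ 0 := by
    by_contra! h
    exact hf0 (LinearMap.ext h)
  -- The scalar is chosen so that `f` takes the value `‖F‖ * R + 1`, exceeding the bound.
  have h := hbd (((‖F‖ * R + 1) / f w) • w)
  rw [map_smul, smul_eq_mul, div_mul_cancel₀ _ hw] at h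
  linarith [le_abs_self (‖F‖ * R + 1)]

end Orbits

section Parametrizations

variable {EM M V V' : Type*} [NormedAddCommGroup EM] [NormedSpace ℂ EM]
  [TopologicalSpace M] [ChartedSpace EM M] [NormedAddCommGroup V] [NormedSpace ℂ V]
  [NormedAddCommGroup V'] [NormedSpace ℂ V'] {p : V → M}

/-- The derivative of a parametrization composed with a continuous affine map. -/
theorem dMap_comp_affine (hp : ContMDiff 𝓘(ℂ, V) 𝓘(ℂ, EM) ω p) (e : V' →L[ℂ] V) (c : V)
    (x v : V') : dMap EM (fun x => p (c + e x)) x v = dMap EM p (c + e x) (e v) := by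
  have h1 : HasMFDerivAt 𝓘(ℂ, V') 𝓘(ℂ, V) (fun x => c + e x) x e :=
    ((e.hasFDerivAt (x := x)).const_add c).hasMFDerivAt
  have h2 := ((hp (c + e x)).mdifferentiableAt (by simp)).hasMFDerivAt.comp x h1
  exact congrArg (fun l : V' →L[ℂ] EM => l v) h2.mfderiv

/-- A torus parametrization composed with a linear change of coordinates. -/
theorem IsTorusParametrization.comp_equiv {A : Set M}
    (hp : IsTorusParametrization (E := EM) p A) (e : V' ≃L[ℂ] V) :
    IsTorusParametrization (E := EM) (fun x => p (0 + e x)) A := by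
  obtain ⟨hpc, hr, hinj, Γ, hd, hZ, hΓ⟩ := hp
  have hD := dMap_comp_affine hpc (e : V' →L[ℂ] V) 0
  refine ⟨hpc.comp (contDiff_const.add e.contDiff).contMDiff, ?_, ?_, ?_⟩
  · simp only [zero_add]
    exact (e.surjective.range_comp p).trans hr
  · intro x v w h
    exact e.injective (hinj _ ((hD x v).symm.trans (Eq.trans h (hD x w))))
  · let e' : V' ≃L[ℝ] V :=
      { e.toLinearEquiv.restrictScalars ℝ with
        continuous_toFun := e.continuous
        continuous_invFun := e.symm.continuous }
    have hdisc : DiscreteTopology (ZLattice.comap ℝ Γ e'.toLinearMap) :=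
      ZLattice.comap_discreteTopology ℝ Γ e'.continuous e'.injective
    refine ⟨ZLattice.comap ℝ Γ e'.toLinearMap, hdisc,
      ⟨ZLattice.comap_span_top ℝ Γ hZ.span_top (fun x _ => e'.surjective x)⟩, fun x y => ?_⟩
    simp only [zero_add, hΓ, ← map_sub]
    rfl

/-- The restriction of a torus parametrization to a translate of a subspace spanned by periods. -/
theorem IsTorusParametrization.translate (hp : ContMDiff 𝓘(ℂ, V) 𝓘(ℂ, EM) ω p)
    (hinj : ∀ x, Function.Injective (dMap EM p x))
    {Γ : Submodule ℤ V} [DiscreteTopology Γ] (hΓ : ∀ x y, p x = p y ↔ x - y ∈ Γ)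
    (W : Submodule ℂ V) (hW : Submodule.span ℝ {w : W | (w : V) ∈ Γ} = ⊤) (x : V) :
    IsTorusParametrization (E := EM) (fun w : W => p (x + w)) (range fun w : W => p (x + w)) := by
  have hD := dMap_comp_affine hp W.subtypeL x
  refine ⟨?_, rfl, ?_, ?_⟩
  · have h : ContDiff ℂ ω fun w : W => x + (w : V) := contDiff_const.add W.subtypeL.contDiff
    exact hp.comp h.contMDiff
  · intro w v v' h
    exact Subtype.ext (hinj _ ((hD w v).symm.trans (Eq.trans h (hD w v'))))
  -- The periods in `W`: discrete because they inject continuously into `Γ`, and of full rank by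
  -- `hW`.
  · let Γ' : Submodule ℤ W := Γ.comap (W.subtype.restrictScalars ℤ)
    have hdisc : DiscreteTopology Γ' := by
      refine DiscreteTopology.of_continuous_injective
        (f := fun w : Γ' => (⟨(w : W), w.2⟩ : Γ)) ?_ ?_
      · exact (continuous_subtype_val.comp continuous_subtype_val).subtype_mk _
      · intro w w' h
        have h' : ((w : W) : V) = (w' : W) := congrArg (fun γ : Γ => γ.1) h
        exact Subtype.ext (Subtype.ext h')
    refine ⟨Γ', hdisc, ⟨hW⟩, fun w w' => ?_⟩
    rw [hΓ, add_sub_add_left_eq_sub]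
    rfl

/-- The translate of a torus parametrization to a subspace spanned by periods parametrizes a
torus generated by invariant vector fields. -/
theorem IntegrableSystem.isTorusGeneratedBy_orbit {EB B : Type*} [NormedAddCommGroup EB]
    [NormedSpace ℂ EB] [TopologicalSpace B] [ChartedSpace EB B] {M : Type u} [TopologicalSpace M]
    [ChartedSpace EM M] (𝓢 : IntegrableSystem EM EB M B) {b : B}
    {p : (EB →L[ℂ] ℂ) → M} (hpc : ContMDiff 𝓘(ℂ, EB →L[ℂ] ℂ) 𝓘(ℂ, EM) ω p)
    (hinj : ∀ x, Function.Injective (dMap EM p x))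
    (he : ∀ (x v : EB →L[ℂ] ℂ), 𝓢.IsFieldValue b v (p x) (dMap EM p x v))
    {Γ : Submodule ℤ (EB →L[ℂ] ℂ)} [DiscreteTopology Γ] (hΓ : ∀ x y, p x = p y ↔ x - y ∈ Γ)
    (W : Submodule ℂ (EB →L[ℂ] ℂ)) (hW : Submodule.span ℝ {w : W | (w : EB →L[ℂ] ℂ) ∈ Γ} = ⊤)
    (x : EB →L[ℂ] ℂ) : 𝓢.IsTorusGeneratedBy b W (range fun w : W => p (x + w)) := by
  refine ⟨fun w => p (x + w), IsTorusParametrization.translate hpc hinj hΓ W hW x, fun w α => ?_⟩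
  have h : 𝓢.IsFieldValue b (α : EB →L[ℂ] ℂ) (p (x + w)) (dMap EM (fun w : W => p (x + w)) w α) :=
    (dMap_comp_affine hpc W.subtypeL x w α).symm ▸ he (x + w) α
  exact h

end Parametrizations

variable {EM EB : Type*} [NormedAddCommGroup EM] [NormedSpace ℂ EM] [FiniteDimensional ℂ EM]
  [NormedAddCommGroup EB] [NormedSpace ℂ EB] [FiniteDimensional ℂ EB]
  {M : Type u} [TopologicalSpace M] [ChartedSpace EM M] [IsManifold 𝓘(ℂ, EM) ω M]
  {B : Type*} [TopologicalSpace B] [ChartedSpace EB B] [IsManifold 𝓘(ℂ, EB) ω B]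
  {b : B}

namespace IntegrableSystem

/-- The cotangent space of the base parametrizes a regular fibre by the flows of the fields
`X_α`. -/
theorem exists_covector_parametrization (𝓢 : IntegrableSystem EM EB M B) (hb : b ∉ 𝓢.S) :
    ∃ p : (EB →L[ℂ] ℂ) → M, IsTorusParametrization (E := EM) p (𝓢.H ⁻¹' {b}) ∧
      ∀ (x v : EB →L[ℂ] ℂ), 𝓢.IsFieldValue b v (p x) (dMap EM p x v) := by
  obtain ⟨n, p, hp⟩ := 𝓢.torus b hb
  obtain ⟨e, he⟩ := 𝓢.exists_covector_equiv hb hp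
  -- Reparametrizing by the inverse of `e` makes the constant field `v` correspond to `X_v`; the
  -- summand `0` matches the affine form in `dMap_comp_affine`.
  refine ⟨fun x => p (0 + e.symm x), hp.comp_equiv e.symm, fun x v => ?_⟩
  have h : 𝓢.IsFieldValue b (e (e.symm v)) (p (0 + e.symm x))
      (dMap EM (fun x => p (0 + e.symm x)) x v) :=
    (dMap_comp_affine hp.1 (e.symm : (EB →L[ℂ] ℂ) →L[ℂ] _) 0 x v).symm ▸ he _ (e.symm v)
  rwa [e.apply_symm_apply v] at h

/-- The data extracted from a visible Lagrangian: the components of its fibre are tori, and the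
periods of the fibre in the annihilator of the tangent space span the annihilator. -/
theorem fibre_components (𝓢 : IntegrableSystem EM EB M B) [T2Space M] [T2Space B] {L : Set M}
    {B' S' : Set B} (hL : 𝓢.IsVisibleLagrangian L B' S') (hb : b ∈ B' \ S') (hbS : b ∉ 𝓢.S)
    {T : Submodule ℂ EB} (hT : IsSmoothPointWithTangent (E := EB) B' b T)
    {p : (EB →L[ℂ] ℂ) → M} (hpc : ContMDiff 𝓘(ℂ, EB →L[ℂ] ℂ) 𝓘(ℂ, EM) ω p)
    (hr : range p = 𝓢.H ⁻¹' {b}) (hinj : ∀ x, Function.Injective (dMap EM p x))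
    (he : ∀ (x v : EB →L[ℂ] ℂ), 𝓢.IsFieldValue b v (p x) (dMap EM p x v))
    {Γ : Submodule ℤ (EB →L[ℂ] ℂ)} (hΓ : ∀ x y, p x = p y ↔ x - y ∈ Γ)
    {x : EB →L[ℂ] ℂ} (hx : p x ∈ L) :
    connectedComponentIn (L ∩ 𝓢.H ⁻¹' {b}) (p x) =
        range (fun w : annihilator T => p (x + w)) ∧
      Submodule.span ℝ {w : annihilator T | (w : EB →L[ℂ] ℂ) ∈ Γ} = ⊤ := by
  have hpb : ∀ x, p x ∈ 𝓢.H ⁻¹' {b} := fun x => (he x 0).1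
  have hF : IsCompact (𝓢.H ⁻¹' {b}) := 𝓢.proper.isCompact_preimage isCompact_singleton
  have hLc : IsClosed L := hL.lagrangian.1.isClosed
  have hK : IsClosed (L ∩ 𝓢.H ⁻¹' {b}) := hLc.inter hF.isClosed
  have hKc : IsCompact (L ∩ 𝓢.H ⁻¹' {b}) := hF.inter_left hLc
  have hKp : L ∩ 𝓢.H ⁻¹' {b} ⊆ range p := hr ▸ inter_subset_right
  -- With covectors as parameters the equivalence `e` is the identity, and `W` is the annihilator
  -- itself.
  have hleaf := fun (x : EB →L[ℂ] ℂ) (hx : p x ∈ L) =>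
    𝓢.fibre_eq_leaf hL hb hbS hT hpc hinj (ContinuousLinearEquiv.refl ℂ _) he
      (W := annihilator T) (fun _ => Iff.rfl) hx
  have hmem : ∀ x, p x ∈ L ∩ 𝓢.H ⁻¹' {b} →
      ∀ᶠ w : annihilator T in 𝓝 0, p (x + w) ∈ L ∩ 𝓢.H ⁻¹' {b} := fun x hx => by
    filter_upwards [(hleaf x hx.1).1] with w hw using ⟨hw, hpb _⟩
  have hopen := fun x (hx : p x ∈ L ∩ 𝓢.H ⁻¹' {b}) => (hleaf x hx.1).2
  exact ⟨connectedComponentIn_eq_orbit hpc.continuous hΓ hK hKp hmem hopen ⟨hx, hpb x⟩,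
    span_periods_eq_top hpc.continuous hΓ hK hKc hKp hmem hopen ⟨hx, hpb x⟩⟩

end IntegrableSystem

end

/-! ### Duality of lattices -/

section

section LinearAlgebra

variable {E : Type*} [NormedAddCommGroup E] [NormedSpace ℂ E]

/-- Vectors are separated by the real parts of the covectors. -/
theorem eq_of_re_eval_eq {v w : E} (h : ∀ α : E →L[ℂ] ℂ, (α v).re = (α w).re) : v = w := by
  refine (SeparatingDual.eq_iff_forall_dual_eq (R := ℂ)).2 fun α => Complex.ext (h α) ?_
  -- Multiplying the covector by `I` turns its real part into minus its imaginary part.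
  have := h (Complex.I • α)
  simpa using this

variable [FiniteDimensional ℂ E]

/-- Real functionals on the dual space are real parts of evaluations. -/
theorem exists_eq_re_eval (φ : (E →L[ℂ] ℂ) →ₗ[ℝ] ℝ) : ∃ v : E, ∀ α : E →L[ℂ] ℂ, φ α = (α v).re := by
  let c : (E →ₗ[ℂ] ℂ) ≃ₗ[ℂ] (E →L[ℂ] ℂ) := LinearMap.toContinuousLinearMap
  -- The complex-linear functional with real part `φ`; by reflexivity it is evaluation at a vector.
  let Φ : (E →L[ℂ] ℂ) →ₗ[ℂ] ℂ := Module.Dual.extendRCLike φ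
  refine ⟨(Module.evalEquiv ℂ E).symm (Φ ∘ₗ (c : (E →ₗ[ℂ] ℂ) →ₗ[ℂ] (E →L[ℂ] ℂ))), fun α => ?_⟩
  have h := Module.apply_evalEquiv_symm_apply (R := ℂ) (M := E) (α : E →ₗ[ℂ] ℂ)
    (Φ ∘ₗ (c : (E →ₗ[ℂ] ℂ) →ₗ[ℂ] (E →L[ℂ] ℂ)))
  have h1 : (Φ ∘ₗ (c : (E →ₗ[ℂ] ℂ) →ₗ[ℂ] (E →L[ℂ] ℂ))) (α : E →ₗ[ℂ] ℂ) = Φ α := rfl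
  rw [h1, ContinuousLinearMap.coe_coe] at h
  rw [h, ← RCLike.re_to_complex]
  exact (Module.Dual.re_extendRCLike_apply φ α).symm

/-- A vector on which the annihilator of a subspace vanishes lies in the subspace. -/
theorem mem_of_annihilator_apply_eq_zero {T : Submodule ℂ E} {v : E}
    (h : ∀ α ∈ IntegrableSystem.annihilator T, (α v).re = 0) : v ∈ T := by
  by_contra hv
  obtain ⟨f, hf, hT⟩ := Submodule.exists_le_ker_of_notMem hv
  let F : E →L[ℂ] ℂ := LinearMap.toContinuousLinearMap f
  have hF : F ∈ IntegrableSystem.annihilator T := fun w hw => hT hw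
  refine hf (Complex.ext (h F hF) ?_)
  have := h _ ((IntegrableSystem.annihilator T).smul_mem Complex.I hF)
  simpa [F] using this

/-- If the elements of a lattice that annihilate a subspace span its annihilator, then the subspace
is spanned by elements of the dual lattice. -/
theorem span_dual_lattice {T : Submodule ℂ E} (Γ : Submodule ℤ (E →L[ℂ] ℂ)) [DiscreteTopology Γ]
    [IsZLattice ℝ Γ]
    (hW : Submodule.span ℝ
      {w : IntegrableSystem.annihilator T | (w : E →L[ℂ] ℂ) ∈ Γ} = ⊤) :
    Submodule.span ℝ {v : E | v ∈ T ∧ ∀ α ∈ Γ, ∃ k : ℤ, (α v).re = k} =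
      T.restrictScalars ℝ := by
  have : FiniteDimensional ℝ (E →L[ℂ] ℂ) := FiniteDimensional.complexToReal _
  have : Module.Finite ℤ Γ := ZLattice.module_finite ℝ Γ
  have : Module.Free ℤ Γ := ZLattice.module_free ℝ Γ
  apply le_antisymm
  · rw [Submodule.span_le]
    exact fun v hv => hv.1
  let A := IntegrableSystem.annihilator T
  let Γ' : Submodule ℤ Γ := (A.restrictScalars ℤ).comap Γ.subtype
  -- `A` is a complex subspace, so `n • x ∈ A` with `n ≠ 0` forces `x ∈ A`. The finitely generated
  -- quotient is then free, and its coordinate functions will provide the spanning vectors.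
  have htf : IsAddTorsionFree (Γ ⧸ Γ') := by
    refine ⟨fun n hn x y hxy => ?_⟩
    obtain ⟨x, rfl⟩ := Γ'.mkQ_surjective x
    obtain ⟨y, rfl⟩ := Γ'.mkQ_surjective y
    simp only [← map_nsmul] at hxy
    simp only [Submodule.mkQ_apply] at hxy ⊢
    rw [Submodule.Quotient.eq] at hxy ⊢
    have h1 : n • ((x - y : Γ) : E →L[ℂ] ℂ) ∈ A := by
      have h2 : ((n • x - n • y : Γ) : E →L[ℂ] ℂ) ∈ A := hxy
      rwa [← smul_sub] at h2
    change ((x - y : Γ) : E →L[ℂ] ℂ) ∈ A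
    rw [← Nat.cast_smul_eq_nsmul ℂ] at h1
    exact (A.smul_mem_iff (Nat.cast_ne_zero.2 hn)).1 h1
  have : Module.Free ℤ (Γ ⧸ Γ') := Module.free_of_finite_type_torsion_free'
  let β := Module.Free.chooseBasis ℤ (Γ ⧸ Γ')
  let bΓ := Module.Free.chooseBasis ℤ Γ
  let bV := bΓ.ofZLatticeBasis ℝ Γ
  choose c hc using fun j => Γ'.mkQ_surjective (β j)
  have hspan : Submodule.span ℝ (Γ : Set (E →L[ℂ] ℂ)) = ⊤ := IsZLattice.span_top
  -- An integral functional on `Γ` extends real-linearly, since a `ℤ`-basis of `Γ` is a real basis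
  -- of the dual space; the extension is then the real part of an evaluation.
  have hext : ∀ j, ∃ v : E, ∀ γ : Γ, ((γ : E →L[ℂ] ℂ) v).re = β.coord j (Γ'.mkQ γ) := by
    intro j
    let φ : (E →L[ℂ] ℂ) →ₗ[ℝ] ℝ := bV.constr ℝ fun i => ((β.coord j (Γ'.mkQ (bΓ i)) : ℤ) : ℝ)
    obtain ⟨v, hv⟩ := exists_eq_re_eval φ
    refine ⟨v, fun γ => ?_⟩
    rw [← hv]
    have h : (φ.restrictScalars ℤ ∘ₗ Γ.subtype) =
        (Int.castAddHom ℝ).toIntLinearMap ∘ₗ β.coord j ∘ₗ Γ'.mkQ := by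
      refine bΓ.ext fun i => ?_
      have h1 : ((bΓ i : Γ) : E →L[ℂ] ℂ) = bV i := (bΓ.ofZLatticeBasis_apply ℝ Γ i).symm
      change φ (bΓ i : Γ) = _
      rw [h1]
      exact bV.constr_basis ℝ _ i
    exact LinearMap.congr_fun h γ
  choose v hv using hext
  -- `Re α (v j)` vanishes for `α` in `Γ'`, hence for all `α` in its real span, which is the
  -- annihilator by `hW`.
  have hvT : ∀ j, v j ∈ T := by
    intro j
    refine mem_of_annihilator_apply_eq_zero fun α hα => ?_
    let ψ : A →ₗ[ℝ] ℝ :=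
      { toFun := fun w => ((w : E →L[ℂ] ℂ) (v j)).re
        map_add' := by simp
        map_smul' := by simp }
    have h : (⊤ : Submodule ℝ A) ≤ LinearMap.ker ψ := by
      rw [← hW, Submodule.span_le]
      intro w hw
      have h1 : Γ'.mkQ ⟨w, hw⟩ = 0 := by
        rw [Submodule.mkQ_apply, Submodule.Quotient.mk_eq_zero]
        exact w.2
      have h2 := hv j ⟨w, hw⟩
      rw [h1, map_zero, Int.cast_zero] at h2
      exact h2
    exact h (Submodule.mem_top (x := (⟨α, hα⟩ : A)))
  intro t ht
  -- Modulo `Γ'`, which kills `t`, each `γ` is the sum of its coordinates times the lifts `c j`. So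
  -- both sides pair equally with `Γ`, and thus with its real span, the whole dual space.
  have hsum : t = ∑ j, ((c j : E →L[ℂ] ℂ) t).re • v j := by
    refine eq_of_re_eval_eq fun α => ?_
    let ψ : (E →L[ℂ] ℂ) →ₗ[ℝ] ℝ :=
      { toFun := fun α => (α t).re - (α (∑ j, ((c j : E →L[ℂ] ℂ) t).re • v j)).re
        map_add' := fun α α' => by
          simp only [add_apply, Complex.add_re]
          ring
        map_smul' := fun r α => by
          simp only [smul_apply, Complex.real_smul, Complex.re_ofReal_mul,
            RingHom.id_apply, smul_eq_mul]
          ring }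
    have h : (⊤ : Submodule ℝ (E →L[ℂ] ℂ)) ≤ LinearMap.ker ψ := by
      rw [← hspan, Submodule.span_le]
      intro γ hγ
      have h1 : (⟨γ, hγ⟩ - ∑ j, (β.coord j (Γ'.mkQ ⟨γ, hγ⟩)) • c j : Γ) ∈ Γ' := by
        rw [← Submodule.Quotient.mk_eq_zero, ← Submodule.mkQ_apply, map_sub, map_sum, sub_eq_zero]
        simp only [map_smul, hc]
        exact (β.sum_repr _).symm
      have h2 : ((⟨γ, hγ⟩ - ∑ j, (β.coord j (Γ'.mkQ ⟨γ, hγ⟩)) • c j : Γ) : E →L[ℂ] ℂ) t = 0 :=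
        h1 t ht
      have h3 : γ t = ∑ j, (β.coord j (Γ'.mkQ ⟨γ, hγ⟩) : ℂ) * (c j : E →L[ℂ] ℂ) t := by
        simpa [sub_eq_zero, sum_apply] using h2
      change (γ t).re - (γ (∑ j, ((c j : E →L[ℂ] ℂ) t).re • v j)).re = 0
      rw [h3, map_sum, Complex.re_sum, Complex.re_sum, sub_eq_zero]
      refine Finset.sum_congr rfl fun j _ => ?_
      have h4 : γ (((c j : E →L[ℂ] ℂ) t).re • v j) = ((c j : E →L[ℂ] ℂ) t).re • γ (v j) :=
        (γ.restrictScalars ℝ).map_smul _ _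
      have h5 : (γ (v j)).re = β.coord j (Γ'.mkQ ⟨γ, hγ⟩) := hv j ⟨γ, hγ⟩
      rw [h4, Complex.smul_re, h5, ← Complex.ofReal_intCast, Complex.re_ofReal_mul, smul_eq_mul,
        mul_comm]
    exact sub_eq_zero.1 (h (Submodule.mem_top (x := α)))
  rw [hsum]
  refine Submodule.sum_mem _ fun j _ => Submodule.smul_mem _ _ (Submodule.subset_span ⟨hvT j, ?_⟩)
  exact fun α hα => ⟨_, hv j ⟨α, hα⟩⟩

end LinearAlgebra

end

end VisibleLagrangian

end

/-! ### The theorem -/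

open VisibleLagrangian Manifold in
theorem theorem2p4
    {EM EB : Type*}
    [NormedAddCommGroup EM] [NormedSpace ℂ EM] [FiniteDimensional ℂ EM]
    [NormedAddCommGroup EB] [NormedSpace ℂ EB] [FiniteDimensional ℂ EB]
    {M : Type*} [TopologicalSpace M] [T2Space M] [ChartedSpace EM M] [IsManifold 𝓘(ℂ, EM) ω M]
    {B : Type*} [TopologicalSpace B] [T2Space B] [ChartedSpace EB B] [IsManifold 𝓘(ℂ, EB) ω B]
    (𝓢 : IntegrableSystem EM EB M B) (L : Set M) (B' S' : Set B)
    (hL : 𝓢.IsVisibleLagrangian L B' S') (hreg : B' \ S' ⊆ 𝓢.regularLocus)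
    (b : B) (hb : b ∈ B' \ S') (T : Submodule ℂ (TangentSpace 𝓘(ℂ, EB) b))
    (hT : IsSmoothPointWithTangent B' b T) :
    𝓢.IsRationalSubspace b T ∧
      ∀ m ∈ L ∩ 𝓢.H ⁻¹' {b},
        𝓢.IsTorusGeneratedBy b (IntegrableSystem.annihilator T)
          (connectedComponentIn (L ∩ 𝓢.H ⁻¹' {b}) m) := by
  have hbS : b ∉ 𝓢.S := hreg hb
  obtain ⟨p, ⟨hpc, hr, hinj, Γ, hd, hZ, hΓ⟩, he⟩ := 𝓢.exists_covector_parametrization hbS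
  have hcomp := fun (x : EB →L[ℂ] ℂ) (hx : p x ∈ L) =>
    𝓢.fibre_components hL hb hbS hT hpc hr hinj he hΓ hx
  constructor
  -- Rationality needs a point of `L` over `b`, since spanning by periods is deduced from an orbit
  -- through such a point; the non-empty bundle fibre provides it.
  · obtain ⟨U, -, hbU, d, F, _, _, _, ⟨y⟩, Φ, Ψ, -, -, hΦ, -⟩ := hL.bundle b hb
    obtain ⟨hy, hyb, -⟩ := hΦ b ⟨hb, hbU⟩ y
    obtain ⟨x, hx⟩ : Φ (b, y) ∈ Set.range p := hr ▸ hyb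
    have hspan := span_dual_lattice Γ (hcomp x (hx ▸ hy)).2
    apply le_antisymm
    · rw [Submodule.span_le]
      exact fun v hv => hv.1
    · rw [← hspan]
      -- The multiple `N = 1` suffices: vectors integral on `Γ` are already integral on the smaller
      -- or equal period lattice.
      refine Submodule.span_mono fun v hv => ⟨hv.1, 1, one_ne_zero, ?_⟩
      rw [one_smul]
      exact fun α hα => hv.2 α (𝓢.periodLattice_subset hbS hpc hinj
        (ContinuousLinearEquiv.refl ℂ _) he hΓ hα)
  · rintro m ⟨hmL, hmb⟩
    obtain ⟨x, rfl⟩ : m ∈ Set.range p := hr ▸ hmb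
    obtain ⟨h1, h2⟩ := hcomp x hmL
    rw [h1]
    exact 𝓢.isTorusGeneratedBy_orbit hpc hinj he hΓ _ h2 x
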